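/- Let $k$ be a field, $R=k[[x,y]]$, $R_t=R[[t]]=k[[x,y,t]]$. For an ideal $I\subset R_t$ let $I_0\subset R$ be its image under $t\mapsto 0$. For $y\in R$ and an integer $p\ge 1$ put $$\operatorname{Tr}(I\,|\,y,p)=\frac{\bigl((I+(y)):t^{p-1}\bigr)_0}{(y)}\subset R/(y),\qquad \widetilde{\operatorname{Res}}(I\,|\,y,p)=(I+(t^p)):y\subset R_t .$$ Given $\mathfrak y=(y_1,\dots,y_M)\in R^M$ and integers $\mathbf p=(p_1\ge\dots\ge p_M\ge 1)$, put $J_0=I$, $J_i=\widetilde{\operatorname{Res}}(J_{i-1}\,|\,y_i,p_i)$, and let $$\operatorname{Tr}_i=\operatorname{Tr}(J_{i-1}\,|\,y_i,p_i),\quad \operatorname{Res}_i=(J_i)_0,\quad \operatorname{tr}_i=\dim_k \frac{R/(y_i)}{\operatorname{Tr}_i},\quad \operatorname{res}_i=\dim_k R/\operatorname{Res}_i ,$$ so that $\operatorname{Res}_0=I_0$. A staircase is a subset $E\subset\mathbb Z_{\ge0}^2$ with $E+\mathbb Z_{\ge0}^2\subset E$. Put $\ell_E(i)=\min\{e\mid(e,i)\in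 E\}$, $h_E(i)=\min\{e\mid (i,e)\in E\}$, $\hat\ell_E(i)=\ell_E(i)-\ell_E(i+1)$ and $\tau(E,i)=\{(e_1,e_2)\mid(e_1+i,e_2)\in E\}$. The staircase $E$ is gentle if $h_E(i)\le h_E(i+1)+1$ for all $i$. With $f=x+y+t$ put $I_E=(x^{e_1}f^{e_2})_{(e_1,e_2)\in E}\subset R_t$. For positive integers $\mathbf m=(m_1,\dots,m_\mu)$ with $M=\sum m_i$, let $\mathfrak y_{\mathbf m}\in R^M$ be the concatenation of $\mu$ blocks $(y,x,\dots,x)$ of lengths $m_1,\dots,m_\mu$, and put $n_i=\sum_{j<i}(m_j-1)$ for $1\le i\le\mu+1$, so that $n_{\mu+1}=M-\mu$. **Theorem.** Let $E$ be a gentle staircase with finite complement, $\mu\ge1$, and let $\mathbf m=(m_1,\dots,m_\mu)$ and $tr_1<\dots<tr_\mu$ be positive integers. Assume that 1. $\hat\ell_E(tr_i-1)\ge tr_i+1$ for all $i<\mu$; 2. $\ell_E(tr_i-1)-\ell_E(tr_{i+1}-1)\ge h_E(n_i)$ for all $i<\mu$; 3. $\ell_E(tr_\mu-1)>n_{\mu+1}$;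 4. if $\ell_E(tr_\mu)>n_\mu$, then $\hat\ell_E(tr_\mu-1)\ge tr_\mu+1$. Then there is a unique staircase $E^\flat$ with finite complement such that $\hat\ell_{E^\flat}(tr_i-1)=\hat\ell_E(tr_i-1)-1$ for $i=1,\dots,\mu$ and $\hat\ell_{E^\flat}(j)=\hat\ell_E(j)$ whenever $j+1\notin\{tr_1,\dots,tr_\mu\}$, and there are integers $p_1\ge\dots\ge p_M\ge1$ such that, for $I=I_E$ and $\mathfrak y=\mathfrak y_{\mathbf m}$: 1. $\operatorname{tr}_{j+n_j}=tr_j$ for $j=1,\dots,\mu$; 2. $\operatorname{tr}_i=h_E(i-j-1)$ whenever $1\le j\le\mu$ and $j+n_j<i\le j+n_{j+1}$; 3. $\operatorname{Res}_M=(I_{E'})_0$, where $E'=\tau(E^\flat,M-\mu)$; that is, $E'$ is obtained from $E$ by deleting from its complement the leftmost $M-\mu$ slices and $\mu$ further slices of heights $tr_1,\dots,tr_\mu$. In particular the number of conditions is preserved: $\operatorname{res}_M+\sum_{i=1}^M\operatorname{tr}_i=\operatorname{res}_0=\dim_kR/(I_E)_0$. -/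

import Mathlib

noncomputable section

namespace StaircaseTraces

/-! ### Higher order traces and residuals

For a commutative ring `R`, the ring `R_t` is `R⟦t⟧ = PowerSeries R`, and `t = PowerSeries.X`.
Sequences `(y_1, …, y_m)`, `(p_1, …, p_m)` are functions on `ℕ` of which only the values at
`1, …, m` are used. -/

section TracesAndResiduals

variable {R : Type*} [CommRing R]

/-- `I_0 ⊆ R`, the image of an ideal `I ⊆ R_t` under `t ↦ 0`. -/
def specialFibre (I : Ideal (PowerSeries R)) : Ideal R :=
  I.map (PowerSeries.constantCoeff : PowerSeries R →+* R)

/-- The trace ideal `((I + (y)) : t^(p-1))_0 / (y) ⊆ R / (y)`, for `p ≥ 1`. -/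
def traceIdeal (I : Ideal (PowerSeries R)) (y : R) (p : ℕ) : Ideal (R ⧸ Ideal.span {y}) :=
  (specialFibre (Submodule.colon (I ⊔ Ideal.span {PowerSeries.C y})
    {(PowerSeries.X : PowerSeries R) ^ (p - 1)})).map (Ideal.Quotient.mk (Ideal.span {y}))

/-- The residual family `(I + (t^p)) : y ⊆ R_t`. -/
def residualFamily (I : Ideal (PowerSeries R)) (y : R) (p : ℕ) : Ideal (PowerSeries R) :=
  Submodule.colon (I ⊔ Ideal.span {(PowerSeries.X : PowerSeries R) ^ p}) {PowerSeries.C y}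

/-- The iterated residual family: the `0`-th one is `I`, and the `i`-th one is the residual family
of the `(i-1)`-st one with respect to `y_i` and `p_i`. -/
def iterResidualFamily (I : Ideal (PowerSeries R)) (y : ℕ → R) (p : ℕ → ℕ) :
    ℕ → Ideal (PowerSeries R)
  | 0 => I
  | i + 1 => residualFamily (iterResidualFamily I y p i) (y (i + 1)) (p (i + 1))

/-- The `i`-th iterated trace ideal, `i ≥ 1`: the trace ideal of the `(i-1)`-st residual family
with respect to `y_i` and `p_i`. -/
def iterTrace (I : Ideal (PowerSeries R)) (y : ℕ → R) (p : ℕ → ℕ) (i : ℕ) :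
    Ideal (R ⧸ Ideal.span {y i}) :=
  traceIdeal (iterResidualFamily I y p (i - 1)) (y i) (p i)

/-- The `i`-th iterated residual ideal; for `i = 0` it is `I_0`. -/
def iterResidual (I : Ideal (PowerSeries R)) (y : ℕ → R) (p : ℕ → ℕ) (i : ℕ) : Ideal R :=
  specialFibre (iterResidualFamily I y p i)

/-- `dim_k` of the quotient of `R / (y_i)` by the `i`-th iterated trace ideal. -/
def traceDim (k : Type*) [Field k] [Algebra k R] (I : Ideal (PowerSeries R)) (y : ℕ → R)
    (p : ℕ → ℕ) (i : ℕ) : Cardinal :=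
  Module.rank k ((R ⧸ Ideal.span {y i}) ⧸ iterTrace I y p i)

/-- `dim_k` of the quotient of `R` by the `i`-th iterated residual ideal. -/
def residualDim (k : Type*) [Field k] [Algebra k R] (I : Ideal (PowerSeries R)) (y : ℕ → R)
    (p : ℕ → ℕ) (i : ℕ) : Cardinal :=
  Module.rank k (R ⧸ iterResidual I y p i)

end TracesAndResiduals

/-! ### Staircases -/

/-- A staircase: a subset `E` of `ℕ²` with `E + ℕ² ⊆ E`. -/
def IsStaircase (E : Set (ℕ × ℕ)) : Prop :=
  ∀ a ∈ E, ∀ b : ℕ × ℕ, a + b ∈ E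

/-- The length `ℓ_E(i) = min {e | (e, i) ∈ E}` of the `i`-th stair. -/
def stairLength (E : Set (ℕ × ℕ)) (i : ℕ) : ℕ :=
  sInf {e | (e, i) ∈ E}

/-- The height `h_E(i) = min {e | (i, e) ∈ E}` of the `i`-th slice. -/
def sliceHeight (E : Set (ℕ × ℕ)) (i : ℕ) : ℕ :=
  sInf {e | (i, e) ∈ E}

/-- The first difference `ℓ_E(i) - ℓ_E(i+1)` of the stair lengths, as an integer. -/
def stairDiff (E : Set (ℕ × ℕ)) (i : ℕ) : ℤ :=
  (stairLength E i : ℤ) - (stairLength E (i + 1) : ℤ)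

/-- A staircase is gentle if it has no steps of height greater than one. -/
def IsGentle (E : Set (ℕ × ℕ)) : Prop :=
  ∀ i, sliceHeight E i ≤ sliceHeight E (i + 1) + 1

/-- The horizontal translation `τ(E, i) = {(e₁, e₂) | (e₁ + i, e₂) ∈ E}`. -/
def horizTranslate (E : Set (ℕ × ℕ)) (i : ℕ) : Set (ℕ × ℕ) :=
  {e | (e.1 + i, e.2) ∈ E}

/-- `F` is a staircase with finite complement obtained from `E` by lowering by one the
differences of stair lengths at `tr_1 - 1, …, tr_μ - 1`, and keeping all other differences. -/
def IsSliceDeletion (E : Set (ℕ × ℕ)) (μ : ℕ) (tr : ℕ → ℕ) (F : Set (ℕ × ℕ)) : Prop :=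
  IsStaircase F ∧ Fᶜ.Finite ∧
    (∀ i ∈ Finset.Icc 1 μ, stairDiff F (tr i - 1) = stairDiff E (tr i - 1) - 1) ∧
    (∀ j, (∀ i ∈ Finset.Icc 1 μ, j + 1 ≠ tr i) → stairDiff F j = stairDiff E j)

/-! ### The moving monomial ideals and the sequences `𝔶_𝐦` -/

/-- The ring `k[[x, y]]`. -/
abbrev PlaneRing (k : Type*) [Field k] : Type _ := MvPowerSeries (Fin 2) k

/-- The coordinate `x` of `k[[x, y]]`. -/
def coordX (k : Type*) [Field k] : PlaneRing k := MvPowerSeries.X 0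

/-- The coordinate `y` of `k[[x, y]]`. -/
def coordY (k : Type*) [Field k] : PlaneRing k := MvPowerSeries.X 1

/-- The series `f = x + y + t` in `k[[x, y]][[t]]`. -/
def movingLine (k : Type*) [Field k] : PowerSeries (PlaneRing k) :=
  PowerSeries.C (coordX k) + PowerSeries.C (coordY k) + PowerSeries.X

/-- `I_E = (x^e₁ f^e₂ | (e₁, e₂) ∈ E) ⊆ k[[x, y]][[t]]`. -/
def staircaseIdeal (k : Type*) [Field k] (E : Set (ℕ × ℕ)) : Ideal (PowerSeries (PlaneRing k)) :=
  Ideal.span ((fun e : ℕ × ℕ => PowerSeries.C (coordX k) ^ e.1 * movingLine k ^ e.2) '' E)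

/-- The sequence `𝔶_𝐦`, the concatenation of `μ` blocks `(y, x, …, x)` of lengths
`m_1, …, m_μ`: its entry is `y` at the positions `1 + m_1 + ⋯ + m_(j-1)`, `1 ≤ j ≤ μ`, and `x`
at all others. -/
def blockSeq (k : Type*) [Field k] (μ : ℕ) (m : ℕ → ℕ) (i : ℕ) : PlaneRing k :=
  if i ∈ (Finset.Icc 1 μ).image (fun j => 1 + ∑ l ∈ Finset.Ico 1 j, m l) then coordY k
  else coordX k

/-- `n_i = ∑_{j < i} (m_j - 1)`, the number of entries `x` in the first `i - 1` blocks. -/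
def xCount (m : ℕ → ℕ) (i : ℕ) : ℕ :=
  ∑ j ∈ Finset.Ico 1 i, (m j - 1)

end StaircaseTraces

end

open StaircaseTraces

/-! In the coordinates X = x, F = f, T = t the line y becomes s - T with s = F - X, and I_E becomes
a monomial ideal free of T. Each step depends on the current family J only through J + (t^p)
(`colon_sup_span_pow`). These ideals contain powers of all variables, so everything can be computed
in k[X][F][T] (`comap_map_familyHom`, `exists_sub_familyHom_mem`).

Gentleness makes s divide like X: s^n g lies in the ideal of E exactly when g lies in that of τ(E,
n) (`pow_mul_mem_monomialIdeal_iff`). Hence, modulo I_E + (T^p), every solution g of (s - T) g ∈ I_E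
+ (T^p) is the truncated series s^(p-1) (1 - T/s)^(-1) times a coefficient in the ideal of τ(E, p)
(`exists_sub_binomTrunc_mul_mem`). At the y-step of block j the monomial part is τ(E, n_j) and p =
ℓ_E(tr_j - 1) - n_j. The new coefficient staircase is therefore V_j = τ(E, ℓ_E(tr_j - 1)), and the
trace reads the height of slice ℓ_E(tr_j - 1) - 1 of E, which is tr_j.

Later steps act on these generators in a simple way. Division by s - T raises the exponent r in (1 -
T/s)^(-r) and divides the coefficient by s. Division by x divides the coefficient by X. Lowering p
by c multiplies the coefficient by s^c. So the coefficients of the i-th generator behave like V_i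
shifted by some a_i. They are not computed exactly: `IsControlled` bounds them from below by
multiples of `truncPow` and from above by the ideal of `slantShift`. The divisions work while
F^(a_i) lies in the current monomial ideal, which hypothesis 2 ensures. The same condition hides the
extra generators from the traces.

At the last y-step p drops to 1, so the series become 1 and T disappears. Adding the translates of
V_μ, …, V_1 by their a_i to τ(E, n_μ) is then exactly the deletion of slices of heights tr_μ, …,
tr_1 (`IsControlled.eq_of_deletion_chain`, `IsAdmissible.blockResidual_last`). Hypotheses 1 and 4
keep the partial deletions diagonal, so the lower terms of `truncPow` lie in ideals already
obtained. Hypothesis 3 keeps the heights of the leftmost M - μ slices unchanged. -/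

namespace StaircaseTraces

/-! ### The polynomial model k[X][F][T] and its evaluations. -/

section PlanePolynomials

variable (k : Type*) [Field k]

/-- The polynomial ring `k[X][F]`. -/
def PlanePoly : Type _ := Polynomial (Polynomial k)

noncomputable instance planePolyCommRing : CommRing (PlanePoly k) :=
  inferInstanceAs (CommRing (Polynomial (Polynomial k)))

noncomputable instance planePolyAlgebra : Algebra k (PlanePoly k) :=
  inferInstanceAs (Algebra k (Polynomial (Polynomial k)))

/-- The polynomial ring `k[X][F][T]`. -/
abbrev FamilyPoly : Type _ := Polynomial (PlanePoly k)

/-- The variable `X` of `k[X][F]`. -/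
noncomputable def varX : PlanePoly k := (Polynomial.C Polynomial.X : Polynomial (Polynomial k))

/-- The variable `F` of `k[X][F]`. -/
noncomputable def varF : PlanePoly k := (Polynomial.X : Polynomial (Polynomial k))

/-- The homomorphism from `k[X][F]` with prescribed values at `X` and `F`. -/
noncomputable def planeEval {Q : Type*} [CommRing Q] [Algebra k Q] (x f : Q) :
    PlanePoly k →ₐ[k] Q :=
  { Polynomial.eval₂RingHom (Polynomial.aeval x : Polynomial k →ₐ[k] Q).toRingHom f with
    commutes' := fun r => by
      change Polynomial.eval₂ _ _ (Polynomial.C (Polynomial.C r)) = _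
      rw [Polynomial.eval₂_C]
      exact Polynomial.aeval_C _ r }

section Eval

variable {k} {Q : Type*} [CommRing Q] [Algebra k Q] (x f t : Q)

@[simp] theorem planeEval_varX : planeEval k x f (varX k) = x := by
  change Polynomial.eval₂ _ _ (Polynomial.C Polynomial.X) = _
  rw [Polynomial.eval₂_C]
  exact Polynomial.aeval_X _

@[simp] theorem planeEval_varF : planeEval k x f (varF k) = f := by
  change Polynomial.eval₂ _ _ Polynomial.X = _
  rw [Polynomial.eval₂_X]

variable (k) in
/-- The homomorphism from `k[X][F][T]` with prescribed values at `X`, `F` and `T`. -/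
noncomputable def familyEval : FamilyPoly k →ₐ[k] Q :=
  { Polynomial.eval₂RingHom (planeEval k x f).toRingHom t with
    commutes' := fun r => by
      change Polynomial.eval₂ _ _ (Polynomial.C (algebraMap k _ r)) = _
      rw [Polynomial.eval₂_C]
      exact (planeEval k x f).commutes r }

@[simp] theorem familyEval_C (g : PlanePoly k) :
    familyEval k x f t (Polynomial.C g) = planeEval k x f g := by
  change Polynomial.eval₂ _ _ (Polynomial.C g) = _
  rw [Polynomial.eval₂_C]; rfl

@[simp] theorem familyEval_X : familyEval k x f t Polynomial.X = t := by
  change Polynomial.eval₂ _ _ Polynomial.X = _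
  rw [Polynomial.eval₂_X]

theorem planePoly_algHom_ext {φ ψ : PlanePoly k →ₐ[k] Q} (hX : φ (varX k) = ψ (varX k))
    (hF : φ (varF k) = ψ (varF k)) : φ = ψ := by
  let φ' : Polynomial (Polynomial k) →+* Q := φ.toRingHom
  let ψ' : Polynomial (Polynomial k) →+* Q := ψ.toRingHom
  have : φ' = ψ' := by
    refine Polynomial.ringHom_ext' (Polynomial.ringHom_ext ?_ hX) hF
    intro a
    exact (φ.commutes a).trans (ψ.commutes a).symm
  exact AlgHom.ext fun a => DFunLike.congr_fun this a

theorem familyPoly_algHom_ext {φ ψ : FamilyPoly k →ₐ[k] Q}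
    (hX : φ (Polynomial.C (varX k)) = ψ (Polynomial.C (varX k)))
    (hF : φ (Polynomial.C (varF k)) = ψ (Polynomial.C (varF k)))
    (hT : φ Polynomial.X = ψ Polynomial.X) : φ = ψ := by
  have : (φ : FamilyPoly k →+* Q) = ψ := by
    refine Polynomial.ringHom_ext' ?_ hT
    let c : PlanePoly k →ₐ[k] FamilyPoly k := { Polynomial.C with commutes' := fun r => rfl }
    have := planePoly_algHom_ext (φ := φ.comp c) (ψ := ψ.comp c) hX hF
    exact RingHom.ext fun a => DFunLike.congr_fun this a
  exact AlgHom.ext fun a => DFunLike.congr_fun this a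

end Eval

end PlanePolynomials

/-! ### Coefficients of polynomials in X and F. -/

section Coefficients

variable {k : Type*} [Field k]

/-- The coefficient of `X^a F^b`. -/
noncomputable def planeCoeff (a b : ℕ) : PlanePoly k →ₗ[k] k :=
  (Polynomial.lcoeff k a).comp
    ((Polynomial.lcoeff (Polynomial k) b).restrictScalars k :
      Polynomial (Polynomial k) →ₗ[k] Polynomial k)

theorem planeCoeff_varX_mul_succ (a b : ℕ) (g : PlanePoly k) :
    planeCoeff (a + 1) b (varX k * g) = planeCoeff a b g := by
  let g' : Polynomial (Polynomial k) := g
  change Polynomial.coeff (Polynomial.coeff (Polynomial.C Polynomial.X *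
    g') b) (a + 1) = _
  rw [Polynomial.coeff_C_mul, Polynomial.coeff_X_mul]; rfl

theorem planeCoeff_varX_mul_zero (b : ℕ) (g : PlanePoly k) :
    planeCoeff 0 b (varX k * g) = 0 := by
  let g' : Polynomial (Polynomial k) := g
  change Polynomial.coeff (Polynomial.coeff (Polynomial.C Polynomial.X *
    g') b) 0 = _
  rw [Polynomial.coeff_C_mul, Polynomial.coeff_X_mul_zero]

theorem planeCoeff_varF_mul_succ (a b : ℕ) (g : PlanePoly k) :
    planeCoeff a (b + 1) (varF k * g) = planeCoeff a b g := by
  let g' : Polynomial (Polynomial k) := g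
  change Polynomial.coeff (Polynomial.coeff (Polynomial.X *
    g') (b + 1)) a = _
  rw [Polynomial.coeff_X_mul]; rfl

theorem planeCoeff_varF_mul_zero (a : ℕ) (g : PlanePoly k) :
    planeCoeff a 0 (varF k * g) = 0 := by
  let g' : Polynomial (Polynomial k) := g
  change Polynomial.coeff (Polynomial.coeff (Polynomial.X *
    g') 0) a = _
  rw [Polynomial.coeff_X_mul_zero, Polynomial.coeff_zero]

theorem planePoly_ext {g g' : PlanePoly k} (h : ∀ a b, planeCoeff a b g = planeCoeff a b g') :
    g = g' :=
  Polynomial.ext fun b => Polynomial.ext fun a => h a b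

theorem exists_planeCoeff_eq_zero (g : PlanePoly k) :
    ∃ N : ℕ, ∀ a b, N ≤ a ∨ N ≤ b → planeCoeff a b g = 0 := by
  let g' : Polynomial (Polynomial k) := g
  let M := g'.support.sup fun b => (g'.coeff b).natDegree
  refine ⟨g'.natDegree + M + 1, fun a b hab => ?_⟩
  change (g'.coeff b).coeff a = 0
  by_cases hb : b ∈ g'.support
  · have h1 := Finset.le_sup (f := fun b => (g'.coeff b).natDegree) hb
    have h2 := Polynomial.le_natDegree_of_mem_supp b hb
    refine Polynomial.coeff_eq_zero_of_natDegree_lt ?_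
    have h3 : (g'.coeff b).natDegree ≤ M := h1
    omega
  · rw [Polynomial.notMem_support_iff.1 hb, Polynomial.coeff_zero]

theorem planeCoeff_monomial_of_ne {i j a b : ℕ} (h : (i, j) ≠ (a, b)) :
    planeCoeff a b (varX k ^ i * varF k ^ j) = 0 := by
  induction i generalizing a with
  | zero =>
    rw [pow_zero, one_mul]
    induction j generalizing b with
    | zero =>
      rw [pow_zero]
      change Polynomial.coeff (Polynomial.coeff (1 : Polynomial (Polynomial k)) b) a = 0
      rw [Polynomial.coeff_one]
      split_ifs with hb
      · rw [Polynomial.coeff_one, if_neg]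
        rintro rfl; exact h (by rw [hb])
      · rw [Polynomial.coeff_zero]
    | succ j ih =>
      rw [pow_succ']
      cases b with
      | zero => exact planeCoeff_varF_mul_zero ..
      | succ b =>
        rw [planeCoeff_varF_mul_succ]
        exact ih fun h' => h (by simp_all)
  | succ i ih =>
    rw [pow_succ', mul_assoc]
    cases a with
    | zero => exact planeCoeff_varX_mul_zero ..
    | succ a =>
      rw [planeCoeff_varX_mul_succ]
      exact ih fun h' => h (by simp_all)

theorem planeCoeff_monomial_self (i j : ℕ) :
    planeCoeff i j (varX k ^ i * varF k ^ j) = 1 := by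
  induction i with
  | zero =>
    rw [pow_zero, one_mul]
    induction j with
    | zero =>
      rw [pow_zero]
      change Polynomial.coeff (Polynomial.coeff (1 : Polynomial (Polynomial k)) 0) 0 = 1
      simp
    | succ j ih => rw [pow_succ', planeCoeff_varF_mul_succ, ih]
  | succ i ih => rw [pow_succ', mul_assoc, planeCoeff_varX_mul_succ, ih]

theorem planePoly_eq_sum (g : PlanePoly k) : ∃ N : ℕ,
    g = ∑ e ∈ Finset.range N ×ˢ Finset.range N,
      planeCoeff e.1 e.2 g • (varX k ^ e.1 * varF k ^ e.2) := by
  obtain ⟨N, hN⟩ := exists_planeCoeff_eq_zero g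
  refine ⟨N, planePoly_ext fun a b => ?_⟩
  rw [map_sum]
  simp only [map_smul, smul_eq_mul]
  by_cases hab : (a, b) ∈ Finset.range N ×ˢ Finset.range N
  · rw [Finset.sum_eq_single (a, b), planeCoeff_monomial_self, mul_one]
    · intro e _ he
      rw [planeCoeff_monomial_of_ne he, mul_zero]
    · intro h; exact absurd hab h
  · rw [hN a b, Finset.sum_eq_zero]
    · intro e he
      rw [planeCoeff_monomial_of_ne, mul_zero]
      intro h
      exact hab (h ▸ he)
    · rw [Finset.mem_product, Finset.mem_range, Finset.mem_range] at hab
      simp only at hab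
      omega

theorem planePoly_induction {P : PlanePoly k → Prop} (h0 : P 0)
    (hadd : ∀ g g', P g → P g' → P (g + g'))
    (hmon : ∀ (c : k) a b, P (c • (varX k ^ a * varF k ^ b))) (g : PlanePoly k) : P g := by
  obtain ⟨N, hN⟩ := planePoly_eq_sum g
  rw [hN]
  exact Finset.sum_induction _ P hadd h0 fun e _ => hmon _ _ _

end Coefficients

attribute [irreducible] planePolyCommRing planePolyAlgebra PlanePoly varX varF planeCoeff planeEval

end StaircaseTraces

namespace StaircaseTraces

/-! ### Comparison of k[X][F][T] with k[[x, y]][[t]]. -/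

section Interface

variable (k : Type*) [Field k]

/-- For the discrete topology nilpotent elements are topologically nilpotent, so power series can be
evaluated at them. -/
theorem exists_evalHom_of_isNilpotent {Q : Type*} [CommRing Q] [Algebra k Q]
    {x y t : Q} (hx : IsNilpotent x) (hy : IsNilpotent y) (ht : IsNilpotent t) :
    ∃ φ : PowerSeries (PlaneRing k) →ₐ[k] Q,
      φ (PowerSeries.C (coordX k)) = x ∧ φ (PowerSeries.C (coordY k)) = y ∧
        φ PowerSeries.X = t := by
  let : UniformSpace Q := ⊥
  let : UniformSpace k := ⊥
  have : DiscreteUniformity Q := ⟨rfl⟩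
  have : DiscreteUniformity k := ⟨rfl⟩
  have ha : MvPowerSeries.HasEval ![x, y] := by
    constructor
    · intro i
      fin_cases i
      · exact hx.isTopologicallyNilpotent
      · exact hy.isTopologicallyNilpotent
    · rw [Filter.cofinite_eq_bot]; exact Filter.tendsto_bot
  have : ContinuousSMul k Q := ⟨continuous_of_discreteTopology⟩
  let φ₀ : PlaneRing k →ₐ[k] Q := MvPowerSeries.aeval ha
  have hX : ∀ i, φ₀ (MvPowerSeries.X i) = ![x, y] i := by
    intro i
    rw [← MvPolynomial.coe_X, MvPowerSeries.aeval_coe, MvPolynomial.aeval_X]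
  -- For the evaluation in t, the discrete topology on k[[x, y]] makes the coefficient map
  -- continuous; t is nilpotent, so nothing finer is needed.
  let : UniformSpace (PlaneRing k) := ⊥
  have : DiscreteUniformity (PlaneRing k) := ⟨rfl⟩
  have hφ : Continuous (φ₀ : PlaneRing k →+* Q) := continuous_of_discreteTopology
  let ψ := PowerSeries.eval₂Hom hφ (a := t) ht.isTopologicallyNilpotent
  have hC : ∀ r, ψ (PowerSeries.C r) = φ₀ r := fun r => by
    simp only [ψ, PowerSeries.coe_eval₂Hom, PowerSeries.eval₂_C]; rfl
  refine ⟨{ ψ with commutes' := fun r => ?_ }, ?_, ?_, ?_⟩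
  · change ψ (algebraMap k _ r) = _
    rw [PowerSeries.algebraMap_apply, hC]; exact φ₀.commutes r
  · exact (hC _).trans (hX 0)
  · exact (hC _).trans (hX 1)
  · change ψ PowerSeries.X = t
    simp only [ψ, PowerSeries.coe_eval₂Hom, PowerSeries.eval₂_X]

/-- The homomorphism `k[X][F][T] → k[[x, y]][[t]]` with `X ↦ x`, `F ↦ f`, `T ↦ t`. -/
noncomputable def familyHom : FamilyPoly k →ₐ[k] PowerSeries (PlaneRing k) :=
  familyEval k (PowerSeries.C (coordX k)) (movingLine k) PowerSeries.X

@[simp] theorem familyHom_X : familyHom k Polynomial.X = PowerSeries.X := familyEval_X ..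

@[simp] theorem familyHom_varX :
    familyHom k (Polynomial.C (varX k)) = PowerSeries.C (coordX k) := by
  simp [familyHom]

@[simp] theorem familyHom_varF : familyHom k (Polynomial.C (varF k)) = movingLine k := by
  simp [familyHom]

/-- The ideal `(X^N, F^N, T^N)` of `k[X][F][T]`. -/
noncomputable def powerIdeal (N : ℕ) : Ideal (FamilyPoly k) :=
  Ideal.span {Polynomial.C (varX k) ^ N, Polynomial.C (varF k) ^ N, Polynomial.X ^ N}

/-- X, F, T are nilpotent modulo K, so x ↦ X, y ↦ F - X - T, t ↦ T defines a map from power series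
to the quotient by K. Its composite with `familyHom` is the quotient map, so its kernel contains the
extension of K and contracts to K. -/
theorem comap_map_familyHom {N : ℕ} {K : Ideal (FamilyPoly k)} (hK : powerIdeal k N ≤ K) :
    (K.map (familyHom k)).comap (familyHom k) = K := by
  refine le_antisymm ?_ Ideal.le_comap_map
  let mk : FamilyPoly k →ₐ[k] FamilyPoly k ⧸ K := Ideal.Quotient.mkₐ k K
  have hmk : ∀ a ∈ K, mk a = 0 := fun a ha => Ideal.Quotient.eq_zero_iff_mem.2 ha
  have nil : ∀ a, a ^ N ∈ K → IsNilpotent (mk a) := fun a ha =>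
    ⟨N, by rw [← map_pow]; exact hmk _ ha⟩
  have hX := nil (Polynomial.C (varX k)) (hK (Ideal.subset_span (by simp)))
  have hF := nil (Polynomial.C (varF k)) (hK (Ideal.subset_span (by simp)))
  have hT := nil Polynomial.X (hK (Ideal.subset_span (by simp)))
  obtain ⟨ρ, h1, h2, h3⟩ := exists_evalHom_of_isNilpotent k hX
    (((Commute.all _ _).isNilpotent_sub ((Commute.all _ _).isNilpotent_sub hF hX) hT)) hT
  have hρ : ρ.comp (familyHom k) = mk := by
    refine familyPoly_algHom_ext ?_ ?_ ?_
    · simp [h1]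
    · simp [movingLine, h1, h2, h3]; ring
    · simp [h3]
  intro g hg
  have hle : K.map (familyHom k) ≤ RingHom.ker ρ := by
    rw [Ideal.map_le_iff_le_comap]
    intro a ha
    rw [Ideal.mem_comap, RingHom.mem_ker]
    exact (DFunLike.congr_fun hρ a).trans (hmk a ha)
  have := hle (Ideal.mem_comap.1 hg)
  rw [RingHom.mem_ker] at this
  exact Ideal.Quotient.eq_zero_iff_mem.1 ((DFunLike.congr_fun hρ g).symm.trans this)

theorem exists_polynomial_add_X_pow_mul (L : ℕ) (r : PlaneRing k) :
    ∃ (q : MvPolynomial (Fin 2) k) (a b : PlaneRing k),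
      r = q + coordX k ^ L * a + coordY k ^ L * b := by
  classical
  let n : Fin 2 →₀ ℕ := Finsupp.equivFunOnFinite.symm fun _ => L
  let q := MvPowerSeries.trunc' k n r
  -- The terms of the remainder divisible by x^L. The others are divisible by y^L, since the
  -- truncation has removed all exponents up to (L, L).
  let r₁ : PlaneRing k := fun e => if L ≤ e 0 then MvPowerSeries.coeff e (r - (q : PlaneRing k)) else 0
  have h₁ : coordX k ^ L ∣ r₁ := MvPowerSeries.X_pow_dvd_iff.2 fun e he =>
    if_neg (not_le.2 he)
  have h₂ : coordY k ^ L ∣ r - (q : PlaneRing k) - r₁ := MvPowerSeries.X_pow_dvd_iff.2 fun e he => by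
    by_cases h0 : L ≤ e 0
    · have : MvPowerSeries.coeff e r₁ = MvPowerSeries.coeff e (r - (q : PlaneRing k)) := if_pos h0
      rw [map_sub, this, sub_self]
    · have : MvPowerSeries.coeff e r₁ = 0 := if_neg h0
      have hen : e ≤ n := by
        intro i
        fin_cases i
        · exact (not_le.1 h0).le
        · exact he.le
      rw [map_sub, this, map_sub, MvPolynomial.coeff_coe, MvPowerSeries.coeff_trunc', if_pos hen,
        sub_self, sub_zero]
  obtain ⟨a, ha⟩ := h₁
  obtain ⟨b, hb⟩ := h₂
  exact ⟨q, a, b, by rw [← ha, ← hb]; ring⟩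

/-- Modulo the extended ideal x, y, t are nilpotent, so every series becomes a polynomial in them;
and y = f - x - t comes from the polynomial ring. -/
theorem exists_sub_familyHom_mem (N : ℕ) (a : PowerSeries (PlaneRing k)) :
    ∃ g, a - familyHom k g ∈ (powerIdeal k N).map (familyHom k) := by
  let 𝔫 := (powerIdeal k N).map (familyHom k)
  let mk : PowerSeries (PlaneRing k) →ₐ[k] PowerSeries (PlaneRing k) ⧸ 𝔫 :=
    Ideal.Quotient.mkₐ k 𝔫
  have hmk : ∀ a ∈ 𝔫, mk a = 0 := fun a ha => Ideal.Quotient.eq_zero_iff_mem.2 ha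
  let V := (mk.comp (familyHom k)).range
  suffices h : mk a ∈ V by
    obtain ⟨g, hg⟩ := h
    refine ⟨g, ?_⟩
    rw [← Ideal.Quotient.mk_eq_mk_iff_sub_mem]
    exact hg.symm
  have hιV : ∀ g, mk (familyHom k g) ∈ V := fun g => ⟨g, rfl⟩
  have hXV : mk (PowerSeries.C (coordX k)) ∈ V := by
    have := hιV (Polynomial.C (varX k)); simpa using this
  have hTV : mk PowerSeries.X ∈ V := by
    have := hιV Polynomial.X; simpa using this
  have hFV : mk (movingLine k) ∈ V := by
    have := hιV (Polynomial.C (varF k)); simpa using this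
  have hY : PowerSeries.C (coordY k) =
      movingLine k - PowerSeries.C (coordX k) - PowerSeries.X := by
    unfold movingLine; ring
  have hYV : mk (PowerSeries.C (coordY k)) ∈ V := by
    rw [hY, map_sub, map_sub]
    exact V.sub_mem (V.sub_mem hFV hXV) hTV
  have nil : ∀ b, b ^ N ∈ powerIdeal k N → IsNilpotent (mk (familyHom k b)) := fun b hb =>
    ⟨N, by rw [← map_pow, ← map_pow]; exact hmk _ (Ideal.mem_map_of_mem _ hb)⟩
  have hXn : IsNilpotent (mk (PowerSeries.C (coordX k))) := by
    have := nil (Polynomial.C (varX k)) (Ideal.subset_span (by simp)); simpa using this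
  have hFn : IsNilpotent (mk (movingLine k)) := by
    have := nil (Polynomial.C (varF k)) (Ideal.subset_span (by simp)); simpa using this
  have hTn : IsNilpotent (mk PowerSeries.X) := by
    have := nil Polynomial.X (Ideal.subset_span (by simp)); simpa using this
  have hYn : IsNilpotent (mk (PowerSeries.C (coordY k))) := by
    rw [hY, map_sub, map_sub]
    exact (Commute.all _ _).isNilpotent_sub ((Commute.all _ _).isNilpotent_sub hFn hXn) hTn
  obtain ⟨L₁, hL₁⟩ := hXn
  obtain ⟨L₂, hL₂⟩ := hYn
  have hpoly : ∀ q : MvPolynomial (Fin 2) k, mk (PowerSeries.C (q : PlaneRing k)) ∈ V := by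
    intro q
    induction q using MvPolynomial.induction_on with
    | C c =>
      have : mk (PowerSeries.C ((MvPolynomial.C c : MvPolynomial (Fin 2) k) : PlaneRing k)) =
          algebraMap k _ c := by
        rw [← mk.commutes c, PowerSeries.algebraMap_apply, MvPolynomial.coe_C]; rfl
      rw [this]
      exact V.algebraMap_mem c
    | add p q hp hq =>
      rw [MvPolynomial.coe_add, map_add, map_add]; exact V.add_mem hp hq
    | mul_X p i hp =>
      rw [MvPolynomial.coe_mul, map_mul, map_mul, MvPolynomial.coe_X]
      refine V.mul_mem hp ?_
      fin_cases i
      · exact hXV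
      · exact hYV
  have hR : ∀ r : PlaneRing k, mk (PowerSeries.C r) ∈ V := by
    intro r
    obtain ⟨q, a, b, h⟩ := exists_polynomial_add_X_pow_mul k (L₁ + L₂) r
    have e : mk (PowerSeries.C r) = mk (PowerSeries.C (q : PlaneRing k)) := by
      rw [h]
      simp only [map_add, map_mul, map_pow, pow_add, hL₁, hL₂, zero_mul, mul_zero, add_zero]
    rw [e]; exact hpoly q
  obtain ⟨L, hL⟩ := hTn
  have e : PowerSeries.X ^ L ∣ a - ((PowerSeries.trunc L a : Polynomial (PlaneRing k)) : PowerSeries (PlaneRing k)) := by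
    rw [PowerSeries.X_pow_dvd_iff]
    intro m hm
    rw [map_sub, Polynomial.coeff_coe, PowerSeries.coeff_trunc, if_pos hm, sub_self]
  obtain ⟨c, hc⟩ := e
  have e' : mk a = mk ((PowerSeries.trunc L a : Polynomial (PlaneRing k)) : PowerSeries (PlaneRing k)) := by
    rw [← sub_eq_zero, ← map_sub, hc, map_mul, map_pow, hL, zero_mul]
  rw [e']
  generalize PowerSeries.trunc L a = q
  induction q using Polynomial.induction_on' with
  | add p q hp hq => rw [Polynomial.coe_add, map_add]; exact V.add_mem hp hq
  | monomial n r =>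
    rw [← Polynomial.C_mul_X_pow_eq_monomial, Polynomial.coe_mul, Polynomial.coe_pow,
      Polynomial.coe_C, Polynomial.coe_X, map_mul, map_pow]
    exact V.mul_mem (hR r) (V.pow_mem hTV n)

end Interface
end StaircaseTraces

namespace StaircaseTraces

/-! ### Dimensions of special fibres and trace quotients. -/

section Quotients

universe u
variable {k : Type u} [Field k]

theorem rank_quotient_comap_of_surjective {B C : Type u} [CommRing B] [CommRing C] [Algebra k B]
    [Algebra k C] (φ : B →ₐ[k] C) (hφ : Function.Surjective φ) (K : Ideal C) :
    Module.rank k (B ⧸ K.comap φ) = Module.rank k (C ⧸ K) := by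
  let ψ : B →ₐ[k] C ⧸ K := (Ideal.Quotient.mkₐ k K).comp φ
  have hψ : Function.Surjective ψ := (Ideal.Quotient.mkₐ_surjective k K).comp hφ
  have hker : RingHom.ker ψ = K.comap φ := by
    ext a
    exact Ideal.Quotient.eq_zero_iff_mem
  rw [← hker]
  exact (Ideal.quotientKerAlgEquivOfSurjective hψ).toLinearEquiv.rank_eq

theorem rank_quotient_map_of_surjective {B C : Type u} [CommRing B] [CommRing C] [Algebra k B]
    [Algebra k C] (φ : B →ₐ[k] C) (hφ : Function.Surjective φ) (K : Ideal B) :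
    Module.rank k (C ⧸ K.map φ) = Module.rank k (B ⧸ K ⊔ RingHom.ker φ) := by
  rw [← rank_quotient_comap_of_surjective φ hφ]
  have : (K.map φ).comap φ = K ⊔ RingHom.ker φ := Ideal.comap_map_of_surjective' φ hφ K
  rw [this]

variable {R : Type u} [CommRing R] [Algebra k R]

variable (k R) in
/-- The specialization `t ↦ 0` as a homomorphism of `k`-algebras. -/
noncomputable def specialization : PowerSeries R →ₐ[k] R :=
  { (PowerSeries.constantCoeff : PowerSeries R →+* R) with
    commutes' := fun r => by
      change PowerSeries.constantCoeff (algebraMap k _ r) = _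
      rw [PowerSeries.algebraMap_apply, PowerSeries.constantCoeff_C] }

theorem specialization_surjective : Function.Surjective (specialization k R) := fun r =>
  ⟨PowerSeries.C r, PowerSeries.constantCoeff_C r⟩

theorem ker_specialization : RingHom.ker (specialization k R) = Ideal.span {PowerSeries.X} := by
  ext a
  rw [Ideal.mem_span_singleton, PowerSeries.X_dvd_iff]
  exact Iff.rfl

theorem rank_quotient_specialFibre (J : Ideal (PowerSeries R)) :
    Module.rank k (R ⧸ specialFibre J) =
      Module.rank k (PowerSeries R ⧸ J ⊔ Ideal.span {PowerSeries.X}) := by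
  rw [← ker_specialization (k := k)]
  exact rank_quotient_map_of_surjective (specialization k R) specialization_surjective J

/-- The colon ideal already contains y, so passing to R / (y) loses nothing, and setting t = 0
amounts to adjoining t. -/
theorem rank_quotient_traceIdeal (J : Ideal (PowerSeries R)) (y : R) (p : ℕ) :
    Module.rank k ((R ⧸ Ideal.span {y}) ⧸ traceIdeal J y p) =
      Module.rank k (PowerSeries R ⧸ Submodule.colon (J ⊔ Ideal.span {PowerSeries.C y})
        {(PowerSeries.X : PowerSeries R) ^ (p - 1)} ⊔ Ideal.span {PowerSeries.X}) := by
  set K := Submodule.colon (J ⊔ Ideal.span {PowerSeries.C y})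
    {(PowerSeries.X : PowerSeries R) ^ (p - 1)} with hK
  have h1 : Module.rank k ((R ⧸ Ideal.span {y}) ⧸ traceIdeal J y p) =
      Module.rank k (R ⧸ specialFibre K ⊔ Ideal.span {y}) := by
    have := rank_quotient_map_of_surjective (Ideal.Quotient.mkₐ k (Ideal.span {y}))
      (Ideal.Quotient.mkₐ_surjective k _) (specialFibre K)
    have hker : RingHom.ker (Ideal.Quotient.mkₐ k (Ideal.span {y})) = Ideal.span {y} :=
      Ideal.Quotient.mkₐ_ker k _
    rw [hker] at this
    exact this
  have hy : specialFibre K ⊔ Ideal.span {y} = specialFibre K := by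
    rw [sup_eq_left, Ideal.span_singleton_le_iff_mem]
    have : PowerSeries.C y ∈ K := by
      rw [hK, Submodule.mem_colon_singleton, smul_eq_mul]
      exact Ideal.mul_mem_right _ _ (Ideal.mem_sup_right (Ideal.mem_span_singleton_self _))
    have := Ideal.mem_map_of_mem (PowerSeries.constantCoeff : PowerSeries R →+* R) this
    rwa [PowerSeries.constantCoeff_C] at this
  rw [h1, hy, rank_quotient_specialFibre]

end Quotients

/-! ### Cofinite ideals and their contractions. -/

section Transfer

universe u
variable (k : Type u) [Field k]

/-- Ideals of `k[[x, y]][[t]]` containing powers of `x`, `f` and `t`. -/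
def IsCofinite (J : Ideal (PowerSeries (PlaneRing k))) : Prop :=
  ∃ N, (powerIdeal k N).map (familyHom k) ≤ J

variable {k} {J : Ideal (PowerSeries (PlaneRing k))}

theorem IsCofinite.mono (hJ : IsCofinite k J) {J' : Ideal (PowerSeries (PlaneRing k))}
    (h : J ≤ J') : IsCofinite k J' :=
  hJ.imp fun _ hN => hN.trans h

theorem IsCofinite.exists_sub_mem (hJ : IsCofinite k J) (a : PowerSeries (PlaneRing k)) :
    ∃ g, a - familyHom k g ∈ J := by
  obtain ⟨N, hN⟩ := hJ
  exact (exists_sub_familyHom_mem k N a).imp fun _ h => hN h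

/-- Contraction commutes with this sum because the multiplier of u may be replaced, modulo J, by a
polynomial. -/
theorem IsCofinite.comap_sup_span (hJ : IsCofinite k J) (u : FamilyPoly k) :
    (J ⊔ Ideal.span {familyHom k u}).comap (familyHom k) =
      J.comap (familyHom k) ⊔ Ideal.span {u} := by
  apply le_antisymm
  · intro g hg
    rw [Ideal.mem_comap] at hg
    obtain ⟨j, hj, w, hw, h⟩ := Submodule.mem_sup.1 hg
    obtain ⟨a, rfl⟩ := Ideal.mem_span_singleton'.1 hw
    obtain ⟨b, hb⟩ := hJ.exists_sub_mem a
    refine Submodule.mem_sup.2 ⟨g - b * u, ?_, b * u, Ideal.mul_mem_left _ _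
      (Ideal.mem_span_singleton_self _), by ring⟩
    rw [Ideal.mem_comap, map_sub, map_mul, ← h]
    have := J.add_mem hj (J.mul_mem_right (familyHom k u) hb)
    convert this using 1
    ring
  · refine sup_le (Ideal.comap_mono le_sup_left) ?_
    rw [Ideal.span_singleton_le_iff_mem, Ideal.mem_comap]
    exact Ideal.mem_sup_right (Ideal.mem_span_singleton_self _)

theorem IsCofinite.map_comap (hJ : IsCofinite k J) :
    (J.comap (familyHom k)).map (familyHom k) = J := by
  refine le_antisymm Ideal.map_comap_le fun a ha => ?_
  obtain ⟨N, hN⟩ := hJ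
  obtain ⟨g, hg⟩ := exists_sub_familyHom_mem k N a
  have hle : (powerIdeal k N).map (familyHom k) ≤ (J.comap (familyHom k)).map (familyHom k) :=
    Ideal.map_mono (Ideal.map_le_iff_le_comap.1 hN)
  have hgJ : g ∈ J.comap (familyHom k) := by
    rw [Ideal.mem_comap]
    have := J.sub_mem ha (hN hg)
    rwa [sub_sub_cancel] at this
  have := Ideal.add_mem _ (hle hg) (Ideal.mem_map_of_mem (familyHom k) hgJ)
  rwa [sub_add_cancel] at this

theorem comap_colon_singleton (u : FamilyPoly k) :
    (Submodule.colon J {familyHom k u} : Ideal _).comap (familyHom k) =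
      Submodule.colon (J.comap (familyHom k)) {u} := by
  ext g
  rw [Ideal.mem_comap, Submodule.mem_colon_singleton, Submodule.mem_colon_singleton,
    Ideal.mem_comap, smul_eq_mul, smul_eq_mul, map_mul]

theorem le_colon_singleton {B : Type*} [CommRing B] (J : Ideal B) (u : B) :
    J ≤ Submodule.colon J {u} := fun g hg => by
  rw [Submodule.mem_colon_singleton, smul_eq_mul]
  exact J.mul_mem_right _ hg

theorem IsCofinite.rank_quotient (hJ : IsCofinite k J) :
    Module.rank k (PowerSeries (PlaneRing k) ⧸ J) =
      Module.rank k (FamilyPoly k ⧸ J.comap (familyHom k)) := by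
  let ψ : FamilyPoly k →ₐ[k] PowerSeries (PlaneRing k) ⧸ J :=
    (Ideal.Quotient.mkₐ k J).comp (familyHom k)
  have hψ : Function.Surjective ψ := by
    intro a
    obtain ⟨a, rfl⟩ := Ideal.Quotient.mkₐ_surjective k J a
    obtain ⟨g, hg⟩ := hJ.exists_sub_mem a
    exact ⟨g, ((Ideal.Quotient.mk_eq_mk_iff_sub_mem _ _).2 hg).symm⟩
  have hker : RingHom.ker ψ = J.comap (familyHom k) := by
    ext a
    exact Ideal.Quotient.eq_zero_iff_mem
  rw [← hker]
  exact (Ideal.quotientKerAlgEquivOfSurjective hψ).toLinearEquiv.rank_eq.symm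

end Transfer
end StaircaseTraces

namespace StaircaseTraces

/-! ### Monomial ideals of staircases. -/

section MonomialIdeals

variable (k : Type*) [Field k]

/-- The ideal of `k[X][F]` generated by the monomials with exponents in `E`. -/
noncomputable def monomialIdeal (E : Set (ℕ × ℕ)) : Ideal (PlanePoly k) :=
  Ideal.span ((fun e : ℕ × ℕ => varX k ^ e.1 * varF k ^ e.2) '' E)

variable {k} {E U : Set (ℕ × ℕ)}

theorem monomial_mem_monomialIdeal {a b : ℕ} (h : (a, b) ∈ E) :
    varX k ^ a * varF k ^ b ∈ monomialIdeal k E := by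
  have := Set.mem_image_of_mem (fun e : ℕ × ℕ => varX k ^ e.1 * varF k ^ e.2) h
  exact Ideal.subset_span this

theorem varF_pow_mem_monomialIdeal {b : ℕ} (h : (0, b) ∈ E) :
    varF k ^ b ∈ monomialIdeal k E := by
  simpa using monomial_mem_monomialIdeal (k := k) h

theorem monomialIdeal_le_iff {J : Ideal (PlanePoly k)} :
    monomialIdeal k E ≤ J ↔ ∀ a b, (a, b) ∈ E → varX k ^ a * varF k ^ b ∈ J := by
  rw [monomialIdeal, Ideal.span_le]
  constructor
  · intro h a b hab
    exact h (Set.mem_image_of_mem (fun e : ℕ × ℕ => varX k ^ e.1 * varF k ^ e.2) hab)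
  · rintro h _ ⟨e, he, rfl⟩
    exact h _ _ he

theorem monomialIdeal_mono (h : E ⊆ U) : monomialIdeal k E ≤ monomialIdeal k U :=
  Ideal.span_mono (Set.image_mono h)

theorem IsStaircase.add_mem (hE : IsStaircase E) {a b : ℕ} (h : (a, b) ∈ E) (c d : ℕ) :
    (a + c, b + d) ∈ E := hE _ h (c, d)

theorem IsStaircase.mem_of_le (hE : IsStaircase E) {a b c d : ℕ} (h : (a, b) ∈ E) (hc : a ≤ c)
    (hd : b ≤ d) : (c, d) ∈ E := by
  have := hE.add_mem h (c - a) (d - b)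
  rwa [Nat.add_sub_cancel' hc, Nat.add_sub_cancel' hd] at this

theorem planeCoeff_mul_eq_zero (hE : IsStaircase E) {g : PlanePoly k}
    (hg : ∀ a b, (a, b) ∉ E → planeCoeff a b g = 0) (c : PlanePoly k) :
    ∀ a b, (a, b) ∉ E → planeCoeff a b (c * g) = 0 := by
  have hX : ∀ g : PlanePoly k, (∀ a b, (a, b) ∉ E → planeCoeff a b g = 0) →
      ∀ a b, (a, b) ∉ E → planeCoeff a b (varX k * g) = 0 := by
    intro g hg a b hab
    cases a with
    | zero => exact planeCoeff_varX_mul_zero ..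
    | succ a =>
      rw [planeCoeff_varX_mul_succ]
      exact hg a b fun h => hab (hE.add_mem h 1 0)
  have hF : ∀ g : PlanePoly k, (∀ a b, (a, b) ∉ E → planeCoeff a b g = 0) →
      ∀ a b, (a, b) ∉ E → planeCoeff a b (varF k * g) = 0 := by
    intro g hg a b hab
    cases b with
    | zero => exact planeCoeff_varF_mul_zero ..
    | succ b =>
      rw [planeCoeff_varF_mul_succ]
      exact hg a b fun h => hab (hE.add_mem h 0 1)
  induction c using planePoly_induction with
  | h0 => intro a b _; rw [zero_mul, map_zero]
  | hadd c d hc hd => intro a b hab; rw [add_mul, map_add, hc a b hab, hd a b hab, add_zero]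
  | hmon c i j =>
    intro a b hab
    rw [smul_mul_assoc, map_smul]
    suffices ∀ a b, (a, b) ∉ E → planeCoeff a b (varX k ^ i * varF k ^ j * g) = 0 by
      rw [this a b hab, smul_zero]
    have hj : ∀ a b, (a, b) ∉ E → planeCoeff a b (varF k ^ j * g) = 0 := by
      induction j with
      | zero => simpa using hg
      | succ j ih => rw [pow_succ', mul_assoc]; exact hF _ ih
    rw [mul_assoc]
    induction i with
    | zero => simpa using hj
    | succ i ih => rw [pow_succ', mul_assoc]; exact hX _ ih

theorem mem_monomialIdeal_iff (hE : IsStaircase E) {g : PlanePoly k} :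
    g ∈ monomialIdeal k E ↔ ∀ a b, (a, b) ∉ E → planeCoeff a b g = 0 := by
  constructor
  · intro hg
    refine Submodule.span_induction (p := fun g _ => ∀ a b, (a, b) ∉ E → planeCoeff a b g = 0)
      ?_ ?_ ?_ ?_ hg
    · rintro _ ⟨⟨i, j⟩, hij, rfl⟩ a b hab
      exact planeCoeff_monomial_of_ne fun h => hab (h ▸ hij)
    · intro a b _; exact map_zero _
    · intro g g' _ _ hg hg' a b hab
      rw [map_add, hg a b hab, hg' a b hab, add_zero]
    · intro c g _ hg
      exact planeCoeff_mul_eq_zero hE hg c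
  · intro hg
    obtain ⟨N, hN⟩ := planePoly_eq_sum g
    rw [hN]
    refine Ideal.sum_mem _ fun ⟨a, b⟩ _ => ?_
    by_cases hab : (a, b) ∈ E
    · rw [Algebra.smul_def]
      exact Ideal.mul_mem_left _ _ (monomial_mem_monomialIdeal hab)
    · rw [hg a b hab, zero_smul]
      exact Ideal.zero_mem _

theorem rank_quotient_monomialIdeal (hE : IsStaircase E) (hfin : Eᶜ.Finite) :
    Module.rank k (PlanePoly k ⧸ monomialIdeal k E) = (Eᶜ.ncard : Cardinal) := by
  have := hfin.to_subtype
  have := hfin.fintype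
  let φ : PlanePoly k →ₗ[k] (↥Eᶜ → k) := LinearMap.pi fun e => planeCoeff e.1.1 e.1.2
  have hφ : Function.Surjective φ := by
    intro v
    refine ⟨∑ e : ↥Eᶜ, v e • (varX k ^ e.1.1 * varF k ^ e.1.2), ?_⟩
    ext e
    change planeCoeff _ _ _ = _
    rw [map_sum, Finset.sum_eq_single e]
    · rw [map_smul, planeCoeff_monomial_self, smul_eq_mul, mul_one]
    · intro e' _ he
      rw [map_smul, planeCoeff_monomial_of_ne, smul_zero]
      intro h
      exact he (Subtype.ext h)
    · intro h; exact absurd (Finset.mem_univ _) h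
  have hker : LinearMap.ker φ = (monomialIdeal k E).restrictScalars k := by
    ext g
    rw [LinearMap.mem_ker, Submodule.restrictScalars_mem, mem_monomialIdeal_iff hE]
    constructor
    · intro h a b hab
      exact congrFun h ⟨(a, b), hab⟩
    · intro h
      ext e
      exact h _ _ e.2
  have e := φ.quotKerEquivOfSurjective hφ
  rw [hker] at e
  have e' : (PlanePoly k ⧸ monomialIdeal k E) ≃ₗ[k] (↥Eᶜ → k) :=
    (Submodule.Quotient.restrictScalarsEquiv k (monomialIdeal k E)).symm.trans e
  rw [e'.rank_eq, rank_fun', Set.ncard_eq_toFinset_card', Set.toFinset_card]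

end MonomialIdeals
end StaircaseTraces

namespace StaircaseTraces

/-! ### Diagonal staircases and slanted shifts. -/

section Staircases

variable {E U V : Set (ℕ × ℕ)}

/-- The elementwise form of gentleness: every element not on the left border can be moved one
step to the left and one step up. -/
def IsDiagonal (E : Set (ℕ × ℕ)) : Prop :=
  ∀ a b, (a + 1, b) ∈ E → (a, b + 1) ∈ E

theorem IsDiagonal.mem_of_add (hE : IsDiagonal E) {a b : ℕ} (n : ℕ) (h : (a + n, b) ∈ E) :
    (a, b + n) ∈ E := by
  induction n generalizing b with
  | zero => exact h
  | succ n ih =>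
    have := ih (hE _ _ h)
    rwa [add_assoc, add_comm 1 n] at this

theorem horizTranslate_horizTranslate (E : Set (ℕ × ℕ)) (m n : ℕ) :
    horizTranslate (horizTranslate E m) n = horizTranslate E (n + m) := by
  ext ⟨a, b⟩
  simp only [horizTranslate, Set.mem_ofPred_eq, add_assoc]

theorem horizTranslate_zero (E : Set (ℕ × ℕ)) : horizTranslate E 0 = E := rfl

theorem mem_horizTranslate {n a b : ℕ} : (a, b) ∈ horizTranslate E n ↔ (a + n, b) ∈ E := Iff.rfl

theorem IsStaircase.horizTranslate (hE : IsStaircase E) (n : ℕ) :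
    IsStaircase (horizTranslate E n) := by
  rintro ⟨a, b⟩ h ⟨c, d⟩
  exact hE.mem_of_le h (show a + n ≤ a + c + n by omega) (show b ≤ b + d by omega)

theorem IsDiagonal.horizTranslate (hE : IsDiagonal E) (n : ℕ) :
    IsDiagonal (horizTranslate E n) := by
  intro a b h
  refine hE _ _ ?_
  rwa [mem_horizTranslate, add_right_comm] at h

theorem subset_horizTranslate (hE : IsStaircase E) (n : ℕ) : E ⊆ horizTranslate E n :=
  fun ⟨_, _⟩ h => hE.add_mem h n 0

/-- The shift of a staircase by one to the right, extended to the left along the diagonal. -/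
def slantStep (U : Set (ℕ × ℕ)) : Set (ℕ × ℕ) :=
  {e | (∃ a, e.1 = a + 1 ∧ (a, e.2) ∈ U) ∨ (e.1 = 0 ∧ ∃ b, e.2 = b + 1 ∧ (0, b) ∈ U)}

/-- The shift of a staircase by `c` to the right, extended to the left along the diagonal. -/
def slantShift (U : Set (ℕ × ℕ)) (c : ℕ) : Set (ℕ × ℕ) := slantStep^[c] U

theorem slantShift_zero : slantShift U 0 = U := rfl

theorem slantShift_succ (c : ℕ) : slantShift U (c + 1) = slantStep (slantShift U c) :=
  Function.iterate_succ_apply' ..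

theorem slantShift_add (c d : ℕ) : slantShift U (c + d) = slantShift (slantShift U d) c :=
  Function.iterate_add_apply ..

theorem succ_mem_slantStep {a b : ℕ} : (a + 1, b) ∈ slantStep U ↔ (a, b) ∈ U := by
  simp [slantStep]

theorem zero_mem_slantStep {b : ℕ} : (0, b) ∈ slantStep U ↔ ∃ c, b = c + 1 ∧ (0, c) ∈ U := by
  simp [slantStep]

theorem horizTranslate_slantStep : horizTranslate (slantStep U) 1 = U :=
  Set.ext fun ⟨_, _⟩ => succ_mem_slantStep

theorem horizTranslate_slantShift_succ (c : ℕ) :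
    horizTranslate (slantShift U (c + 1)) 1 = slantShift U c := by
  rw [slantShift_succ, horizTranslate_slantStep]

theorem IsDiagonal.slantStep (hU : IsDiagonal U) : IsDiagonal (slantStep U) := by
  intro a b h
  rw [succ_mem_slantStep] at h
  cases a with
  | zero => exact zero_mem_slantStep.2 ⟨b, rfl, h⟩
  | succ a => exact succ_mem_slantStep.2 (hU _ _ h)

theorem IsDiagonal.slantShift (hU : IsDiagonal U) (c : ℕ) : IsDiagonal (slantShift U c) := by
  induction c with
  | zero => exact hU
  | succ c ih => rw [slantShift_succ]; exact ih.slantStep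

/-- Each slanted step raises the total degree by one. This bound is what hides the corresponding
ideals from the traces. -/
theorem le_add_of_mem_slantShift {a b c : ℕ} (h : (a, b) ∈ slantShift U c) : c ≤ a + b := by
  induction c generalizing a b with
  | zero => exact Nat.zero_le _
  | succ c ih =>
    rw [slantShift_succ] at h
    cases a with
    | zero =>
      obtain ⟨d, rfl, h'⟩ := zero_mem_slantStep.1 h
      have := ih h'; omega
    | succ a =>
      have := ih (succ_mem_slantStep.1 h); omega

theorem mem_slantShift_cases {a b c : ℕ} (h : (a, b) ∈ slantShift U c) :
    (∃ i, a = c + i ∧ (i, b) ∈ U) ∨ ∃ m d, 1 ≤ m ∧ a + m = c ∧ b = d + m ∧ (0, d) ∈ U := by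
  induction c generalizing a b with
  | zero => exact Or.inl ⟨a, by omega, h⟩
  | succ c ih =>
    rw [slantShift_succ] at h
    cases a with
    | zero =>
      obtain ⟨d, rfl, h0⟩ := zero_mem_slantStep.1 h
      rcases ih h0 with ⟨i, hi, h'⟩ | ⟨m, e, h1, h2, h3, h4⟩
      · obtain ⟨rfl, rfl⟩ : c = 0 ∧ i = 0 := by omega
        exact Or.inr ⟨1, d, le_rfl, rfl, rfl, h'⟩
      · exact Or.inr ⟨m + 1, e, by omega, by omega, by omega, h4⟩
    | succ a =>
      rcases ih (succ_mem_slantStep.1 h) with ⟨i, hi, h'⟩ | ⟨m, e, h1, h2, h3, h4⟩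
      · exact Or.inl ⟨i, by omega, h'⟩
      · exact Or.inr ⟨m, e, h1, by omega, h3, h4⟩

end Staircases

/-! ### Multiplication and division of monomial ideals by X and F - X. -/

section MonomialIdealOperations

variable {k : Type*} [Field k] {E U V : Set (ℕ × ℕ)}

theorem varX_mul_mem_monomialIdeal_iff (hE : IsStaircase E) {g : PlanePoly k} :
    varX k * g ∈ monomialIdeal k E ↔ g ∈ monomialIdeal k (horizTranslate E 1) := by
  rw [mem_monomialIdeal_iff hE, mem_monomialIdeal_iff (hE.horizTranslate 1)]
  constructor
  · intro h a b hab
    rw [← planeCoeff_varX_mul_succ]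
    exact h _ _ hab
  · intro h a b hab
    cases a with
    | zero => exact planeCoeff_varX_mul_zero ..
    | succ a => rw [planeCoeff_varX_mul_succ]; exact h _ _ hab

theorem mul_mem_of_mem_horizTranslate (hE : IsDiagonal E) {g : PlanePoly k}
    (hg : g ∈ monomialIdeal k (horizTranslate E 1)) :
    (varF k - varX k) * g ∈ monomialIdeal k E := by
  have : monomialIdeal k (horizTranslate E 1) ≤
      Submodule.colon (monomialIdeal k E) {varF k - varX k} := by
    rw [monomialIdeal_le_iff]
    intro a b hab
    rw [Submodule.mem_colon_singleton, smul_eq_mul]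
    have e : varX k ^ a * varF k ^ b * (varF k - varX k) =
        varX k ^ a * varF k ^ (b + 1) - varX k ^ (a + 1) * varF k ^ b := by ring
    rw [e]
    exact Ideal.sub_mem _ (monomial_mem_monomialIdeal (hE _ _ hab))
      (monomial_mem_monomialIdeal hab)
  have := this hg
  rwa [Submodule.mem_colon_singleton, smul_eq_mul, mul_comm] at this

/-- Induction on the F-exponent: a coefficient of (F - X) g is the difference of two neighbouring
coefficients of g on a diagonal. By diagonality the one with smaller F-exponent is also outside the
translate, so it vanishes by induction. -/
theorem mem_horizTranslate_of_mul_mem (hE : IsStaircase E) (hE' : IsDiagonal E)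
    {g : PlanePoly k} (hg : (varF k - varX k) * g ∈ monomialIdeal k E) :
    g ∈ monomialIdeal k (horizTranslate E 1) := by
  rw [mem_monomialIdeal_iff hE] at hg
  rw [mem_monomialIdeal_iff (hE.horizTranslate 1)]
  intro a b
  induction b generalizing a with
  | zero =>
    intro h
    have := hg (a + 1) 0 h
    rw [sub_mul, map_sub, planeCoeff_varF_mul_zero, planeCoeff_varX_mul_succ, zero_sub,
      neg_eq_zero] at this
    exact this
  | succ b ih =>
    intro h
    have h' := hg (a + 1) (b + 1) h
    rw [sub_mul, map_sub, planeCoeff_varF_mul_succ, planeCoeff_varX_mul_succ,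
      ih (a + 1) (fun h' => h (hE' _ _ h')), zero_sub, neg_eq_zero] at h'
    exact h'

theorem pow_mul_mem_monomialIdeal_iff (hE : IsStaircase E) (hE' : IsDiagonal E) (n : ℕ)
    {g : PlanePoly k} : (varF k - varX k) ^ n * g ∈ monomialIdeal k E ↔
      g ∈ monomialIdeal k (horizTranslate E n) := by
  induction n generalizing g with
  | zero => rw [pow_zero, one_mul, horizTranslate_zero]
  | succ n ih =>
    rw [pow_succ, mul_assoc, ih, add_comm, ← horizTranslate_horizTranslate]
    exact ⟨mem_horizTranslate_of_mul_mem (hE.horizTranslate n) (hE'.horizTranslate n),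
      mul_mem_of_mem_horizTranslate (hE'.horizTranslate n)⟩

theorem monomialIdeal_le_varX_mul_sup (h0 : ∀ j, (0, j) ∈ U → (0, j) ∈ E) :
    monomialIdeal k U ≤
      Ideal.span {varX k} * monomialIdeal k (horizTranslate U 1) ⊔ monomialIdeal k E := by
  rw [monomialIdeal_le_iff]
  intro a b hab
  cases a with
  | zero => exact Ideal.mem_sup_right (monomial_mem_monomialIdeal (h0 _ hab))
  | succ a =>
    refine Ideal.mem_sup_left (Ideal.mem_span_singleton_mul.2 ⟨varX k ^ a * varF k ^ b, ?_, ?_⟩)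
    · exact monomial_mem_monomialIdeal hab
    · ring

/-- The relation X^(a+1) F^b = X^a F^(b+1) - (F - X) X^a F^b moves a monomial along its diagonal
until it reaches the left border, where it lies in E. -/
theorem monomialIdeal_le_sub_mul_sup (hU : IsDiagonal U) (h0 : ∀ j, (0, j) ∈ U → (0, j) ∈ E) :
    monomialIdeal k U ≤
      Ideal.span {varF k - varX k} * monomialIdeal k (horizTranslate U 1) ⊔
        monomialIdeal k E := by
  rw [monomialIdeal_le_iff]
  intro a b hab
  induction a generalizing b with
  | zero => exact Ideal.mem_sup_right (monomial_mem_monomialIdeal (h0 _ hab))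
  | succ a ih =>
    have e : varX k ^ (a + 1) * varF k ^ b = varX k ^ a * varF k ^ (b + 1) -
        (varF k - varX k) * (varX k ^ a * varF k ^ b) := by ring
    rw [e]
    exact Ideal.sub_mem _ (ih _ (hU _ _ hab)) (Ideal.mem_sup_left
      (Ideal.mem_span_singleton_mul.2 ⟨_, monomial_mem_monomialIdeal hab, rfl⟩))

theorem mul_mem_slantStep (hU : IsDiagonal U) {g : PlanePoly k} (hg : g ∈ monomialIdeal k U) :
    (varF k - varX k) * g ∈ monomialIdeal k (slantStep U) := by
  apply mul_mem_of_mem_horizTranslate hU.slantStep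
  rwa [horizTranslate_slantStep]

theorem pow_mul_mem_slantShift (hU : IsDiagonal U) {g : PlanePoly k}
    (hg : g ∈ monomialIdeal k U) (c : ℕ) :
    (varF k - varX k) ^ c * g ∈ monomialIdeal k (slantShift U c) := by
  induction c with
  | zero => simpa [slantShift_zero] using hg
  | succ c ih =>
    rw [pow_succ', mul_assoc, slantShift_succ]
    exact mul_mem_slantStep (hU.slantShift c) ih

variable (k) in
/-- The truncation at `(-F)^(a+1)` of the homogeneous expression `X^(a-b) (X - F)^b`. -/
noncomputable def truncPow (b : ℕ) : ℕ → PlanePoly k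
  | 0 => 1
  | a + 1 => varX k * truncPow b a + (b.choose (a + 1) : PlanePoly k) * (-varF k) ^ (a + 1)

/-- Pascal's rule; the correction is the one term of the product that lies beyond the truncation. -/
theorem sub_mul_truncPow (a b : ℕ) :
    (varX k - varF k) * truncPow k b a =
      truncPow k (b + 1) (a + 1) - (b.choose (a + 1) : PlanePoly k) * (-varF k) ^ (a + 1) := by
  induction a with
  | zero => simp [truncPow]; ring
  | succ a ih =>
    have h1 : truncPow k b (a + 1) =
        varX k * truncPow k b a + (b.choose (a + 1) : PlanePoly k) * (-varF k) ^ (a + 1) := rfl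
    have h2 : truncPow k (b + 1) (a + 1 + 1) = varX k * truncPow k (b + 1) (a + 1) +
        ((b + 1).choose (a + 1 + 1) : PlanePoly k) * (-varF k) ^ (a + 1 + 1) := rfl
    rw [h1, mul_add, mul_left_comm, ih, h2, Nat.choose_succ_succ' b (a + 1)]
    push_cast
    ring

theorem truncPow_sub_mem (a b : ℕ) : truncPow k b a - varX k ^ a ∈
    monomialIdeal k {e | e.1 + e.2 = a ∧ 1 ≤ e.2} := by
  induction a with
  | zero => simp [truncPow]
  | succ a ih =>
    have h : monomialIdeal k {e | e.1 + e.2 = a ∧ 1 ≤ e.2} ≤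
        Submodule.colon (monomialIdeal k {e | e.1 + e.2 = a + 1 ∧ 1 ≤ e.2}) {varX k} := by
      rw [monomialIdeal_le_iff]
      rintro i j ⟨h1, h2⟩
      rw [Submodule.mem_colon_singleton, smul_eq_mul, mul_right_comm, ← pow_succ]
      simp only at h1 h2
      exact monomial_mem_monomialIdeal ⟨by simp only; omega, h2⟩
    have h' := h ih
    rw [Submodule.mem_colon_singleton, smul_eq_mul] at h'
    have e : truncPow k b (a + 1) - varX k ^ (a + 1) = (truncPow k b a - varX k ^ a) * varX k +
        (b.choose (a + 1) : PlanePoly k) * (-1) ^ (a + 1) * (varX k ^ 0 * varF k ^ (a + 1)) := by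
      rw [truncPow, neg_pow (varF k)]; ring
    rw [e]
    refine Ideal.add_mem _ h' (Ideal.mul_mem_left _ _ (monomial_mem_monomialIdeal ⟨?_, ?_⟩))
    · simp
    · simp

/-- The wanted monomial is the leading term of `truncPow` times X^i F^j. Another term carries
X^(c+i) F^(l+j) with c + l = A and l ≥ 1. For l ≤ i it is the case i - l of the induction, since
diagonality puts (i - l, j + l) in V. For l > i it lies in G through the border point (0, j + i) of
V, with m = l - i. -/
theorem varX_pow_mul_mem_of_truncPow_mul_mem {G : Set (ℕ × ℕ)} {A B : ℕ} (hV : IsDiagonal V)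
    (hG : ∀ m d, 1 ≤ m → m ≤ A → (0, d) ∈ V → (A - m, d + m) ∈ G) {J : Ideal (PlanePoly k)}
    (hJ : monomialIdeal k G ≤ J) (hZ : ∀ v ∈ monomialIdeal k V, truncPow k B A * v ∈ J)
    (i j : ℕ) (hij : (i, j) ∈ V) : varX k ^ (A + i) * varF k ^ j ∈ J := by
  induction i using Nat.strong_induction_on generalizing j with
  | _ i ih =>
    have h : monomialIdeal k {e | e.1 + e.2 = A ∧ 1 ≤ e.2} ≤
        Submodule.colon J {varX k ^ i * varF k ^ j} := by
      rw [monomialIdeal_le_iff]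
      rintro c l ⟨h1, h2⟩
      simp only at h1 h2
      rw [Submodule.mem_colon_singleton, smul_eq_mul]
      rcases le_or_gt l i with hl | hl
      · have := ih (i - l) (by omega) (j + l) (hV.mem_of_add l (by rwa [Nat.sub_add_cancel hl]))
        convert this using 1
        have : A + (i - l) = c + i := by omega
        rw [this]; ring
      · have h0 : (0, j + i) ∈ V := hV.mem_of_add i (by rwa [zero_add])
        have := hJ (monomial_mem_monomialIdeal (k := k)
          (hG (l - i) (j + i) (by omega) (by omega) h0))
        convert this using 1
        have e1 : A - (l - i) = c + i := by omega
        have e2 : j + i + (l - i) = l + j := by omega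
        rw [e1, e2]; ring
    have h' := h (truncPow_sub_mem A B)
    rw [Submodule.mem_colon_singleton, smul_eq_mul] at h'
    have e : varX k ^ (A + i) * varF k ^ j = truncPow k B A * (varX k ^ i * varF k ^ j) -
        (truncPow k B A - varX k ^ A) * (varX k ^ i * varF k ^ j) := by ring
    rw [e]
    exact J.sub_mem (hZ _ (monomial_mem_monomialIdeal hij)) h'

end MonomialIdealOperations
end StaircaseTraces

namespace StaircaseTraces

/-! ### Congruences modulo T^p and truncated binomial series. -/

open Polynomial in
theorem mem_map_C_sup_span_X_pow {P : Type*} [CommRing P] {I : Ideal P} {p : ℕ}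
    {g : Polynomial P} :
    g ∈ I.map (C : P →+* Polynomial P) ⊔ Ideal.span {X ^ p} ↔ ∀ i < p, g.coeff i ∈ I := by
  constructor
  · intro h i hi
    obtain ⟨u, hu, w, hw, rfl⟩ := Submodule.mem_sup.1 h
    obtain ⟨c, rfl⟩ := Ideal.mem_span_singleton.1 hw
    rw [coeff_add, coeff_X_pow_mul', if_neg (not_le.2 hi), add_zero]
    exact Ideal.mem_map_C_iff.1 hu i
  · intro h
    let g₁ : Polynomial P := ∑ i ∈ Finset.range p, C (g.coeff i) * X ^ i
    have h₁ : g₁ ∈ I.map (C : P →+* Polynomial P) := Ideal.sum_mem _ fun i hi =>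
      Ideal.mul_mem_right _ _ (Ideal.mem_map_of_mem _ (h i (Finset.mem_range.1 hi)))
    have h₂ : X ^ p ∣ g - g₁ := by
      rw [X_pow_dvd_iff]
      intro d hd
      rw [coeff_sub, finsetSum_coeff, Finset.sum_eq_single d]
      · rw [coeff_C_mul, coeff_X_pow_self, mul_one, sub_self]
      · intro i _ hi
        rw [coeff_C_mul, coeff_X_pow, if_neg (Ne.symm hi), mul_zero]
      · intro hd'; exact absurd (Finset.mem_range.2 hd) hd'
    exact Submodule.mem_sup.2 ⟨g₁, h₁, g - g₁, Ideal.mem_span_singleton.2 h₂, by ring⟩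

section BinomialSeries

open Polynomial

variable {P : Type*} [CommRing P] (s : P)

/-- The truncation at `T^p` of the binomial series `s^(p-1) (1 - T/s)^(-r)`. -/
noncomputable def binomTrunc (r : ℕ) : ℕ → Polynomial P
  | 0 => 0
  | p + 1 => C s * binomTrunc r p + (r.multichoose p : Polynomial P) * X ^ p

theorem binomTrunc_succ (r p : ℕ) : binomTrunc s r (p + 1) =
    C s * binomTrunc s r p + (r.multichoose p : Polynomial P) * X ^ p := rfl

theorem binomTrunc_one (r : ℕ) : binomTrunc s r 1 = 1 := by
  simp [binomTrunc]

/-- Only the normalising factor s^(p-1) depends on p, apart from the truncation; hence lowering the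
order by c costs exactly s^c. -/
theorem binomTrunc_add_sub_mem (r p c : ℕ) :
    binomTrunc s r (p + c) - C s ^ c * binomTrunc s r p ∈
      Ideal.span {(X : Polynomial P) ^ p} := by
  induction c with
  | zero => simp
  | succ c ih =>
    have e : binomTrunc s r (p + (c + 1)) - C s ^ (c + 1) * binomTrunc s r p =
        C s * (binomTrunc s r (p + c) - C s ^ c * binomTrunc s r p) +
          (r.multichoose (p + c) : Polynomial P) * X ^ c * X ^ p := by
      rw [← add_assoc, binomTrunc_succ]; ring
    rw [e]
    exact Ideal.add_mem _ (Ideal.mul_mem_left _ _ ih)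
      (Ideal.mul_mem_left _ _ (Ideal.mem_span_singleton_self _))

/-- The truncated form of (s - T) (1 - T/s)^(-r-1) = s (1 - T/s)^(-r), with the boundary term at
T^(p+1). -/
theorem sub_mul_binomTrunc_succ (r p : ℕ) : (C s - X) * binomTrunc s (r + 1) (p + 1) =
    C s * binomTrunc s r (p + 1) - ((r + 1).multichoose p : Polynomial P) * X ^ (p + 1) := by
  induction p with
  | zero => simp [binomTrunc]
  | succ p ih =>
    rw [binomTrunc_succ s (r + 1) (p + 1), mul_add, mul_left_comm, ih,
      binomTrunc_succ s r (p + 1), Nat.multichoose_succ_succ]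
    push_cast
    ring

theorem sub_mul_binomTrunc_sub_mem (r p : ℕ) :
    (C s - X) * binomTrunc s (r + 1) p - C s * binomTrunc s r p ∈
      Ideal.span {(X : Polynomial P) ^ p} := by
  cases p with
  | zero => simp [binomTrunc]
  | succ p =>
    rw [sub_mul_binomTrunc_succ, sub_sub_cancel_left, neg_mem_iff]
    exact Ideal.mul_mem_left _ _ (Ideal.mem_span_singleton_self _)

theorem binomTrunc_zero_succ (p : ℕ) : binomTrunc s 0 (p + 1) = C s ^ p := by
  induction p with
  | zero => simp [binomTrunc]
  | succ p ih => rw [binomTrunc_succ, ih, Nat.multichoose_zero_succ]; simp; ring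

theorem coeff_binomTrunc_one (p i : ℕ) (hi : i < p) :
    (binomTrunc s 1 p).coeff i = s ^ (p - 1 - i) := by
  induction p with
  | zero => omega
  | succ p ih =>
    rw [binomTrunc_succ, Nat.multichoose_one, Nat.cast_one, one_mul, coeff_add, coeff_C_mul,
      coeff_X_pow]
    rcases Nat.lt_succ_iff_lt_or_eq.1 hi with h | rfl
    · rw [ih h, if_neg h.ne, add_zero, ← pow_succ']
      congr 1; omega
    · have h0 : ∀ q, q ≤ i → (binomTrunc s 1 q).coeff i = 0 := by
        intro q hq
        induction q with
        | zero => simp [binomTrunc]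
        | succ q ihq =>
          rw [binomTrunc_succ, Nat.multichoose_one, Nat.cast_one, one_mul, coeff_add,
            coeff_C_mul, coeff_X_pow, ihq (by omega), if_neg (by omega)]
          simp
      rw [h0 i le_rfl]; simp

/-- The truncated series is homogeneous of degree p - 1 in s and T. -/
theorem eval_binomTrunc_mem (r p : ℕ) :
    (binomTrunc s r p).eval s ∈ Ideal.span {s ^ (p - 1)} := by
  induction p with
  | zero => simp [binomTrunc]
  | succ p ih =>
    rw [binomTrunc_succ, eval_add, eval_mul, eval_C, eval_mul, eval_natCast, eval_pow, eval_X,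
      Nat.add_sub_cancel]
    refine Ideal.add_mem _ ?_ (Ideal.mul_mem_left _ _ (Ideal.mem_span_singleton_self _))
    cases p with
    | zero => simp
    | succ p =>
      obtain ⟨c, hc⟩ := Ideal.mem_span_singleton.1 ih
      rw [hc, Nat.add_sub_cancel, ← mul_assoc, ← pow_succ']
      exact Ideal.mul_mem_right _ _ (Ideal.mem_span_singleton_self _)

/-- Comparing coefficients of T gives s g_0 ∈ I and g_i ≡ s g_(i+1). So the last coefficient h =
g_(p-1) determines the others as powers of s times h, and the condition on g_0 becomes s^p h ∈ I. -/
theorem exists_sub_binomTrunc_mul_mem {I : Ideal P} {p : ℕ} {g : Polynomial P}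
    (hg : (C s - X) * g ∈ I.map (C : P →+* Polynomial P) ⊔ Ideal.span {X ^ p}) :
    ∃ h, s ^ p * h ∈ I ∧ g - binomTrunc s 1 p * C h ∈
      I.map (C : P →+* Polynomial P) ⊔ Ideal.span {X ^ p} := by
  cases p with
  | zero => exact ⟨0, by simp, by simp⟩
  | succ q =>
    rw [mem_map_C_sup_span_X_pow] at hg
    have h0 : s * g.coeff 0 ∈ I := by
      have := hg 0 (Nat.succ_pos _)
      rwa [sub_mul, coeff_sub, coeff_C_mul, coeff_X_mul_zero, sub_zero] at this
    have h1 : ∀ i < q, s * g.coeff (i + 1) - g.coeff i ∈ I := by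
      intro i hi
      have := hg (i + 1) (by omega)
      rwa [sub_mul, coeff_sub, coeff_C_mul, coeff_X_mul] at this
    have h2 : ∀ j ≤ q, g.coeff (q - j) - s ^ j * g.coeff q ∈ I := by
      intro j hj
      induction j with
      | zero => simp
      | succ j ih =>
        have e := h1 (q - (j + 1)) (by omega)
        have hq : q - (j + 1) + 1 = q - j := by omega
        rw [hq] at e
        have := I.sub_mem (I.mul_mem_left s (ih (by omega))) e
        convert this using 1
        ring
    refine ⟨g.coeff q, ?_, mem_map_C_sup_span_X_pow.2 fun i hi => ?_⟩
    · have e := h2 q le_rfl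
      rw [Nat.sub_self] at e
      have := I.sub_mem h0 (I.mul_mem_left s e)
      convert this using 1
      ring
    · rw [coeff_sub, coeff_mul_C, coeff_binomTrunc_one s _ _ hi]
      have e := h2 (q - i) (by omega)
      have e1 : q - (q - i) = i := by omega
      have e2 : q + 1 - 1 - i = q - i := by omega
      rwa [e1] at e

end BinomialSeries
end StaircaseTraces

namespace StaircaseTraces

open Polynomial

/-! ### Controlled ideals and their behaviour under truncation and residuals. -/

section Controlled

variable {k : Type*} [Field k]

/-- Extension to `k[X][F][T]` of the monomial ideal of `E`. -/
noncomputable abbrev familyIdeal (k : Type*) [Field k] (E : Set (ℕ × ℕ)) : Ideal (FamilyPoly k) :=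
  (monomialIdeal k E).map (C : PlanePoly k →+* FamilyPoly k)

/-- The element `F - X` of `k[X][F]`. -/
noncomputable abbrev diffFX (k : Type*) [Field k] : PlanePoly k := varF k - varX k

/-- Two-sided control of an ideal `K` of `k[X][F][T]` containing `T^p`: up to the ideal of the
staircase `E` it is generated by multiples of truncated binomial series, where the `i`-th
coefficient ideal is squeezed between two ideals determined by `V i` and `a i`. -/
structure IsControlled (V : ℕ → Set (ℕ × ℕ)) (K : Ideal (FamilyPoly k)) (E : Set (ℕ × ℕ))
    (p j : ℕ) (a : ℕ → ℕ) : Prop where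
  le : familyIdeal k E ≤ K
  pow_mem : X ^ p ∈ K
  -- Here b is the net power of X - F multiplied in, and b - a i counts the divisions by X. Once
  -- these have occurred, `truncPow` is a genuine truncation, and F^(a i + 1) in the ideal of E
  -- makes the missing terms harmless.
  mul_mem : ∀ i ∈ Finset.Icc 1 j, ∃ b, a i ≤ b ∧ (b = a i ∨ (0, a i + 1) ∈ E) ∧
    ∀ v ∈ monomialIdeal k (V i),
      binomTrunc (diffFX k) (j + 1 - i) p * C (truncPow k b (a i) * v) ∈ K
  exists_sub_mem : ∀ g ∈ K, ∃ w : ℕ → FamilyPoly k,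
    (∀ i ∈ Finset.Icc 1 j, w i ∈ familyIdeal k (slantShift (V i) (a i))) ∧
      g - ∑ i ∈ Finset.Icc 1 j, binomTrunc (diffFX k) (j + 1 - i) p * w i ∈
        familyIdeal k E ⊔ Ideal.span {X ^ p}

variable {V : ℕ → Set (ℕ × ℕ)} {K : Ideal (FamilyPoly k)} {E : Set (ℕ × ℕ)} {p j : ℕ}
  {a : ℕ → ℕ}

theorem isControlled_base (V : ℕ → Set (ℕ × ℕ)) (E : Set (ℕ × ℕ)) (p : ℕ) (a : ℕ → ℕ) :
    IsControlled V (familyIdeal k E ⊔ Ideal.span {X ^ p}) E p 0 a where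
  le := le_sup_left
  pow_mem := Ideal.mem_sup_right (Ideal.mem_span_singleton_self _)
  mul_mem i hi := by simp at hi
  exists_sub_mem g hg := ⟨0, by simp, by simpa using hg⟩

theorem IsControlled.congr {E' : Set (ℕ × ℕ)} {a' : ℕ → ℕ} (h : IsControlled V K E p j a)
    (hE : E = E') (ha : ∀ i ∈ Finset.Icc 1 j, a i = a' i) : IsControlled V K E' p j a' := by
  subst hE
  refine ⟨h.le, h.pow_mem, fun i hi => ?_, fun g hg => ?_⟩
  · rw [← ha i hi]; exact h.mul_mem i hi
  · obtain ⟨w, hw, h'⟩ := h.exists_sub_mem g hg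
    exact ⟨w, fun i hi => by rw [← ha i hi]; exact hw i hi, h'⟩

/-- The errors in `sub_mul_truncPow` are multiples of a binomial coefficient, which is zero when b =
a, and of F^(a+1), which lies in I otherwise. -/
theorem pow_mul_truncPow_sub_mem {I : Ideal (PlanePoly k)} {a b : ℕ}
    (h : b = a ∨ varF k ^ (a + 1) ∈ I) (c : ℕ) :
    (varX k - varF k) ^ c * truncPow k b a - truncPow k (b + c) (a + c) ∈ I := by
  induction c with
  | zero => simp
  | succ c ih =>
    have e : (varX k - varF k) ^ (c + 1) * truncPow k b a - truncPow k (b + (c + 1)) (a + (c + 1))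
        = (varX k - varF k) * ((varX k - varF k) ^ c * truncPow k b a -
            truncPow k (b + c) (a + c)) -
          ((b + c).choose (a + c + 1) : PlanePoly k) * (-varF k) ^ (a + c + 1) := by
      rw [mul_sub, sub_mul_truncPow]; simp only [add_assoc]; ring
    rw [e]
    refine I.sub_mem (I.mul_mem_left _ ih) ?_
    rcases h with rfl | h
    · rw [Nat.choose_succ_self, Nat.cast_zero, zero_mul]; exact I.zero_mem
    · rw [neg_pow, show a + c + 1 = a + 1 + c by ring, pow_add (varF k)]
      exact I.mul_mem_left _ (I.mul_mem_left _ (I.mul_mem_right _ h))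

theorem C_mul_mem_familyIdeal {v : PlanePoly k} (hv : v ∈ monomialIdeal k E) :
    C v ∈ familyIdeal k E := Ideal.mem_map_of_mem _ hv

/-- The series of order p + c is s^c times that of order p, modulo T^p. The factor s^c passes to the
coefficients, where `truncPow` absorbs it in the lower bound and the slanted shift in the upper one.
-/
theorem IsControlled.truncate {c : ℕ} (h : IsControlled V K E (p + c) j a) (hE : IsStaircase E)
    (hV : ∀ i ∈ Finset.Icc 1 j, IsDiagonal (V i)) :
    IsControlled V (K ⊔ Ideal.span {X ^ p}) E p j fun i => a i + c := by
  have hX : ∀ g ∈ Ideal.span {(X : FamilyPoly k) ^ p}, g ∈ K ⊔ Ideal.span {X ^ p} :=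
    fun g hg => Ideal.mem_sup_right hg
  refine ⟨h.le.trans le_sup_left, hX _ (Ideal.mem_span_singleton_self _), fun i hi => ?_,
    fun g hg => ?_⟩
  · obtain ⟨b, hab, hb, hm⟩ := h.mul_mem i hi
    refine ⟨b + c, by omega, hb.imp (fun h => by rw [h])
      (fun h => hE.mem_of_le h le_rfl (by omega)), fun v hv => ?_⟩
    set Ψ := binomTrunc (diffFX k) (j + 1 - i) p
    have h1 : C (diffFX k) ^ c * Ψ * C (truncPow k b (a i) * v) ∈ K ⊔ Ideal.span {X ^ p} := by
      have h2 := Ideal.mul_mem_right (C (truncPow k b (a i) * v)) _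
        (hX _ (binomTrunc_add_sub_mem (diffFX k) (j + 1 - i) p c))
      have h3 := Ideal.mem_sup_left (T := Ideal.span {(X : FamilyPoly k) ^ p}) (hm v hv)
      have := Ideal.sub_mem _ h3 h2
      convert this using 1
      ring
    have h2 : Ψ * C (((varX k - varF k) ^ c * truncPow k b (a i) -
        truncPow k (b + c) (a i + c)) * v) ∈ K ⊔ Ideal.span {X ^ p} := by
      refine Ideal.mul_mem_left _ _ (Ideal.mem_sup_left (h.le (C_mul_mem_familyIdeal ?_)))
      refine Ideal.mul_mem_right _ _ (pow_mul_truncPow_sub_mem (hb.imp id fun h => ?_) c)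
      exact varF_pow_mem_monomialIdeal h
    -- The sign arises because `truncPow` is built from X - F, whereas s = F - X.
    have e : Ψ * C (truncPow k (b + c) (a i + c) * v) =
        (-1) ^ c * (C (diffFX k) ^ c * Ψ * C (truncPow k b (a i) * v)) -
        Ψ * C (((varX k - varF k) ^ c * truncPow k b (a i) -
          truncPow k (b + c) (a i + c)) * v) := by
      have : varX k - varF k = -1 * diffFX k := by simp only [diffFX]; ring
      rw [this, mul_pow]
      simp only [map_mul, map_sub, map_pow, map_neg, map_one]
      ring
    rw [e]
    exact Ideal.sub_mem _ (Ideal.mul_mem_left _ _ h1) h2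
  · obtain ⟨g', hg', u, hu, rfl⟩ := Submodule.mem_sup.1 hg
    obtain ⟨w, hw, hs⟩ := h.exists_sub_mem g' hg'
    have hle : Ideal.span {(X : FamilyPoly k) ^ (p + c)} ≤ Ideal.span {X ^ p} := by
      rw [Ideal.span_singleton_le_span_singleton]
      exact pow_dvd_pow _ (Nat.le_add_right _ _)
    refine ⟨fun i => C (diffFX k ^ c) * w i, fun i hi => ?_, ?_⟩
    · rw [add_comm, slantShift_add]
      refine Ideal.mem_map_C_iff.2 fun n => ?_
      rw [coeff_C_mul]
      exact pow_mul_mem_slantShift ((hV i hi).slantShift _) (Ideal.mem_map_C_iff.1 (hw i hi) n) c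
    · have e : g' + u - ∑ i ∈ Finset.Icc 1 j,
          binomTrunc (diffFX k) (j + 1 - i) p * (C (diffFX k ^ c) * w i) =
          (g' - ∑ i ∈ Finset.Icc 1 j, binomTrunc (diffFX k) (j + 1 - i) (p + c) * w i) +
          (u + ∑ i ∈ Finset.Icc 1 j, (binomTrunc (diffFX k) (j + 1 - i) (p + c) -
            C (diffFX k) ^ c * binomTrunc (diffFX k) (j + 1 - i) p) * w i) := by
        simp only [sub_mul, Finset.sum_sub_distrib, map_pow]
        have : ∀ i, binomTrunc (diffFX k) (j + 1 - i) p * (C (diffFX k) ^ c * w i) =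
          C (diffFX k) ^ c * binomTrunc (diffFX k) (j + 1 - i) p * w i := fun i => by ring
        simp only [this]
        ring
      rw [e]
      refine Ideal.add_mem _ (sup_le_sup_left hle _ hs) (Ideal.mem_sup_right (Ideal.add_mem _ hu
        (Ideal.sum_mem _ fun i _ => Ideal.mul_mem_right _ _ (binomTrunc_add_sub_mem _ _ _ _))))

/-- Coefficientwise division of a family with coefficients in `J` when `J ⊆ s J' + I`. -/
theorem exists_sub_C_mul_mem {I J J' : Ideal (PlanePoly k)} {s : PlanePoly k}
    (h : J ≤ Ideal.span {s} * J' ⊔ I) {w : FamilyPoly k}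
    (hw : w ∈ J.map (C : PlanePoly k →+* FamilyPoly k)) :
    ∃ z ∈ J'.map (C : PlanePoly k →+* FamilyPoly k),
      w - C s * z ∈ I.map (C : PlanePoly k →+* FamilyPoly k) := by
  have h' := Ideal.map_mono (f := (C : PlanePoly k →+* FamilyPoly k)) h hw
  rw [Ideal.map_sup, Ideal.map_mul, Ideal.map_span, Set.image_singleton] at h'
  obtain ⟨u, hu, v, hv, rfl⟩ := Submodule.mem_sup.1 h'
  obtain ⟨z, hz, rfl⟩ := Ideal.mem_span_singleton_mul.1 hu
  exact ⟨z, hz, by simpa using hv⟩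

/-- The border points of the shift have height at least c. This lets X or F - X be divided out of
the coefficients modulo the ideal of E. -/
theorem zero_mem_of_mem_slantShift (hE : IsStaircase E) {U : Set (ℕ × ℕ)} {c : ℕ}
    (hc : (0, c) ∈ E) (b : ℕ) (hb : (0, b) ∈ slantShift U c) : (0, b) ∈ E := by
  have := le_add_of_mem_slantShift hb
  exact hE.mem_of_le hc le_rfl (by omega)

/-- Since F^(a i) lies in the ideal of E, X divides each coefficient modulo that ideal. Subtracting
the divided generators leaves a family with X g ∈ I_E + (T^p), for which the colon is a translation.
From below, `truncPow` b (c + 1) is X times `truncPow` b c up to a multiple of F^(c+1). -/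
theorem IsControlled.colon_varX (h : IsControlled V K E p j a) (hE : IsStaircase E)
    (ha : ∀ i ∈ Finset.Icc 1 j, 1 ≤ a i ∧ (0, a i) ∈ E) :
    IsControlled V (Submodule.colon K {C (varX k)}) (horizTranslate E 1) p j
      fun i => a i - 1 := by
  refine ⟨?_, le_colon_singleton _ _ h.pow_mem, fun i hi => ?_, fun g hg => ?_⟩
  · intro g hg
    rw [Submodule.mem_colon_singleton, smul_eq_mul, mul_comm]
    refine h.le (Ideal.mem_map_C_iff.2 fun n => ?_)
    rw [coeff_C_mul, varX_mul_mem_monomialIdeal_iff hE]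
    exact Ideal.mem_map_C_iff.1 hg n
  · obtain ⟨h1, h0⟩ := ha i hi
    obtain ⟨b, hab, -, hm⟩ := h.mul_mem i hi
    obtain ⟨c, hc⟩ : ∃ c, a i = c + 1 := ⟨a i - 1, by omega⟩
    rw [hc] at hab h0 hm ⊢
    simp only [Nat.add_sub_cancel]
    refine ⟨b, by omega, Or.inr (subset_horizTranslate hE 1 h0), fun v hv => ?_⟩
    rw [Submodule.mem_colon_singleton, smul_eq_mul]
    have e : binomTrunc (diffFX k) (j + 1 - i) p * C (truncPow k b c * v) * C (varX k) =
        binomTrunc (diffFX k) (j + 1 - i) p * C (truncPow k b (c + 1) * v) -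
        binomTrunc (diffFX k) (j + 1 - i) p * C ((b.choose (c + 1) : PlanePoly k) *
          ((-1) ^ (c + 1) * v * varF k ^ (c + 1))) := by
      rw [show truncPow k b (c + 1) = varX k * truncPow k b c +
        (b.choose (c + 1) : PlanePoly k) * (-varF k) ^ (c + 1) from rfl, neg_pow]
      simp only [map_mul, map_add]
      ring
    rw [e]
    refine K.sub_mem (hm v hv) (K.mul_mem_left _ (h.le (C_mul_mem_familyIdeal ?_)))
    exact Ideal.mul_mem_left _ _ (Ideal.mul_mem_left _ _ (varF_pow_mem_monomialIdeal h0))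
  · rw [Submodule.mem_colon_singleton, smul_eq_mul] at hg
    obtain ⟨w, hw, hs⟩ := h.exists_sub_mem _ hg
    have hz : ∀ i, ∃ z, i ∈ Finset.Icc 1 j → z ∈ familyIdeal k (slantShift (V i) (a i - 1)) ∧
        w i - C (varX k) * z ∈ familyIdeal k E := by
      intro i
      by_cases hi : i ∈ Finset.Icc 1 j
      · obtain ⟨h1, h0⟩ := ha i hi
        obtain ⟨z, hz, hz'⟩ := exists_sub_C_mul_mem
          (monomialIdeal_le_varX_mul_sup (zero_mem_of_mem_slantShift hE h0)) (hw i hi)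
        refine ⟨z, fun _ => ⟨?_, hz'⟩⟩
        obtain ⟨c, hc⟩ : ∃ c, a i = c + 1 := ⟨a i - 1, by omega⟩
        rw [hc, Nat.add_sub_cancel]
        rwa [hc, horizTranslate_slantShift_succ] at hz
      · exact ⟨0, fun h => absurd h hi⟩
    choose z hz using hz
    refine ⟨z, fun i hi => (hz i hi).1, ?_⟩
    have key : C (varX k) * (g - ∑ i ∈ Finset.Icc 1 j,
        binomTrunc (diffFX k) (j + 1 - i) p * z i) ∈ familyIdeal k E ⊔ Ideal.span {X ^ p} := by
      have e : C (varX k) * (g - ∑ i ∈ Finset.Icc 1 j,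
          binomTrunc (diffFX k) (j + 1 - i) p * z i) =
          (g * C (varX k) - ∑ i ∈ Finset.Icc 1 j, binomTrunc (diffFX k) (j + 1 - i) p * w i) +
          ∑ i ∈ Finset.Icc 1 j, binomTrunc (diffFX k) (j + 1 - i) p *
            (w i - C (varX k) * z i) := by
        simp only [mul_sub, Finset.sum_sub_distrib, Finset.mul_sum]
        have : ∀ i, C (varX k) * (binomTrunc (diffFX k) (j + 1 - i) p * z i) =
          binomTrunc (diffFX k) (j + 1 - i) p * (C (varX k) * z i) := fun i => by ring
        simp only [this]
        ring
      rw [e]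
      exact Ideal.add_mem _ hs (Ideal.mem_sup_left (Ideal.sum_mem _ fun i hi =>
        Ideal.mul_mem_left _ _ (hz i hi).2))
    rw [mem_map_C_sup_span_X_pow] at key ⊢
    intro i hi
    have := key i hi
    rwa [coeff_C_mul, varX_mul_mem_monomialIdeal_iff hE] at this

/-- For an old generator, r grows by one while its coefficient is divided by s. What remains of g
solves (s - T) g ∈ I_E + (T^p), so it is a multiple of the series with r = 1 and coefficient in τ(E,
p); this is the new generator j + 1. The monomial part E does not move. -/
theorem IsControlled.colon_sub (h : IsControlled V K E p j a) (hE : IsStaircase E)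
    (hE' : IsDiagonal E) (hV : ∀ i ∈ Finset.Icc 1 j, IsDiagonal (V i))
    (hVj : V (j + 1) = horizTranslate E p)
    (ha : ∀ i ∈ Finset.Icc 1 j, 1 ≤ a i ∧ (0, a i) ∈ E) :
    IsControlled V (Submodule.colon K {C (diffFX k) - X}) E p (j + 1)
      fun i => if i = j + 1 then 0 else a i - 1 := by
  have hspan : ∀ g ∈ Ideal.span {(X : FamilyPoly k) ^ p}, g ∈ K := by
    intro g hg
    exact (Ideal.span_singleton_le_iff_mem K).2 h.pow_mem hg
  refine ⟨h.le.trans (le_colon_singleton _ _), le_colon_singleton _ _ h.pow_mem,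
    fun i hi => ?_, fun g hg => ?_⟩
  · by_cases hij : i = j + 1
    · subst hij
      rw [if_pos rfl]
      refine ⟨0, le_rfl, Or.inl rfl, fun v hv => ?_⟩
      rw [Submodule.mem_colon_singleton, smul_eq_mul, show j + 1 + 1 - (j + 1) = 0 + 1 by omega,
        truncPow, one_mul]
      have h1 := K.mul_mem_right (C v) (hspan _ (sub_mul_binomTrunc_sub_mem (diffFX k) 0 p))
      -- For p ≥ 1 the product s · `binomTrunc` s 0 p is s^p, which carries the ideal of τ(E, p)
      -- into that of E.
      have h2 : C (diffFX k) * binomTrunc (diffFX k) 0 p * C v ∈ K := by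
        cases p with
        | zero => simp [binomTrunc]
        | succ p =>
          rw [binomTrunc_zero_succ, ← map_pow, ← map_mul, ← pow_succ', ← map_mul]
          refine h.le (C_mul_mem_familyIdeal ?_)
          rw [pow_mul_mem_monomialIdeal_iff hE hE', ← hVj]
          exact hv
      have := K.add_mem h1 h2
      convert this using 1
      ring
    · rw [if_neg hij]
      have hi' : i ∈ Finset.Icc 1 j := by rw [Finset.mem_Icc] at hi ⊢; omega
      obtain ⟨h1, h0⟩ := ha i hi'
      obtain ⟨b, hab, -, hm⟩ := h.mul_mem i hi'
      obtain ⟨c, hc⟩ : ∃ c, a i = c + 1 := ⟨a i - 1, by omega⟩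
      obtain ⟨d, hd⟩ : ∃ d, b = d + 1 := ⟨b - 1, by omega⟩
      subst hd
      rw [hc] at hab h0 hm ⊢
      simp only [Nat.add_sub_cancel]
      refine ⟨d, by omega, Or.inr h0, fun v hv => ?_⟩
      have hr : j + 1 + 1 - i = j + 1 - i + 1 := by rw [Finset.mem_Icc] at hi; omega
      rw [Submodule.mem_colon_singleton, smul_eq_mul, hr]
      set Ψ := binomTrunc (diffFX k) (j + 1 - i) p
      have h3 := K.mul_mem_right (C (truncPow k d c * v))
        (hspan _ (sub_mul_binomTrunc_sub_mem (diffFX k) (j + 1 - i) p))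
      have h4 : Ψ * C ((d.choose (c + 1) : PlanePoly k) *
          ((-1) ^ (c + 1) * v * varF k ^ (c + 1))) ∈ K :=
        K.mul_mem_left _ (h.le (C_mul_mem_familyIdeal (Ideal.mul_mem_left _ _
          (Ideal.mul_mem_left _ _ (varF_pow_mem_monomialIdeal h0)))))
      have e : binomTrunc (diffFX k) (j + 1 - i + 1) p * C (truncPow k d c * v) *
          (C (diffFX k) - X) =
          ((C (diffFX k) - X) * binomTrunc (diffFX k) (j + 1 - i + 1) p - C (diffFX k) * Ψ) *
            C (truncPow k d c * v) - Ψ * C (truncPow k (d + 1) (c + 1) * v) +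
          Ψ * C ((d.choose (c + 1) : PlanePoly k) *
          ((-1) ^ (c + 1) * v * varF k ^ (c + 1))) := by
        have e1 : diffFX k * truncPow k d c = -(truncPow k (d + 1) (c + 1) -
            (d.choose (c + 1) : PlanePoly k) * ((-1) ^ (c + 1) * varF k ^ (c + 1))) := by
          rw [← neg_pow, ← sub_mul_truncPow]; simp only [diffFX]; ring
        have e2 : C (diffFX k) * C (truncPow k d c) = -(C (truncPow k (d + 1) (c + 1)) -
            C (d.choose (c + 1) : PlanePoly k) * (C ((-1) ^ (c + 1)) * C (varF k ^ (c + 1)))) := by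
          rw [← map_mul, e1]; simp only [map_neg, map_sub, map_mul]
        simp only [map_mul]
        linear_combination Ψ * C v * e2
      rw [e]
      exact K.add_mem (K.sub_mem h3 (hm v hv)) h4
  · rw [Submodule.mem_colon_singleton, smul_eq_mul] at hg
    obtain ⟨w, hw, hs⟩ := h.exists_sub_mem _ hg
    have hz : ∀ i, ∃ z, i ∈ Finset.Icc 1 j → z ∈ familyIdeal k (slantShift (V i) (a i - 1)) ∧
        w i - C (diffFX k) * z ∈ familyIdeal k E := by
      intro i
      by_cases hi : i ∈ Finset.Icc 1 j
      · obtain ⟨h1, h0⟩ := ha i hi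
        obtain ⟨z, hz, hz'⟩ := exists_sub_C_mul_mem (monomialIdeal_le_sub_mul_sup
          ((hV i hi).slantShift _) (zero_mem_of_mem_slantShift hE h0)) (hw i hi)
        refine ⟨z, fun _ => ⟨?_, hz'⟩⟩
        obtain ⟨c, hc⟩ : ∃ c, a i = c + 1 := ⟨a i - 1, by omega⟩
        rw [hc, Nat.add_sub_cancel]
        rwa [hc, horizTranslate_slantShift_succ] at hz
      · exact ⟨0, fun h => absurd h hi⟩
    choose z hz using hz
    have key : (C (diffFX k) - X) * (g - ∑ i ∈ Finset.Icc 1 j,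
        binomTrunc (diffFX k) (j + 1 - i + 1) p * z i) ∈
          familyIdeal k E ⊔ Ideal.span {X ^ p} := by
      have e : (C (diffFX k) - X) * (g - ∑ i ∈ Finset.Icc 1 j,
          binomTrunc (diffFX k) (j + 1 - i + 1) p * z i) =
          (g * (C (diffFX k) - X) -
            ∑ i ∈ Finset.Icc 1 j, binomTrunc (diffFX k) (j + 1 - i) p * w i) +
          ∑ i ∈ Finset.Icc 1 j, (binomTrunc (diffFX k) (j + 1 - i) p *
            (w i - C (diffFX k) * z i) -
            z i * ((C (diffFX k) - X) * binomTrunc (diffFX k) (j + 1 - i + 1) p -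
              C (diffFX k) * binomTrunc (diffFX k) (j + 1 - i) p)) := by
        have e1 : ∀ i, binomTrunc (diffFX k) (j + 1 - i) p * (w i - C (diffFX k) * z i) -
            z i * ((C (diffFX k) - X) * binomTrunc (diffFX k) (j + 1 - i + 1) p -
              C (diffFX k) * binomTrunc (diffFX k) (j + 1 - i) p) =
            binomTrunc (diffFX k) (j + 1 - i) p * w i -
            (C (diffFX k) - X) * (binomTrunc (diffFX k) (j + 1 - i + 1) p * z i) :=
          fun i => by ring
        simp only [e1, Finset.sum_sub_distrib, ← Finset.mul_sum]
        ring
      rw [e]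
      exact Ideal.add_mem _ hs (Ideal.sum_mem _ fun i hi => Ideal.sub_mem _
        (Ideal.mem_sup_left (Ideal.mul_mem_left _ _ (hz i hi).2))
        (Ideal.mem_sup_right (Ideal.mul_mem_left _ _ (sub_mul_binomTrunc_sub_mem _ _ _))))
    obtain ⟨u, hu, hu'⟩ := exists_sub_binomTrunc_mul_mem _ key
    refine ⟨fun i => if i = j + 1 then C u else z i, fun i hi => ?_, ?_⟩
    · by_cases hij : i = j + 1
      · subst hij
        simp only [if_true]
        rw [slantShift_zero, hVj]
        refine C_mul_mem_familyIdeal ?_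
        rwa [pow_mul_mem_monomialIdeal_iff hE hE'] at hu
      · simp only [if_neg hij]
        exact (hz i (by rw [Finset.mem_Icc] at hi ⊢; omega)).1
    · rw [Finset.sum_Icc_succ_top (by omega)]
      simp only [if_true]
      have e : ∑ i ∈ Finset.Icc 1 j, binomTrunc (diffFX k) (j + 1 + 1 - i) p *
          (if i = j + 1 then C u else z i) =
          ∑ i ∈ Finset.Icc 1 j, binomTrunc (diffFX k) (j + 1 - i + 1) p * z i := by
        refine Finset.sum_congr rfl fun i hi => ?_
        rw [Finset.mem_Icc] at hi
        rw [if_neg (by omega), show j + 1 + 1 - i = j + 1 - i + 1 by omega]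
      rw [e, show j + 1 + 1 - (j + 1) = 1 by omega, ← sub_sub]
      exact hu'

end Controlled
end StaircaseTraces

namespace StaircaseTraces

open Polynomial

/-! ### Traces of controlled ideals, and controlled ideals of order one. -/

section TraceIdeals

universe u
variable {k : Type u} [Field k]

theorem sub_aeval_familyEval_mem {q : k[X]} {N : Ideal (FamilyPoly k)} (hT : X ∈ N)
    (hX : C (varX k) - aeval (C (varF k)) q ∈ N) (g : FamilyPoly k) :
    g - aeval (C (varF k)) (familyEval k q X 0 g) ∈ N := by
  let mk : FamilyPoly k →ₐ[k] FamilyPoly k ⧸ N := Ideal.Quotient.mkₐ k N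
  have h : mk = (mk.comp (aeval (C (varF k)))).comp (familyEval k q X 0) := by
    refine familyPoly_algHom_ext ?_ ?_ ?_
    · have : mk (C (varX k)) = mk (aeval (C (varF k)) q) :=
        (Ideal.Quotient.mk_eq_mk_iff_sub_mem _ _).2 hX
      simpa using this
    · simp
    · have : mk X = 0 := Ideal.Quotient.eq_zero_iff_mem.2 hT
      simpa using this
  exact (Ideal.Quotient.mk_eq_mk_iff_sub_mem _ _).1 (DFunLike.congr_fun h g)

/-- Modulo N everything is a polynomial in F, as X = q(F) and T = 0; the last two hypotheses make
F^h the exact relation. -/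
theorem rank_quotient_eq_of_familyEval {q : k[X]} {N : Ideal (FamilyPoly k)} {h : ℕ}
    (hT : X ∈ N) (hX : C (varX k) - aeval (C (varF k)) q ∈ N) (hF : C (varF k) ^ h ∈ N)
    (hN : ∀ g ∈ N, familyEval k q X 0 g ∈ Ideal.span {(X : k[X]) ^ h}) :
    Module.rank k (FamilyPoly k ⧸ N) = (h : Cardinal) := by
  have e : N = (Ideal.span {(X : k[X]) ^ h}).comap (familyEval k q X 0) := by
    refine le_antisymm hN fun g hg => ?_
    obtain ⟨c, hc⟩ := Ideal.mem_span_singleton.1 (Ideal.mem_comap.1 hg)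
    have h1 := sub_aeval_familyEval_mem hT hX g
    rw [hc, map_mul, map_pow, aeval_X] at h1
    have := N.add_mem h1 (N.mul_mem_right (aeval (C (varF k)) c) hF)
    rwa [sub_add_cancel] at this
  have hsurj : Function.Surjective (familyEval k q X 0) := by
    intro c
    refine ⟨aeval (C (varF k)) c, ?_⟩
    have : (familyEval k q X 0).comp (aeval (C (varF k))) = AlgHom.id k k[X] := by
      ext; simp
    exact DFunLike.congr_fun this c
  rw [e, rank_quotient_comap_of_surjective _ hsurj]
  have hm : ((X : k[X]) ^ h).Monic := monic_X_pow h
  have := rank_eq_card_basis (AdjoinRoot.powerBasis' hm).basis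
  rw [Fintype.card_fin, AdjoinRoot.powerBasis'_dim, natDegree_X_pow] at this
  exact this

theorem familyEval_eq_planeEval_coeff (q : k[X]) (g : FamilyPoly k) :
    familyEval k q X 0 g = planeEval k q X (g.coeff 0) := by
  have : (familyEval k q X 0).toRingHom =
      (planeEval k q X).toRingHom.comp (constantCoeff : FamilyPoly k →+* PlanePoly k) := by
    refine Polynomial.ringHom_ext ?_ ?_
    · intro c
      change familyEval k q X 0 (C c) = planeEval k q X ((C c).coeff 0)
      rw [familyEval_C, coeff_C_zero]
    · change familyEval k q X 0 X = planeEval k q X ((X : FamilyPoly k).coeff 0)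
      rw [familyEval_X, coeff_X_zero, map_zero]
  exact DFunLike.congr_fun this g

theorem familyEval_eq_planeEval_eval (g : FamilyPoly k) :
    familyEval k (X : k[X]) X 0 g = planeEval k (X : k[X]) X (g.eval (diffFX k)) := by
  have : (familyEval k (X : k[X]) X 0).toRingHom =
      (planeEval k (X : k[X]) X).toRingHom.comp (evalRingHom (diffFX k)) := by
    refine Polynomial.ringHom_ext ?_ ?_
    · intro c
      change familyEval k (X : k[X]) X 0 (C c) = planeEval k (X : k[X]) X ((C c).eval (diffFX k))
      rw [familyEval_C, eval_C]
    · change familyEval k (X : k[X]) X 0 X = planeEval k (X : k[X]) X ((X : FamilyPoly k).eval (diffFX k))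
      rw [familyEval_X, eval_X]
      simp
  exact DFunLike.congr_fun this g

theorem eval_mem_of_mem_map_C {P : Type*} [CommRing P] {I : Ideal P} {g : P[X]}
    (hg : g ∈ I.map (C : P →+* P[X])) (s : P) : g.eval s ∈ I := by
  have := Ideal.mem_map_of_mem (evalRingHom s) hg
  rw [Ideal.map_map] at this
  have e : (evalRingHom s).comp C = RingHom.id P := RingHom.ext fun a => eval_C
  rwa [e, Ideal.map_id] at this

variable {V : ℕ → Set (ℕ × ℕ)} {K : Ideal (FamilyPoly k)} {E : Set (ℕ × ℕ)} {p j h : ℕ}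
  {a : ℕ → ℕ}

/-- Modulo s - T the variable T becomes s, and the colon by T^(p-1) a colon by s^(p-1). The ideal of
E gives that of τ(E, p - 1), and the series become multiples of s^(p-1) with cofactors of order at
least h. Setting T = 0 then identifies X with F and leaves k[F] / (F^h). -/
theorem IsControlled.rank_trace_sub (hK : IsControlled V K E p j a) (hE : IsStaircase E)
    (hE' : IsDiagonal E) (hp : 1 ≤ p) (ha : ∀ i ∈ Finset.Icc 1 j, (0, a i) ∈ E)
    (hh : (p - 1, h) ∈ E) (hmin : ∀ b, (p - 1, b) ∈ E → h ≤ b) :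
    Module.rank k (FamilyPoly k ⧸ Submodule.colon (K ⊔ Ideal.span {C (diffFX k) - X})
      {(X : FamilyPoly k) ^ (p - 1)} ⊔ Ideal.span {X}) = (h : Cardinal) := by
  set N := Submodule.colon (K ⊔ Ideal.span {C (diffFX k) - X})
      {(X : FamilyPoly k) ^ (p - 1)} with hN
  have hs : C (diffFX k) - X ∈ N :=
    le_colon_singleton _ _ (Ideal.mem_sup_right (Ideal.mem_span_singleton_self _))
  have hT : X ∈ N ⊔ Ideal.span {X} := Ideal.mem_sup_right (Ideal.mem_span_singleton_self _)
  -- The elements divisible by an h-th power once X and F are identified, as they are when T = s and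
  -- T = 0.
  let L : Ideal (PlanePoly k) :=
    (Ideal.span {(X : k[X]) ^ h}).comap (planeEval k (X : k[X]) X)
  have hmon : ∀ {c d : ℕ}, h ≤ c + d → varX k ^ c * varF k ^ d ∈ L := by
    intro c d hcd
    rw [Ideal.mem_comap, map_mul, map_pow, map_pow, planeEval_varX, planeEval_varF, ← pow_add,
      Ideal.mem_span_singleton]
    exact pow_dvd_pow _ hcd
  have hLs : diffFX k ∈ L := by
    rw [Ideal.mem_comap]; simp
  refine rank_quotient_eq_of_familyEval (q := X) hT ?_ (Ideal.mem_sup_left ?_) ?_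
  · rw [aeval_X]
    have e : C (varX k) - C (varF k) = -(C (diffFX k) - X) - X := by
      rw [map_sub]; ring
    rw [e]
    exact Ideal.sub_mem _ (neg_mem (Ideal.mem_sup_left hs)) hT
  · rw [hN, Submodule.mem_colon_singleton, smul_eq_mul]
    have h1 : C (varF k) ^ h * C (diffFX k) ^ (p - 1) ∈ K := by
      rw [← map_pow, ← map_pow, ← map_mul, mul_comm]
      refine hK.le (C_mul_mem_familyIdeal ?_)
      rw [pow_mul_mem_monomialIdeal_iff hE hE']
      exact varF_pow_mem_monomialIdeal (by rwa [mem_horizTranslate, zero_add])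
    have h2 : C (diffFX k) ^ (p - 1) - X ^ (p - 1) ∈ Ideal.span {C (diffFX k) - X} :=
      Ideal.mem_span_singleton.2 (sub_dvd_pow_sub_pow _ _ _)
    have := Ideal.sub_mem _ (Ideal.mem_sup_left (T := Ideal.span {C (diffFX k) - X}) h1)
      (Ideal.mul_mem_left _ (C (varF k) ^ h) (Ideal.mem_sup_right (S := K) h2))
    convert this using 1
    ring
  · have hKL : ∀ g ∈ K, g.eval (diffFX k) ∈
        monomialIdeal k E ⊔ Ideal.span {diffFX k ^ (p - 1)} * L := by
      intro g hg
      obtain ⟨w, hw, hs⟩ := hK.exists_sub_mem g hg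
      have h1 : (g - ∑ i ∈ Finset.Icc 1 j, binomTrunc (diffFX k) (j + 1 - i) p * w i).eval
          (diffFX k) ∈ monomialIdeal k E ⊔ Ideal.span {diffFX k ^ (p - 1)} * L := by
        obtain ⟨u, hu, v, hv, e⟩ := Submodule.mem_sup.1 hs
        rw [← e, eval_add]
        refine Ideal.add_mem _ (Ideal.mem_sup_left (eval_mem_of_mem_map_C hu _))
          (Ideal.mem_sup_right ?_)
        obtain ⟨c, rfl⟩ := Ideal.mem_span_singleton.1 hv
        rw [eval_mul, eval_pow, eval_X]
        refine Ideal.mem_span_singleton_mul.2 ⟨diffFX k * c.eval (diffFX k),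
          L.mul_mem_right _ hLs, ?_⟩
        rw [← mul_assoc, ← pow_succ, Nat.sub_add_cancel hp]
      have h2 : (∑ i ∈ Finset.Icc 1 j, binomTrunc (diffFX k) (j + 1 - i) p * w i).eval
          (diffFX k) ∈ monomialIdeal k E ⊔ Ideal.span {diffFX k ^ (p - 1)} * L := by
        rw [eval_finsetSum]
        refine Ideal.mem_sup_right (Ideal.sum_mem _ fun i hi => ?_)
        rw [eval_mul]
        refine Ideal.mul_mem_mul (eval_binomTrunc_mem _ _ _) ?_
        have hle : monomialIdeal k (slantShift (V i) (a i)) ≤ L := by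
          rw [monomialIdeal_le_iff]
          intro c d hcd
          refine hmon ((hmin _ ?_).trans (le_add_of_mem_slantShift hcd))
          exact hE.mem_of_le (ha i hi) (Nat.zero_le _) le_rfl
        exact hle (eval_mem_of_mem_map_C (hw i hi) _)
      have := Ideal.add_mem _ h1 h2
      rwa [eval_sub, sub_add_cancel] at this
    have hNL : ∀ g ∈ N, familyEval k X X 0 g ∈ Ideal.span {(X : k[X]) ^ h} := by
      intro g hg
      rw [hN, Submodule.mem_colon_singleton, smul_eq_mul] at hg
      obtain ⟨u, hu, v, hv, e⟩ := Submodule.mem_sup.1 hg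
      obtain ⟨c, rfl⟩ := Ideal.mem_span_singleton.1 hv
      have h1 : g.eval (diffFX k) * diffFX k ^ (p - 1) = u.eval (diffFX k) := by
        have := congrArg (eval (diffFX k)) e
        rw [eval_add, eval_mul, eval_sub, eval_C, eval_X, sub_self, zero_mul, add_zero,
          eval_mul, eval_pow, eval_X] at this
        exact this.symm
      have h2 := hKL u hu
      rw [← h1] at h2
      obtain ⟨r, hr, v, hv, e⟩ := Submodule.mem_sup.1 h2
      obtain ⟨l, hl, rfl⟩ := Ideal.mem_span_singleton_mul.1 hv
      have h3 : diffFX k ^ (p - 1) * (g.eval (diffFX k) - l) ∈ monomialIdeal k E := by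
        convert hr using 1
        rw [mul_sub, mul_comm _ (g.eval (diffFX k)), ← e]; ring
      rw [pow_mul_mem_monomialIdeal_iff hE hE'] at h3
      have hle : monomialIdeal k (horizTranslate E (p - 1)) ≤ L := by
        rw [monomialIdeal_le_iff]
        intro c d hcd
        refine hmon ?_
        have := hmin (d + c) (hE'.mem_of_add c (by rw [add_comm]; exact hcd))
        omega
      have := L.add_mem (hle h3) hl
      rw [sub_add_cancel] at this
      rw [familyEval_eq_planeEval_eval]
      exact this
    intro g hg
    obtain ⟨u, hu, v, hv, rfl⟩ := Submodule.mem_sup.1 hg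
    obtain ⟨c, rfl⟩ := Ideal.mem_span_singleton.1 hv
    rw [map_add, map_mul, familyEval_X, zero_mul, add_zero]
    exact hNL u hu

/-- At X = 0 a coefficient of a controlled generator is a multiple of F^(a i), hence of F^h, so only
E contributes to the trace. -/
theorem IsControlled.rank_trace_varX (hK : IsControlled V K E p j a)
    (hp : 1 ≤ p) (ha : ∀ i ∈ Finset.Icc 1 j, (0, a i) ∈ E)
    (hh : (0, h) ∈ E) (hmin : ∀ b, (0, b) ∈ E → h ≤ b) :
    Module.rank k (FamilyPoly k ⧸ Submodule.colon (K ⊔ Ideal.span {C (varX k)})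
      {(X : FamilyPoly k) ^ (p - 1)} ⊔ Ideal.span {X}) = (h : Cardinal) := by
  set N := Submodule.colon (K ⊔ Ideal.span {C (varX k)})
      {(X : FamilyPoly k) ^ (p - 1)} with hN
  have hT : X ∈ N ⊔ Ideal.span {X} := Ideal.mem_sup_right (Ideal.mem_span_singleton_self _)
  let Q : Ideal (PlanePoly k) :=
    (Ideal.span {(X : k[X]) ^ h}).comap (planeEval k (0 : k[X]) X)
  have hmon : ∀ {c d : ℕ}, (c = 0 → h ≤ d) → varX k ^ c * varF k ^ d ∈ Q := by
    intro c d hcd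
    rw [Ideal.mem_comap, map_mul, map_pow, map_pow, planeEval_varX, planeEval_varF]
    rcases Nat.eq_zero_or_pos c with rfl | hc
    · rw [pow_zero, one_mul, Ideal.mem_span_singleton]
      exact pow_dvd_pow _ (hcd rfl)
    · rw [zero_pow hc.ne', zero_mul]; exact Ideal.zero_mem _
  refine rank_quotient_eq_of_familyEval (q := 0) hT ?_ (Ideal.mem_sup_left ?_) ?_
  · rw [map_zero, sub_zero]
    exact Ideal.mem_sup_left
      (le_colon_singleton _ _ (Ideal.mem_sup_right (Ideal.mem_span_singleton_self _)))
  · refine le_colon_singleton _ _ (Ideal.mem_sup_left (hK.le ?_))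
    rw [← map_pow]
    exact C_mul_mem_familyIdeal (varF_pow_mem_monomialIdeal hh)
  · have hEQ : familyIdeal k E ≤ Q.map C := Ideal.map_mono (by
      rw [monomialIdeal_le_iff]
      intro c d hcd
      exact hmon (by rintro rfl; exact hmin d hcd))
    have hKQ : K ⊔ Ideal.span {C (varX k)} ≤ Q.map C ⊔ Ideal.span {X ^ p} := by
      refine sup_le (fun g hg => ?_) ?_
      · obtain ⟨w, hw, hs⟩ := hK.exists_sub_mem g hg
        have h1 := sup_le_sup_right hEQ _ hs
        have h2 : ∑ i ∈ Finset.Icc 1 j, binomTrunc (diffFX k) (j + 1 - i) p * w i ∈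
            Q.map C ⊔ Ideal.span {(X : FamilyPoly k) ^ p} := by
          refine Ideal.mem_sup_left (Ideal.sum_mem _ fun i hi => Ideal.mul_mem_left _ _ ?_)
          refine Ideal.map_mono ?_ (hw i hi)
          rw [monomialIdeal_le_iff]
          intro c d hcd
          refine hmon ?_
          rintro rfl
          have := le_add_of_mem_slantShift hcd
          have := hmin _ (ha i hi)
          omega
        have := Ideal.add_mem _ h1 h2
        rwa [sub_add_cancel] at this
      · rw [Ideal.span_singleton_le_iff_mem]
        refine Ideal.mem_sup_left (Ideal.mem_map_of_mem _ ?_)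
        have := hmon (c := 1) (d := 0) (by simp)
        simpa using this
    intro g hg
    obtain ⟨u, hu, v, hv, rfl⟩ := Submodule.mem_sup.1 hg
    obtain ⟨c, rfl⟩ := Ideal.mem_span_singleton.1 hv
    rw [map_add, map_mul, familyEval_X, zero_mul, add_zero, familyEval_eq_planeEval_coeff]
    rw [hN, Submodule.mem_colon_singleton, smul_eq_mul] at hu
    have := mem_map_C_sup_span_X_pow.1 (hKQ hu) (p - 1) (by omega)
    rw [coeff_mul_X_pow', if_pos le_rfl, Nat.sub_self] at this
    exact this

/-- At order 1 the series are 1 modulo T, so only the coefficient ideals count. From above, each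
slanted shift lies in `G` 1. From below, the chain is climbed from `G` (j + 1) to `G` 1: at each i
the lower terms of `truncPow` lie in `G` (i + 1), which sets free the translate of `V` i. -/
theorem IsControlled.eq_of_deletion_chain {G : ℕ → Set (ℕ × ℕ)}
    (hK : IsControlled V K (G (j + 1)) 1 j a)
    (hV : ∀ i ∈ Finset.Icc 1 j, IsDiagonal (V i))
    (hG : ∀ i ∈ Finset.Icc 1 j, ∀ m d, 1 ≤ m → m ≤ a i → (0, d) ∈ V i →
      (a i - m, d + m) ∈ G (i + 1))
    (hle : ∀ i ∈ Finset.Icc 1 j, G (i + 1) ⊆ G i)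
    (hsub : ∀ i ∈ Finset.Icc 1 j, ∀ x b, (x, b) ∈ V i → (a i + x, b) ∈ G i)
    (hsup : ∀ i ∈ Finset.Icc 1 j, ∀ c b, (c, b) ∈ G i → (c, b) ∈ G (i + 1) ∨
      ∃ x, c = a i + x ∧ (x, b) ∈ V i) :
    K = familyIdeal k (G 1) ⊔ Ideal.span {X ^ 1} := by
  have hanti : ∀ i, 1 ≤ i → i ≤ j + 1 → G i ⊆ G 1 := by
    intro i h1 h2
    induction i, h1 using Nat.le_induction with
    | base => exact subset_rfl
    | succ i hi ih => exact (hle i (Finset.mem_Icc.2 ⟨hi, by omega⟩)).trans (ih (by omega))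
  apply le_antisymm
  · intro g hg
    obtain ⟨w, hw, hs⟩ := hK.exists_sub_mem g hg
    have h0 : familyIdeal k (G (j + 1)) ≤ familyIdeal k (G 1) :=
      Ideal.map_mono (monomialIdeal_mono (hanti (j + 1) (by omega) le_rfl))
    have h1 := sup_le_sup_right h0 _ hs
    have h2 : ∑ i ∈ Finset.Icc 1 j, binomTrunc (diffFX k) (j + 1 - i) 1 * w i ∈
        familyIdeal k (G 1) ⊔ Ideal.span {X ^ 1} := by
      refine Ideal.mem_sup_left (Ideal.sum_mem _ fun i hi => Ideal.mul_mem_left _ _ ?_)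
      refine Ideal.map_mono (monomialIdeal_mono ?_) (hw i hi)
      rintro ⟨c, b⟩ hcb
      have hi' := Finset.mem_Icc.1 hi
      rcases mem_slantShift_cases hcb with ⟨x, rfl, hx⟩ | ⟨m, d, hm, hcm, rfl, hd⟩
      · exact hanti i hi'.1 (by omega) (hsub i hi x b hx)
      · have := hG i hi m d hm (by omega) hd
        rw [show a i - m = c by omega] at this
        exact hanti (i + 1) (by omega) (by omega) this
    have := Ideal.add_mem _ h1 h2
    rwa [sub_add_cancel] at this
  · refine sup_le ?_ ((Ideal.span_singleton_le_iff_mem K).2 hK.pow_mem)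
    have key : ∀ n ≤ j, monomialIdeal k (G (j + 1 - n)) ≤
        K.comap (C : PlanePoly k →+* FamilyPoly k) := by
      intro n hn
      induction n with
      | zero => exact Ideal.map_le_iff_le_comap.1 hK.le
      | succ n ih =>
        have hi : j + 1 - (n + 1) ∈ Finset.Icc 1 j := Finset.mem_Icc.2 (by omega)
        have ih := ih (by omega)
        rw [show j + 1 - n = j + 1 - (n + 1) + 1 by omega] at ih
        generalize j + 1 - (n + 1) = i at hi ih
        obtain ⟨b, -, -, hm⟩ := hK.mul_mem i hi
        rw [monomialIdeal_le_iff]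
        intro c d hcd
        rcases hsup i hi c d hcd with h | ⟨x, rfl, hx⟩
        · exact ih (monomial_mem_monomialIdeal h)
        · refine varX_pow_mul_mem_of_truncPow_mul_mem (B := b) (hV i hi) (hG i hi) ih ?_ x d hx
          intro v hv
          have := hm v hv
          rwa [binomTrunc_one, one_mul] at this
    have := key j le_rfl
    rw [show j + 1 - j = 1 by omega] at this
    exact Ideal.map_le_iff_le_comap.2 this

end TraceIdeals
end StaircaseTraces

namespace StaircaseTraces

/-! ### Stair lengths, slice heights and cardinality of the complement. -/

section CofiniteStaircases

variable {E F : Set (ℕ × ℕ)}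

theorem exists_mem_row (hfin : Eᶜ.Finite) (b : ℕ) : ∃ a, (a, b) ∈ E := by
  by_contra! h
  refine Set.infinite_of_injective_forall_mem (f := fun a : ℕ => (a, b)) ?_ h hfin
  intro a a' h
  exact (Prod.mk.inj h).1

theorem exists_mem_column (hfin : Eᶜ.Finite) (a : ℕ) : ∃ b, (a, b) ∈ E := by
  by_contra! h
  refine Set.infinite_of_injective_forall_mem (f := fun b : ℕ => (a, b)) ?_ h hfin
  intro b b' h
  exact (Prod.mk.inj h).2

theorem stairLength_le_iff (hE : IsStaircase E) (hfin : Eᶜ.Finite) {a b : ℕ} :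
    stairLength E b ≤ a ↔ (a, b) ∈ E := by
  constructor
  · intro h
    have : stairLength E b ∈ {e | (e, b) ∈ E} := Nat.sInf_mem (exists_mem_row hfin b)
    exact hE.mem_of_le this h le_rfl
  · intro h; exact Nat.sInf_le h

theorem sliceHeight_le_iff (hE : IsStaircase E) (hfin : Eᶜ.Finite) {a b : ℕ} :
    sliceHeight E a ≤ b ↔ (a, b) ∈ E := by
  constructor
  · intro h
    have : sliceHeight E a ∈ {e | (a, e) ∈ E} := Nat.sInf_mem (exists_mem_column hfin a)
    exact hE.mem_of_le this le_rfl h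
  · intro h; exact Nat.sInf_le h

theorem IsGentle.isDiagonal (hE : IsStaircase E) (hfin : Eᶜ.Finite) (h : IsGentle E) :
    IsDiagonal E := by
  intro a b hab
  rw [← sliceHeight_le_iff hE hfin] at hab ⊢
  have := h a
  omega

theorem stairLength_antitone (hE : IsStaircase E) (hfin : Eᶜ.Finite) :
    Antitone (stairLength E) := by
  intro b b' h
  rw [stairLength_le_iff hE hfin]
  exact hE.mem_of_le ((stairLength_le_iff hE hfin).1 le_rfl) le_rfl h

theorem sliceHeight_antitone (hE : IsStaircase E) (hfin : Eᶜ.Finite) :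
    Antitone (sliceHeight E) := by
  intro b b' h
  rw [sliceHeight_le_iff hE hfin]
  exact hE.mem_of_le ((sliceHeight_le_iff hE hfin).1 le_rfl) h le_rfl

theorem stairLength_eq_zero_of_le (hE : IsStaircase E) (hfin : Eᶜ.Finite) {b : ℕ}
    (hb : sliceHeight E 0 ≤ b) : stairLength E b = 0 := by
  have := (stairLength_le_iff hE hfin).2 ((sliceHeight_le_iff hE hfin).1 hb)
  omega

theorem finite_compl_horizTranslate (hE : IsStaircase E) (hfin : Eᶜ.Finite) (n : ℕ) :
    (horizTranslate E n)ᶜ.Finite :=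
  hfin.subset (Set.compl_subset_compl.2 (subset_horizTranslate hE n))

theorem sliceHeight_horizTranslate (E : Set (ℕ × ℕ)) (n a : ℕ) :
    sliceHeight (horizTranslate E n) a = sliceHeight E (a + n) := rfl

/-- Both length functions vanish high up, so their differences determine them from the top down. -/
theorem eq_of_stairDiff_eq (hE : IsStaircase E) (hfin : Eᶜ.Finite) (hF : IsStaircase F)
    (hfin' : Fᶜ.Finite) (h : ∀ j, stairDiff E j = stairDiff F j) : E = F := by
  let B := max (sliceHeight E 0) (sliceHeight F 0)
  have key : ∀ n b, b + n = B → stairLength E b = stairLength F b := by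
    intro n
    induction n with
    | zero =>
      intro b hb
      rw [stairLength_eq_zero_of_le hE hfin (by omega),
        stairLength_eq_zero_of_le hF hfin' (by omega)]
    | succ n ih =>
      intro b hb
      have h1 := ih (b + 1) (by omega)
      have h2 := h b
      unfold stairDiff at h2
      omega
  ext ⟨a, b⟩
  rw [← stairLength_le_iff hE hfin, ← stairLength_le_iff hF hfin']
  rcases le_total b B with hb | hb
  · rw [key (B - b) b (by omega)]
  · rw [stairLength_eq_zero_of_le hE hfin (by omega),
      stairLength_eq_zero_of_le hF hfin' (by omega)]

theorem ncard_compl_eq_sum (hE : IsStaircase E) (hfin : Eᶜ.Finite) {B : ℕ}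
    (hB : stairLength E B = 0) : Eᶜ.ncard = ∑ b ∈ Finset.range B, stairLength E b := by
  let T : Finset (ℕ × ℕ) := (Finset.range B).biUnion fun b =>
    (Finset.range (stairLength E b)).image fun a => (a, b)
  have hT : Eᶜ = (T : Set (ℕ × ℕ)) := by
    ext ⟨a, b⟩
    rw [Set.mem_compl_iff, ← stairLength_le_iff hE hfin]
    simp only [T, Finset.coe_biUnion, Finset.mem_coe, Finset.mem_range, Set.mem_iUnion,
      Finset.mem_image, Prod.mk.injEq, exists_prop]
    constructor
    · intro h
      refine ⟨b, ?_, a, by omega, rfl, rfl⟩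
      by_contra hb
      have := stairLength_antitone hE hfin (not_lt.1 hb)
      omega
    · rintro ⟨b', -, a', ha, rfl, rfl⟩
      omega
  rw [hT, Set.ncard_coe_finset, Finset.card_biUnion]
  · refine Finset.sum_congr rfl fun b _ => ?_
    rw [Finset.card_image_of_injective, Finset.card_range]
    intro a a' h
    exact (Prod.mk.inj h).1
  · intro b _ b' _ hbb
    rw [Function.onFun, Finset.disjoint_left]
    intro e he he'
    obtain ⟨a, -, rfl⟩ := Finset.mem_image.1 he
    obtain ⟨a', -, h⟩ := Finset.mem_image.1 he'
    exact hbb (Prod.mk.inj h).2.symm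

theorem ncard_compl_horizTranslate_one (hE : IsStaircase E) (hfin : Eᶜ.Finite) :
    (horizTranslate E 1)ᶜ.ncard + sliceHeight E 0 = Eᶜ.ncard := by
  have hE' := hE.horizTranslate 1
  have hfin' := finite_compl_horizTranslate hE hfin 1
  have hl : ∀ b, stairLength (horizTranslate E 1) b = stairLength E b - 1 := by
    intro b
    apply eq_of_forall_ge_iff
    intro c
    rw [stairLength_le_iff hE' hfin', mem_horizTranslate, ← stairLength_le_iff hE hfin]
    omega
  have h0 := stairLength_eq_zero_of_le hE hfin (le_refl (sliceHeight E 0))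
  rw [ncard_compl_eq_sum hE hfin h0, ncard_compl_eq_sum hE' hfin' (by rw [hl, h0])]
  have h1 : ∑ b ∈ Finset.range (sliceHeight E 0), 1 = sliceHeight E 0 := by simp
  refine Eq.trans (congrArg _ h1.symm) ?_
  rw [← Finset.sum_add_distrib]
  refine Finset.sum_congr rfl fun b hb => ?_
  rw [hl]
  refine Nat.sub_add_cancel (Nat.one_le_iff_ne_zero.2 fun h => ?_)
  rw [Finset.mem_range] at hb
  have := (sliceHeight_le_iff hE hfin).2 ((stairLength_le_iff hE hfin).1 h.le)
  omega

theorem ncard_compl_horizTranslate (hE : IsStaircase E) (hfin : Eᶜ.Finite) (n : ℕ) :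
    (horizTranslate E n)ᶜ.ncard + ∑ a ∈ Finset.range n, sliceHeight E a = Eᶜ.ncard := by
  induction n with
  | zero => simp [horizTranslate_zero]
  | succ n ih =>
    have := ncard_compl_horizTranslate_one (hE.horizTranslate n)
      (finite_compl_horizTranslate hE hfin n)
    rw [horizTranslate_horizTranslate, sliceHeight_horizTranslate, zero_add, add_comm 1 n] at this
    rw [Finset.sum_range_succ]
    omega

end CofiniteStaircases

/-! ### Admissible data and slice deletion. -/

section Admissible

/-- The combinatorial conditions on a staircase, block lengths and trace dimensions. -/
structure IsAdmissible (E : Set (ℕ × ℕ)) (μ : ℕ) (m tr : ℕ → ℕ) : Prop where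
  stair : IsStaircase E
  fin : Eᶜ.Finite
  diag : IsDiagonal E
  pos : 1 ≤ μ
  one_le_m : ∀ i ∈ Finset.Icc 1 μ, 1 ≤ m i
  one_le_tr : ∀ i ∈ Finset.Icc 1 μ, 1 ≤ tr i
  tr_lt : ∀ i j, 1 ≤ i → i < j → j ≤ μ → tr i < tr j
  -- Weaker than the bound tr_i + 1 of the theorem: a stair difference of 2 is enough for the
  -- deletion to stay diagonal.
  gap : ∀ i, 1 ≤ i → i < μ → stairLength E (tr i) + 2 ≤ stairLength E (tr i - 1)
  step : ∀ i, 1 ≤ i → i < μ →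
    stairLength E (tr (i + 1) - 1) + sliceHeight E (xCount m i) ≤ stairLength E (tr i - 1)
  last : xCount m (μ + 1) < stairLength E (tr μ - 1)
  gap_last : xCount m μ < stairLength E (tr μ) →
    stairLength E (tr μ) + 2 ≤ stairLength E (tr μ - 1)

/-- The number of indices `i' ∈ [i, μ]` with `b < tr i'`. -/
def countAbove (μ : ℕ) (tr : ℕ → ℕ) (i b : ℕ) : ℕ :=
  ((Finset.Icc i μ).filter fun i' => b < tr i').card

theorem xCount_succ {m : ℕ → ℕ} {j : ℕ} (hj : 1 ≤ j) :
    xCount m (j + 1) = xCount m j + (m j - 1) := Finset.sum_Ico_succ_top hj _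

theorem xCount_mono (m : ℕ → ℕ) : Monotone (xCount m) := fun _ _ h =>
  Finset.sum_le_sum_of_subset (Finset.Ico_subset_Ico le_rfl h)

namespace IsAdmissible

variable {E : Set (ℕ × ℕ)} {μ : ℕ} {m tr : ℕ → ℕ} (h : IsAdmissible E μ m tr)
include h

theorem tr_le {i j : ℕ} (hi : 1 ≤ i) (hij : i ≤ j) (hj : j ≤ μ) : tr i ≤ tr j := by
  rcases hij.eq_or_lt with rfl | hlt
  · exact le_rfl
  · exact (h.tr_lt i j hi hlt hj).le

/-- For i = μ, either ℓ_E(tr_μ) ≤ n_μ and `last` applies, or `gap_last` does. -/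
theorem stairLength_tr_lt {i : ℕ} (hi : 1 ≤ i) (hiμ : i ≤ μ) :
    stairLength E (tr i) < stairLength E (tr i - 1) := by
  rcases hiμ.eq_or_lt with rfl | hlt
  · have h1 := h.last
    have h2 := h.gap_last
    have h3 := xCount_mono m (Nat.le_succ i)
    simp only [Nat.succ_eq_add_one] at h3
    by_contra h4
    have := h2 (by omega)
    omega
  · have := h.gap i hi hlt; omega

theorem stairLength_add_two_le {i : ℕ} (hi : 1 ≤ i) (hiμ : i < μ) :
    stairLength E (tr (i + 1) - 1) + 2 ≤ stairLength E (tr i - 1) := by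
  have h1 := h.gap i hi hiμ
  have h2 := h.tr_lt i (i + 1) hi (by omega) (by omega)
  have h3 := stairLength_antitone h.stair h.fin (show tr i ≤ tr (i + 1) - 1 by omega)
  omega

theorem stairLength_add_le {i j : ℕ} (hi : 1 ≤ i) (hij : i ≤ j) (hj : j ≤ μ) :
    stairLength E (tr j - 1) + (j - i) ≤ stairLength E (tr i - 1) := by
  induction j, hij using Nat.le_induction with
  | base => omega
  | succ j hij ih =>
    have h1 := ih (by omega)
    have h2 := h.stairLength_add_two_le (by omega : 1 ≤ j) (by omega)
    omega

theorem countAbove_eq_of_lt {i b : ℕ} (hi : 1 ≤ i) (hb : b < tr i) :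
    countAbove μ tr i b = μ + 1 - i := by
  rw [countAbove, Finset.filter_true_of_mem, Nat.card_Icc]
  intro i' hi'
  rw [Finset.mem_Icc] at hi'
  exact hb.trans_le (h.tr_le hi hi'.1 hi'.2)

omit h in
theorem countAbove_eq_of_le {i b : ℕ} (hb : tr i ≤ b) :
    countAbove μ tr i b = countAbove μ tr (i + 1) b := by
  unfold countAbove
  congr 1
  ext i'
  simp only [Finset.mem_filter, Finset.mem_Icc]
  constructor
  · rintro ⟨⟨h1, h2⟩, h3⟩
    refine ⟨⟨?_, h2⟩, h3⟩
    rcases h1.eq_or_lt with rfl | h1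
    · omega
    · exact h1
  · rintro ⟨⟨h1, h2⟩, h3⟩
    exact ⟨⟨by omega, h2⟩, h3⟩

omit h in
theorem countAbove_succ_le (i b : ℕ) : countAbove μ tr (i + 1) b ≤ countAbove μ tr i b := by
  refine Finset.card_le_card (Finset.filter_subset_filter _ (Finset.Icc_subset_Icc ?_ le_rfl))
  omega

omit h in
theorem countAbove_eq_countAbove_succ {i b : ℕ} (hb : ∀ i' ∈ Finset.Icc i μ, b + 1 ≠ tr i') :
    countAbove μ tr i b = countAbove μ tr i (b + 1) := by
  unfold countAbove
  congr 1
  refine Finset.filter_congr fun i' hi' => ?_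
  have := hb i' hi'
  omega

theorem countAbove_eq_countAbove_succ_add_one {i j : ℕ} (hi : 1 ≤ i) (hj : j ∈ Finset.Icc i μ) :
    countAbove μ tr i (tr j - 1) = countAbove μ tr i (tr j) + 1 := by
  unfold countAbove
  rw [Finset.mem_Icc] at hj
  have h0 := h.one_le_tr j (Finset.mem_Icc.2 ⟨by omega, hj.2⟩)
  have : (Finset.Icc i μ).filter (fun i' => tr j - 1 < tr i') =
      insert j ((Finset.Icc i μ).filter (fun i' => tr j < tr i')) := by
    ext i'
    simp only [Finset.mem_filter, Finset.mem_insert, Finset.mem_Icc]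
    constructor
    · rintro ⟨⟨h1, h2⟩, h3⟩
      rcases lt_trichotomy i' j with hlt | rfl | hlt
      · have := h.tr_lt i' j (by omega) hlt hj.2; omega
      · exact Or.inl rfl
      · exact Or.inr ⟨⟨h1, h2⟩, h.tr_lt j i' (by omega) hlt h2⟩
    · rintro (rfl | ⟨⟨h1, h2⟩, h3⟩)
      · exact ⟨hj, by omega⟩
      · exact ⟨⟨h1, h2⟩, by omega⟩
  rw [this, Finset.card_insert_of_notMem]
  simp

/-- The count drops only on reaching some tr_j, by one, and there the stair length drops as well. So
ℓ_E minus the count still decreases with height, which makes the deletion a staircase. -/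
theorem stairLength_succ_add_le {i : ℕ} (hi : 1 ≤ i) (b : ℕ) :
    stairLength E (b + 1) + countAbove μ tr i b ≤
      stairLength E b + countAbove μ tr i (b + 1) := by
  by_cases hb : ∃ j ∈ Finset.Icc i μ, b + 1 = tr j
  · obtain ⟨j, hj, hbj⟩ := hb
    have h1 := h.countAbove_eq_countAbove_succ_add_one hi hj
    rw [Finset.mem_Icc] at hj
    have h2 := h.stairLength_tr_lt (by omega : 1 ≤ j) hj.2
    rw [← hbj, Nat.add_sub_cancel] at h1 h2
    omega
  · push Not at hb
    rw [countAbove_eq_countAbove_succ hb]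
    have := stairLength_antitone h.stair h.fin (Nat.le_succ b)
    simp only [Nat.succ_eq_add_one] at this
    omega

theorem stairLength_add_countAbove_le {i b b' : ℕ} (hi : 1 ≤ i) (hb : b ≤ b') :
    stairLength E b' + countAbove μ tr i b ≤ stairLength E b + countAbove μ tr i b' := by
  induction b', hb using Nat.le_induction with
  | base => exact le_rfl
  | succ b' _ ih =>
    have := h.stairLength_succ_add_le hi b'
    omega

theorem exists_bound : ∃ B, stairLength E B = 0 ∧ ∀ i ∈ Finset.Icc 1 μ, tr i ≤ B := by
  refine ⟨sliceHeight E 0 + tr μ, stairLength_eq_zero_of_le h.stair h.fin (by omega), ?_⟩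
  intro i hi
  rw [Finset.mem_Icc] at hi
  have := h.tr_le hi.1 hi.2 le_rfl
  omega

theorem countAbove_le_stairLength {i : ℕ} (hi : 1 ≤ i) (b : ℕ) :
    countAbove μ tr i b ≤ stairLength E b := by
  obtain ⟨B, hB, hB'⟩ := h.exists_bound
  have h0 : countAbove μ tr i (max b B) = 0 := by
    rw [countAbove, Finset.card_eq_zero, Finset.filter_eq_empty_iff]
    intro i' hi'
    rw [Finset.mem_Icc] at hi'
    have := hB' i' (Finset.mem_Icc.2 ⟨by omega, hi'.2⟩)
    omega
  have := h.stairLength_add_countAbove_le hi (le_max_left b B)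
  omega

end IsAdmissible

/-- The staircase obtained from `E` by deleting slices of heights `tr_i, …, tr_μ` and then the
leftmost `n` slices. -/
def deletedStaircase (E : Set (ℕ × ℕ)) (μ : ℕ) (tr : ℕ → ℕ) (n i : ℕ) : Set (ℕ × ℕ) :=
  {e | stairLength E e.2 ≤ e.1 + n + countAbove μ tr i e.2}

theorem mem_deletedStaircase {E : Set (ℕ × ℕ)} {μ : ℕ} {tr : ℕ → ℕ} {n i a b : ℕ} :
    (a, b) ∈ deletedStaircase E μ tr n i ↔
      stairLength E b ≤ a + n + countAbove μ tr i b := Iff.rfl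

theorem horizTranslate_deletedStaircase (E : Set (ℕ × ℕ)) (μ : ℕ) (tr : ℕ → ℕ) (n i c : ℕ) :
    horizTranslate (deletedStaircase E μ tr n i) c = deletedStaircase E μ tr (c + n) i := by
  ext ⟨a, b⟩
  rw [mem_horizTranslate, mem_deletedStaircase, mem_deletedStaircase, add_assoc a]

namespace IsAdmissible

variable {E : Set (ℕ × ℕ)} {μ : ℕ} {m tr : ℕ → ℕ} (h : IsAdmissible E μ m tr)
include h

theorem deletedStaircase_isStaircase (n : ℕ) {i : ℕ} (hi : 1 ≤ i) :
    IsStaircase (deletedStaircase E μ tr n i) := by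
  rintro ⟨a, b⟩ hab ⟨c, d⟩
  rw [mem_deletedStaircase] at hab
  have := h.stairLength_add_countAbove_le hi (Nat.le_add_right b d)
  change stairLength E (b + d) ≤ a + c + n + countAbove μ tr i (b + d)
  omega

theorem subset_deletedStaircase (n i : ℕ) : E ⊆ deletedStaircase E μ tr n i := by
  rintro ⟨a, b⟩ hab
  rw [← stairLength_le_iff h.stair h.fin] at hab
  rw [mem_deletedStaircase]
  omega

theorem finite_compl_deletedStaircase (n i : ℕ) : (deletedStaircase E μ tr n i)ᶜ.Finite :=
  h.fin.subset (Set.compl_subset_compl.2 (h.subset_deletedStaircase n i))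

theorem stairLength_deletedStaircase {i : ℕ} (hi : 1 ≤ i) (b : ℕ) :
    stairLength (deletedStaircase E μ tr 0 i) b = stairLength E b - countAbove μ tr i b := by
  apply eq_of_forall_ge_iff
  intro c
  rw [stairLength_le_iff (h.deletedStaircase_isStaircase 0 hi)
    (h.finite_compl_deletedStaircase 0 i), mem_deletedStaircase]
  omega

theorem isSliceDeletion_deletedStaircase :
    IsSliceDeletion E μ tr (deletedStaircase E μ tr 0 1) := by
  refine ⟨h.deletedStaircase_isStaircase 0 le_rfl, h.finite_compl_deletedStaircase 0 1,
    fun i hi => ?_, fun j hj => ?_⟩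
  · have h0 := h.one_le_tr i hi
    have h1 := h.countAbove_eq_countAbove_succ_add_one le_rfl hi
    have h2 := h.countAbove_le_stairLength le_rfl (tr i)
    have h3 := h.countAbove_le_stairLength le_rfl (tr i - 1)
    unfold stairDiff
    rw [h.stairLength_deletedStaircase le_rfl, h.stairLength_deletedStaircase le_rfl,
      Nat.sub_add_cancel h0]
    omega
  · have h1 := countAbove_eq_countAbove_succ hj
    have h2 := h.countAbove_le_stairLength le_rfl j
    have h3 := h.countAbove_le_stairLength le_rfl (j + 1)
    unfold stairDiff
    rw [h.stairLength_deletedStaircase le_rfl, h.stairLength_deletedStaircase le_rfl]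
    omega

theorem eq_deletedStaircase {F : Set (ℕ × ℕ)} (hF : IsSliceDeletion E μ tr F) :
    F = deletedStaircase E μ tr 0 1 := by
  obtain ⟨h1, h2, h3, h4⟩ := h.isSliceDeletion_deletedStaircase
  refine eq_of_stairDiff_eq hF.1 hF.2.1 h1 h2 fun j => ?_
  by_cases hj : ∃ i ∈ Finset.Icc 1 μ, j + 1 = tr i
  · obtain ⟨i, hi, hji⟩ := hj
    have e : j = tr i - 1 := by omega
    rw [e, hF.2.2.1 i hi, h3 i hi]
  · push Not at hj
    rw [hF.2.2.2 j hj, h4 j hj]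

/-- The deletion shortens the step at height tr_j by one, and the gap of two leaves it nonempty. For
j = μ the gap may be missing, but then the stair at height tr_μ has length at most n_μ and is
translated away. -/
theorem deletedStaircase_isDiagonal {i : ℕ} (hi : 1 ≤ i) :
    IsDiagonal (deletedStaircase E μ tr (xCount m μ) i) := by
  intro a b hab
  rw [mem_deletedStaircase] at hab ⊢
  by_cases hb : ∃ j ∈ Finset.Icc i μ, b + 1 = tr j
  · obtain ⟨j, hj, hbj⟩ := hb
    have h1 := h.countAbove_eq_countAbove_succ_add_one hi hj
    rw [Finset.mem_Icc] at hj
    rcases hj.2.eq_or_lt with rfl | hlt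
    · have h2 := h.gap_last
      rw [← hbj, Nat.add_sub_cancel] at h1 h2
      by_contra h3
      have := h2 (by omega)
      omega
    · have h2 := h.gap j (by omega) hlt
      rw [← hbj, Nat.add_sub_cancel] at h1 h2
      omega
  · push Not at hb
    rw [countAbove_eq_countAbove_succ hb] at hab
    rw [stairLength_le_iff h.stair h.fin] at hab ⊢
    refine h.diag _ _ ?_
    convert hab using 2
    omega

/-- A row touched by the deletion lies below tr_μ and keeps length at least ℓ_E(tr_μ - 1) - 1 ≥
n_(μ+1). -/
theorem mem_deletedStaircase_iff_mem {a b : ℕ} (ha : a < xCount m (μ + 1)) :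
    (a, b) ∈ deletedStaircase E μ tr 0 1 ↔ (a, b) ∈ E := by
  refine ⟨fun hab => ?_, fun hab => h.subset_deletedStaircase 0 1 hab⟩
  rw [mem_deletedStaircase] at hab
  rw [← stairLength_le_iff h.stair h.fin]
  by_contra hlt
  have hb : ∃ i ∈ Finset.Icc 1 μ, b < tr i := by
    by_contra! hb
    have : countAbove μ tr 1 b = 0 := by
      rw [countAbove, Finset.card_eq_zero, Finset.filter_eq_empty_iff]
      intro i hi
      exact not_lt.2 (hb i hi)
    omega
  obtain ⟨i, hi, hbi⟩ := hb
  rw [Finset.mem_Icc] at hi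
  have h1 := h.tr_le hi.1 hi.2 le_rfl
  have h2 := h.stairLength_add_countAbove_le le_rfl (show b ≤ tr μ - 1 by omega)
  have h3 := h.countAbove_eq_countAbove_succ_add_one le_rfl
    (Finset.mem_Icc.2 ⟨h.pos, le_rfl⟩ : μ ∈ Finset.Icc 1 μ)
  have h4 : countAbove μ tr 1 (tr μ) = 0 := by
    rw [countAbove, Finset.card_eq_zero, Finset.filter_eq_empty_iff]
    intro i hi
    rw [Finset.mem_Icc] at hi
    exact not_lt.2 (h.tr_le hi.1 hi.2 le_rfl)
  have h5 := h.last
  omega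

theorem sliceHeight_deletedStaircase {a : ℕ} (ha : a < xCount m (μ + 1)) :
    sliceHeight (deletedStaircase E μ tr 0 1) a = sliceHeight E a := by
  apply eq_of_forall_ge_iff
  intro b
  rw [sliceHeight_le_iff (h.deletedStaircase_isStaircase 0 le_rfl)
    (h.finite_compl_deletedStaircase 0 1), sliceHeight_le_iff h.stair h.fin,
    h.mem_deletedStaircase_iff_mem ha]

/-- Count by rows: deleting a slice of height tr_i removes one point from each row b < tr_i. -/
theorem ncard_compl_deletedStaircase :
    (deletedStaircase E μ tr 0 1)ᶜ.ncard + ∑ i ∈ Finset.Icc 1 μ, tr i = Eᶜ.ncard := by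
  obtain ⟨B, hB, hB'⟩ := h.exists_bound
  have h1 : ∑ b ∈ Finset.range B, countAbove μ tr 1 b = ∑ i ∈ Finset.Icc 1 μ, tr i := by
    simp only [countAbove, Finset.card_filter]
    rw [Finset.sum_comm]
    refine Finset.sum_congr rfl fun i hi => ?_
    rw [← Finset.card_filter]
    have : (Finset.range B).filter (fun b => b < tr i) = Finset.range (tr i) := by
      ext b
      have := hB' i hi
      simp only [Finset.mem_filter, Finset.mem_range]
      omega
    rw [this, Finset.card_range]
  rw [ncard_compl_eq_sum h.stair h.fin hB,
    ncard_compl_eq_sum (h.deletedStaircase_isStaircase 0 le_rfl)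
      (h.finite_compl_deletedStaircase 0 1)
      (by rw [h.stairLength_deletedStaircase le_rfl, hB, Nat.zero_sub]), ← h1,
    ← Finset.sum_add_distrib]
  refine Finset.sum_congr rfl fun b _ => ?_
  rw [h.stairLength_deletedStaircase le_rfl]
  exact Nat.sub_add_cancel (h.countAbove_le_stairLength le_rfl b)

theorem ncard_compl_horizTranslate_deletedStaircase :
    (horizTranslate (deletedStaircase E μ tr 0 1) (xCount m (μ + 1)))ᶜ.ncard +
      (∑ a ∈ Finset.range (xCount m (μ + 1)), sliceHeight E a + ∑ i ∈ Finset.Icc 1 μ, tr i) =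
        Eᶜ.ncard := by
  rw [← h.ncard_compl_deletedStaircase, ← add_assoc,
    ← ncard_compl_horizTranslate (h.deletedStaircase_isStaircase 0 le_rfl)
      (h.finite_compl_deletedStaircase 0 1) (xCount m (μ + 1))]
  congr 2
  refine Finset.sum_congr rfl fun a ha => ?_
  rw [h.sliceHeight_deletedStaircase (Finset.mem_range.1 ha)]

end IsAdmissible
end Admissible
end StaircaseTraces

namespace StaircaseTraces

open Polynomial

/-! ### Positions and orders in the sequence of blocks. -/

section Blocks

/-- The order `p` used at the first step of the `j`-th block; it equals `1` after the last one. -/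
noncomputable def blockOrder (E : Set (ℕ × ℕ)) (μ : ℕ) (m tr : ℕ → ℕ) (j : ℕ) : ℕ :=
  if j ≤ μ then stairLength E (tr j - 1) - xCount m j else 1

/-- The sequence `p_1, p_2, …`: after its first entry each block already uses the order of the
next one. -/
noncomputable def stepOrder (E : Set (ℕ × ℕ)) (μ : ℕ) (m tr : ℕ → ℕ) (i : ℕ) : ℕ :=
  blockOrder E μ m tr (1 + ((Finset.Icc 1 μ).filter fun l => l + xCount m l < i).card)

/-- The element of `k[X][F][T]` corresponding to the `i`-th entry of the sequence of lines. -/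
noncomputable def stepElement (k : Type*) [Field k] (μ : ℕ) (m : ℕ → ℕ) (i : ℕ) : FamilyPoly k :=
  if i ∈ (Finset.Icc 1 μ).image (fun j => 1 + ∑ l ∈ Finset.Ico 1 j, m l) then C (diffFX k) - X
  else C (varX k)

/-- The iterated residuals in `k[X][F][T]`, the `i`-th one enlarged by `T^(p_(i+1))`. -/
noncomputable def residualSeq {k : Type*} [Field k] (E : Set (ℕ × ℕ)) (y : ℕ → FamilyPoly k)
    (p : ℕ → ℕ) : ℕ → Ideal (FamilyPoly k)
  | 0 => familyIdeal k E ⊔ Ideal.span {X ^ p 1}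
  | i + 1 => Submodule.colon (residualSeq E y p i) {y (i + 1)} ⊔ Ideal.span {X ^ p (i + 2)}

namespace IsAdmissible

variable {E : Set (ℕ × ℕ)} {μ : ℕ} {m tr : ℕ → ℕ} (h : IsAdmissible E μ m tr)
include h

theorem one_add_sum_eq {j : ℕ} (hj : 1 ≤ j) (hjμ : j ≤ μ + 1) :
    1 + ∑ l ∈ Finset.Ico 1 j, m l = j + xCount m j := by
  induction j, hj using Nat.le_induction with
  | base => simp [xCount]
  | succ j hj ih =>
    have := h.one_le_m j (Finset.mem_Icc.2 ⟨hj, by omega⟩)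
    rw [Finset.sum_Ico_succ_top hj, xCount_succ hj, ← add_assoc, ih (by omega)]
    omega

theorem position_succ {j : ℕ} (hj : j ∈ Finset.Icc 1 μ) :
    j + 1 + xCount m (j + 1) = j + xCount m j + m j := by
  have := h.one_le_m j hj
  rw [xCount_succ (Finset.mem_Icc.1 hj).1]
  omega

omit h in
theorem position_mono {j l : ℕ} (hjl : j ≤ l) : j + xCount m j ≤ l + xCount m l :=
  add_le_add hjl (xCount_mono m hjl)

theorem stepElement_sub (k : Type*) [Field k] {j : ℕ} (hj : j ∈ Finset.Icc 1 μ) :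
    stepElement k μ m (j + xCount m j) = C (diffFX k) - X := by
  have hj' := Finset.mem_Icc.1 hj
  exact if_pos (Finset.mem_image.2 ⟨j, hj, h.one_add_sum_eq hj'.1 (by omega)⟩)

theorem notMem_positions {j e : ℕ} (hj : j ∈ Finset.Icc 1 μ) (he : 1 ≤ e)
    (hem : e < m j) : j + xCount m j + e ∉
      (Finset.Icc 1 μ).image (fun j => 1 + ∑ l ∈ Finset.Ico 1 j, m l) := by
  intro hmem
  obtain ⟨l, hl, hlj⟩ := Finset.mem_image.1 hmem
  have hl' := Finset.mem_Icc.1 hl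
  rw [h.one_add_sum_eq hl'.1 (by omega)] at hlj
  rcases le_or_gt l j with hle | hlt
  · have := position_mono (m := m) hle; omega
  · have h1 := position_mono (m := m) (Nat.succ_le_iff.2 hlt)
    have h2 := h.position_succ hj
    simp only [Nat.succ_eq_add_one] at h1
    omega

theorem stepElement_varX (k : Type*) [Field k] {j e : ℕ} (hj : j ∈ Finset.Icc 1 μ) (he : 1 ≤ e)
    (hem : e < m j) : stepElement k μ m (j + xCount m j + e) = C (varX k) :=
  if_neg (h.notMem_positions hj he hem)

theorem stepOrder_eq {j e : ℕ} (hj : j ∈ Finset.Icc 1 μ) (he : 1 ≤ e) (hem : e ≤ m j) :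
    stepOrder E μ m tr (j + xCount m j + e) = blockOrder E μ m tr (j + 1) := by
  have hj' := Finset.mem_Icc.1 hj
  have : (Finset.Icc 1 μ).filter (fun l => l + xCount m l < j + xCount m j + e) =
      Finset.Icc 1 j := by
    ext l
    simp only [Finset.mem_filter, Finset.mem_Icc]
    constructor
    · rintro ⟨⟨h1, h2⟩, h3⟩
      refine ⟨h1, ?_⟩
      by_contra hlt
      have h1 := position_mono (m := m) (Nat.succ_le_iff.2 (not_le.1 hlt))
      have h2 := h.position_succ hj
      simp only [Nat.succ_eq_add_one] at h1
      omega
    · rintro ⟨h1, h2⟩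
      have := position_mono (m := m) h2
      exact ⟨⟨h1, by omega⟩, by omega⟩
  rw [stepOrder, this, Nat.card_Icc, Nat.add_sub_cancel, add_comm]

omit h in
theorem stepOrder_one : stepOrder E μ m tr 1 = blockOrder E μ m tr 1 := by
  have : (Finset.Icc 1 μ).filter (fun l => l + xCount m l < 1) = ∅ := by
    rw [Finset.filter_eq_empty_iff]
    intro l hl
    rw [Finset.mem_Icc] at hl
    omega
  rw [stepOrder, this, Finset.card_empty]

theorem xCount_lt {j : ℕ} (hj : 1 ≤ j) (hjμ : j ≤ μ) :
    xCount m (μ + 1) < stairLength E (tr j - 1) := by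
  have := h.stairLength_add_le hj hjμ le_rfl
  have := h.last
  omega

omit h in
theorem blockOrder_eq {j : ℕ} (hjμ : j ≤ μ) :
    blockOrder E μ m tr j = stairLength E (tr j - 1) - xCount m j := if_pos hjμ

omit h in
theorem blockOrder_eq_one {j : ℕ} (hjμ : μ < j) : blockOrder E μ m tr j = 1 :=
  if_neg (not_le.2 hjμ)

theorem one_le_blockOrder {j : ℕ} (hj : 1 ≤ j) : 1 ≤ blockOrder E μ m tr j := by
  rcases le_or_gt j μ with hjμ | hjμ
  · rw [blockOrder_eq hjμ]
    have h1 := h.xCount_lt hj hjμ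
    have h2 := xCount_mono m (show j ≤ μ + 1 by omega)
    omega
  · rw [blockOrder_eq_one hjμ]

theorem blockOrder_succ_le {j : ℕ} (hj : 1 ≤ j) :
    blockOrder E μ m tr (j + 1) ≤ blockOrder E μ m tr j := by
  rcases le_or_gt (j + 1) μ with hjμ | hjμ
  · rw [blockOrder_eq hjμ, blockOrder_eq (by omega : j ≤ μ)]
    have h1 := h.stairLength_add_two_le hj (by omega)
    have h2 := xCount_mono m (show j ≤ j + 1 by omega)
    omega
  · rw [blockOrder_eq_one hjμ]
    exact h.one_le_blockOrder hj

theorem blockOrder_antitone {i j : ℕ} (hi : 1 ≤ i) (hij : i ≤ j) :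
    blockOrder E μ m tr j ≤ blockOrder E μ m tr i := by
  induction j, hij using Nat.le_induction with
  | base => exact le_rfl
  | succ j hij ih => exact (h.blockOrder_succ_le (by omega)).trans ih

theorem stepOrder_antitone : Antitone (stepOrder E μ m tr) := by
  intro i j hij
  refine h.blockOrder_antitone (by omega) (Nat.add_le_add_left (Finset.card_le_card ?_) 1)
  intro l hl
  rw [Finset.mem_filter] at hl ⊢
  exact ⟨hl.1, by omega⟩

theorem one_le_stepOrder (i : ℕ) : 1 ≤ stepOrder E μ m tr i :=
  h.one_le_blockOrder (by omega)

/-- For i = j this is hypothesis 2, and smaller i only give larger shifts. The slack e and c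
accounts for slices already removed and x-divisions still to come in the block; slice heights only
decrease. -/
theorem step_conditions {i j e : ℕ} (hi : i ∈ Finset.Icc 1 j) (hjμ : j < μ) :
    1 ≤ stairLength E (tr i - 1) - stairLength E (tr (j + 1) - 1) - (j - i) ∧
      ∀ n, n = xCount m j + e → ∀ c,
      (0, stairLength E (tr i - 1) - stairLength E (tr (j + 1) - 1) - (j - i) + c) ∈
        horizTranslate E n := by
  rw [Finset.mem_Icc] at hi
  have h1 := h.stairLength_add_le hi.1 hi.2 hjμ.le
  have h2 := h.stairLength_add_two_le (by omega : 1 ≤ j) hjμ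
  have h3 := h.step j (by omega) hjμ
  refine ⟨by omega, ?_⟩
  rintro n rfl c
  rw [mem_horizTranslate, ← sliceHeight_le_iff h.stair h.fin]
  have h4 := sliceHeight_antitone h.stair h.fin (show xCount m j ≤ 0 + (xCount m j + e) by omega)
  omega

end IsAdmissible

end Blocks

/-! ### Control along the blocks, the last residual and the traces. -/

section BlockInduction

universe u
variable (k : Type u) [Field k] {E : Set (ℕ × ℕ)} {μ : ℕ} {m tr : ℕ → ℕ}

/-- The iterated residuals for the given staircase, block lengths and trace dimensions. -/
noncomputable abbrev blockResidual (E : Set (ℕ × ℕ)) (μ : ℕ) (m tr : ℕ → ℕ) :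
    ℕ → Ideal (FamilyPoly k) :=
  residualSeq E (stepElement k μ m) (stepOrder E μ m tr)

/-- The coefficient staircases created at the first steps of the blocks. -/
abbrev createdStaircase (E : Set (ℕ × ℕ)) (tr : ℕ → ℕ) (i : ℕ) : Set (ℕ × ℕ) :=
  horizTranslate E (stairLength E (tr i - 1))

namespace IsAdmissible

variable (h : IsAdmissible E μ m tr)
include h

/-- The y-step of block j + 1 is preceded by j + `xCount` m (j + 1) steps. -/
theorem blockResidual_sub {j : ℕ} (hj : j < μ) :
    blockResidual k E μ m tr (j + 1 + xCount m (j + 1)) =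
      Submodule.colon (blockResidual k E μ m tr (j + xCount m (j + 1)))
        {C (diffFX k) - X} ⊔ Ideal.span {X ^ blockOrder E μ m tr (j + 2)} := by
  have hj' : j + 1 ∈ Finset.Icc 1 μ := Finset.mem_Icc.2 ⟨by omega, hj⟩
  have h1 := h.stepElement_sub k hj'
  have h2 := h.stepOrder_eq hj' le_rfl (h.one_le_m _ hj')
  rw [show j + 1 + xCount m (j + 1) = j + xCount m (j + 1) + 1 by ring] at h1 h2 ⊢
  rw [blockResidual, residualSeq, h1, h2]

theorem blockResidual_varX {j e : ℕ} (hj : j ∈ Finset.Icc 1 μ) (he : e + 1 < m j) :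
    blockResidual k E μ m tr (j + xCount m j + (e + 1)) =
      Submodule.colon (blockResidual k E μ m tr (j + xCount m j + e)) {C (varX k)} ⊔
        Ideal.span {X ^ blockOrder E μ m tr (j + 1)} := by
  have h1 := h.stepElement_varX k hj (by omega) he
  have h2 := h.stepOrder_eq hj (by omega : 1 ≤ e + 2) (by omega)
  rw [← add_assoc] at h1 ⊢
  rw [blockResidual, residualSeq, h1, add_assoc _ e 2, h2]

theorem createdStaircase_isDiagonal (i : ℕ) : IsDiagonal (createdStaircase E tr i) :=
  h.diag.horizTranslate _

variable {k}

/-- The order is ℓ_E(tr_(j+1) - 1) - n_(j+1), so translating τ(E, n_(j+1)) by it gives the created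
staircase τ(E, ℓ_E(tr_(j+1) - 1)). -/
theorem isControlled_after_sub {j : ℕ} (hj : j < μ)
    (hpre : IsControlled (createdStaircase E tr) (blockResidual k E μ m tr (j + xCount m (j + 1)))
      (horizTranslate E (xCount m (j + 1))) (blockOrder E μ m tr (j + 1)) j
      fun i => stairLength E (tr i - 1) - stairLength E (tr (j + 1) - 1) - (j - i)) :
    IsControlled (createdStaircase E tr)
      (Submodule.colon (blockResidual k E μ m tr (j + xCount m (j + 1))) {C (diffFX k) - X})
      (horizTranslate E (xCount m (j + 1))) (blockOrder E μ m tr (j + 1)) (j + 1)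
      fun i => stairLength E (tr i - 1) - stairLength E (tr (j + 1) - 1) - (j + 1 - i) := by
  refine (hpre.colon_sub (h.stair.horizTranslate _) (h.diag.horizTranslate _)
    (fun i _ => h.createdStaircase_isDiagonal i) ?_ fun i hi => ?_).congr rfl fun i hi => ?_
  · rw [horizTranslate_horizTranslate, blockOrder_eq (by omega : j + 1 ≤ μ), Nat.sub_add_cancel]
    have h1 := h.xCount_lt (by omega : 1 ≤ j + 1) (by omega : j + 1 ≤ μ)
    have h2 := xCount_mono m (show j + 1 ≤ μ + 1 by omega)
    omega
  · have hj1 : 1 ≤ j := by rw [Finset.mem_Icc] at hi; omega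
    have h1 := h.step_conditions (e := m j - 1) hi hj
    exact ⟨h1.1, h1.2 _ (xCount_succ hj1) 0⟩
  · rw [Finset.mem_Icc] at hi
    split_ifs with hij
    · subst hij; simp
    · omega

theorem isControlled_mid {j : ℕ} (hj1 : 1 ≤ j) (hj : j < μ)
    (h0 : IsControlled (createdStaircase E tr) (blockResidual k E μ m tr (j + xCount m j))
      (horizTranslate E (xCount m j)) (blockOrder E μ m tr (j + 1)) j
      fun i => stairLength E (tr i - 1) - stairLength E (tr (j + 1) - 1) - (j - i) + (m j - 1))
    {e : ℕ} (he : e < m j) :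
    IsControlled (createdStaircase E tr) (blockResidual k E μ m tr (j + xCount m j + e))
      (horizTranslate E (xCount m j + e)) (blockOrder E μ m tr (j + 1)) j
      fun i => stairLength E (tr i - 1) - stairLength E (tr (j + 1) - 1) - (j - i) +
        (m j - 1 - e) := by
  induction e with
  | zero => exact h0
  | succ e ih =>
    have hjm : j ∈ Finset.Icc 1 μ := Finset.mem_Icc.2 ⟨hj1, hj.le⟩
    rw [h.blockResidual_varX k hjm he]
    -- The order is constant inside the block, so adjoining T^p again is a truncation by 0.
    refine (((ih (by omega)).colon_varX (h.stair.horizTranslate _) fun i hi => ?_).truncate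
      (c := 0) ((h.stair.horizTranslate _).horizTranslate _)
      fun i _ => h.createdStaircase_isDiagonal i).congr ?_ fun i hi => ?_
    · have h1 := h.step_conditions (e := e) hi hj
      exact ⟨by omega, h1.2 _ rfl _⟩
    · rw [horizTranslate_horizTranslate]; congr 1; omega
    · omega

/-- The drop of the order adds to every shift the difference of two stair lengths plus m_(j+1) - 1;
the latter part is used up by the x-steps of the block. -/
theorem isControlled_first {j : ℕ} (hj : j + 1 < μ)
    (hpre : IsControlled (createdStaircase E tr) (blockResidual k E μ m tr (j + xCount m (j + 1)))
      (horizTranslate E (xCount m (j + 1))) (blockOrder E μ m tr (j + 1)) j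
      fun i => stairLength E (tr i - 1) - stairLength E (tr (j + 1) - 1) - (j - i)) :
    IsControlled (createdStaircase E tr)
      (blockResidual k E μ m tr (j + 1 + xCount m (j + 1)))
      (horizTranslate E (xCount m (j + 1))) (blockOrder E μ m tr (j + 2)) (j + 1)
      fun i => stairLength E (tr i - 1) - stairLength E (tr (j + 2) - 1) - (j + 1 - i) +
        (m (j + 1) - 1) := by
  rw [h.blockResidual_sub k (by omega)]
  have h1 := h.isControlled_after_sub (by omega) hpre
  have hxc := xCount_succ (m := m) (show 1 ≤ j + 1 by omega)
  have h2 := h.stairLength_add_two_le (by omega : 1 ≤ j + 1) hj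
  have h3 := h.xCount_lt (by omega : 1 ≤ j + 2) hj
  have h4 := xCount_mono m (show j + 2 ≤ μ + 1 by omega)
  have e : blockOrder E μ m tr (j + 1) = blockOrder E μ m tr (j + 2) +
      (stairLength E (tr (j + 1) - 1) - stairLength E (tr (j + 2) - 1) + (m (j + 1) - 1)) := by
    rw [blockOrder_eq (by omega : j + 1 ≤ μ), blockOrder_eq (by omega : j + 2 ≤ μ)]
    rw [show j + 1 + 1 = j + 2 by ring] at hxc h2
    omega
  rw [e] at h1
  refine (h1.truncate (h.stair.horizTranslate _)
    fun i _ => h.createdStaircase_isDiagonal i).congr rfl fun i hi => ?_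
  rw [Finset.mem_Icc] at hi
  have h5 := h.stairLength_add_le hi.1 hi.2 (by omega)
  rw [show j + 1 + 1 = j + 2 by ring] at h2
  omega

theorem isControlled_pre {j : ℕ} (hj : j < μ) :
    IsControlled (createdStaircase E tr) (blockResidual k E μ m tr (j + xCount m (j + 1)))
      (horizTranslate E (xCount m (j + 1))) (blockOrder E μ m tr (j + 1)) j
      fun i => stairLength E (tr i - 1) - stairLength E (tr (j + 1) - 1) - (j - i) := by
  induction j with
  | zero =>
    have h0 : xCount m (0 + 1) = 0 := by simp [xCount]
    rw [h0, horizTranslate_zero]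
    have := isControlled_base (k := k) (createdStaircase E tr) E (blockOrder E μ m tr 1)
      (fun i => stairLength E (tr i - 1) - stairLength E (tr (0 + 1) - 1) - (0 - i))
    rw [← stepOrder_one] at this ⊢
    exact this
  | succ j ih =>
    have h1 := h.isControlled_first hj (ih (by omega))
    have hm := h.one_le_m (j + 1) (Finset.mem_Icc.2 ⟨by omega, by omega⟩)
    have h2 := h.isControlled_mid (by omega) hj h1 (e := m (j + 1) - 1) (by omega)
    have hxc := xCount_succ (m := m) (show 1 ≤ j + 1 by omega)
    rw [show j + 1 + xCount m (j + 1) + (m (j + 1) - 1) = j + 1 + xCount m (j + 1 + 1) by omega,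
      ← hxc] at h2
    exact h2.congr rfl fun i _ => by omega

theorem isControlled_block {j : ℕ} (hj1 : 1 ≤ j) (hj : j < μ) {e : ℕ} (he : e < m j) :
    IsControlled (createdStaircase E tr) (blockResidual k E μ m tr (j + xCount m j + e))
      (horizTranslate E (xCount m j + e)) (blockOrder E μ m tr (j + 1)) j
      fun i => stairLength E (tr i - 1) - stairLength E (tr (j + 1) - 1) - (j - i) +
        (m j - 1 - e) := by
  obtain ⟨j, rfl⟩ : ∃ l, j = l + 1 := ⟨j - 1, by omega⟩
  exact h.isControlled_mid hj1 hj (h.isControlled_first hj (h.isControlled_pre (by omega))) he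

/-- With `G` i the deletion of slices i, …, μ, the rows of `G` i below tr_i form the translate by
`A` i of the i-th created staircase, and the other rows are those of `G` (i + 1). -/
theorem blockResidual_last :
    blockResidual k E μ m tr (μ + xCount m μ) =
      familyIdeal k (deletedStaircase E μ tr (xCount m μ) 1) ⊔ Ideal.span {X ^ 1} := by
  obtain ⟨ν, rfl⟩ : ∃ l, μ = l + 1 := ⟨μ - 1, by have := h.pos; omega⟩
  have h1 := h.isControlled_after_sub (k := k) (Nat.lt_succ_self ν)
    (h.isControlled_pre (Nat.lt_succ_self ν))
  have hx := xCount_mono m (show ν + 1 ≤ ν + 1 + 1 by omega)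
  have hl := h.last
  have e : blockOrder E (ν + 1) m tr (ν + 1) =
      1 + (stairLength E (tr (ν + 1) - 1) - xCount m (ν + 1) - 1) := by
    rw [blockOrder_eq le_rfl]; omega
  rw [e] at h1
  have h2 := h1.truncate (h.stair.horizTranslate _)
    fun i _ => h.createdStaircase_isDiagonal i
  have h3 := h.blockResidual_sub k (Nat.lt_succ_self ν)
  rw [blockOrder_eq_one (by omega)] at h3
  rw [← h3] at h2
  set μ := ν + 1 with hμ
  have hG : horizTranslate E (xCount m μ) = deletedStaircase E μ tr (xCount m μ) (μ + 1) := by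
    ext ⟨a, b⟩
    rw [mem_horizTranslate, ← stairLength_le_iff h.stair h.fin, mem_deletedStaircase]
    simp [countAbove]
  set A : ℕ → ℕ := fun i => stairLength E (tr i - 1) - xCount m μ - 1 - (μ - i) with hA
  have hAi : ∀ i ∈ Finset.Icc 1 μ,
      A i + (xCount m μ + 1 + (μ - i)) = stairLength E (tr i - 1) := by
    intro i hi
    rw [Finset.mem_Icc] at hi
    have := h.stairLength_add_le hi.1 hi.2 le_rfl
    simp only [hA]
    omega
  have h4 : IsControlled (createdStaircase E tr) (blockResidual k E μ m tr (μ + xCount m μ))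
      (deletedStaircase E μ tr (xCount m μ) (μ + 1)) 1 μ A := by
    refine h2.congr hG fun i hi => ?_
    have e1 := hAi i hi
    rw [Finset.mem_Icc] at hi
    have := h.stairLength_add_le hi.1 hi.2 le_rfl
    omega
  refine h4.eq_of_deletion_chain (G := fun i => deletedStaircase E μ tr (xCount m μ) i)
    (fun i _ => h.createdStaircase_isDiagonal i) ?_ ?_ ?_ ?_
  · intro i hi c d hc hcA hd
    have e1 := hAi i hi
    have htr := h.one_le_tr i hi
    rw [Finset.mem_Icc] at hi
    -- One diagonal step from (ℓ_E(tr_i - 1), d) lands in column ℓ_E(tr_i - 1) - 1, which no row of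
    -- E at height at most tr_i - 1 reaches.
    have hd' : tr i ≤ d + 1 := by
      rw [mem_horizTranslate] at hd
      have h5 : (stairLength E (tr i - 1) - 1, d + 1) ∈ E := by
        apply h.diag
        convert hd using 2
        omega
      by_contra hlt
      have h6 := h.stair.mem_of_le h5 le_rfl (show d + 1 ≤ tr i - 1 by omega)
      rw [← stairLength_le_iff h.stair h.fin] at h6
      omega
    -- Along the diagonal leaving (`A` i, tr_i - 1), the first step enters `G` (i + 1) by the gap at
    -- tr_i, or for i = μ possibly by translation; the later ones stay by diagonality.
    have key : ∀ c, 1 ≤ c → c ≤ A i →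
        (A i - c, tr i - 1 + c) ∈ deletedStaircase E μ tr (xCount m μ) (i + 1) := by
      intro c hc
      induction c, hc using Nat.le_induction with
      | base =>
        intro hA1
        rw [Nat.sub_add_cancel htr, mem_deletedStaircase]
        rcases hi.2.eq_or_lt with rfl | hlt
        · have := h.gap_last
          by_contra h7
          have := this (by omega)
          omega
        · have h7 := h.gap i hi.1 hlt
          have h8 := h.countAbove_eq_of_lt (by omega : 1 ≤ i + 1)
            (h.tr_lt i (i + 1) hi.1 (by omega) hlt)
          omega
      | succ c hc ih =>
        intro hA1
        have h7 := h.deletedStaircase_isDiagonal (by omega : 1 ≤ i + 1) (A i - (c + 1))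
          (tr i - 1 + c) (by
            have := ih (by omega)
            rwa [show A i - c = A i - (c + 1) + 1 by omega] at this)
        rwa [add_assoc] at h7
    exact (h.deletedStaircase_isStaircase _ (by omega : 1 ≤ i + 1)).mem_of_le (key c hc hcA)
      le_rfl (by omega)
  · intro i hi
    rintro ⟨a, b⟩ hab
    rw [mem_deletedStaircase] at hab ⊢
    have := countAbove_succ_le (μ := μ) (tr := tr) i b
    omega
  · intro i hi x b hx
    have e1 := hAi i hi
    rw [Finset.mem_Icc] at hi
    rw [mem_horizTranslate, ← stairLength_le_iff h.stair h.fin] at hx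
    rw [mem_deletedStaircase]
    rcases lt_or_ge b (tr i) with hb | hb
    · rw [h.countAbove_eq_of_lt hi.1 hb]
      omega
    · rw [countAbove_eq_of_le hb]
      have h5 := h.stairLength_add_countAbove_le (by omega : 1 ≤ i + 1) hb
      have h6 := h.stairLength_tr_lt hi.1 hi.2
      have h7 : countAbove μ tr (i + 1) (tr i) = μ - i := by
        rcases hi.2.eq_or_lt with hiμ | hlt
        · simp [countAbove, hiμ]
        · rw [h.countAbove_eq_of_lt (by omega) (h.tr_lt i (i + 1) hi.1 (by omega) hlt)]
          omega
      omega
  · intro i hi c b hcb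
    have e1 := hAi i hi
    have htr := h.one_le_tr i hi
    rw [Finset.mem_Icc] at hi
    rcases lt_or_ge b (tr i) with hb | hb
    · right
      rw [mem_deletedStaircase, h.countAbove_eq_of_lt hi.1 hb] at hcb
      have h5 := stairLength_antitone h.stair h.fin (show b ≤ tr i - 1 by omega)
      refine ⟨c - A i, by omega, ?_⟩
      rw [mem_horizTranslate, ← stairLength_le_iff h.stair h.fin]
      omega
    · left
      rw [mem_deletedStaircase] at hcb ⊢
      rwa [countAbove_eq_of_le hb] at hcb

theorem blockResidual_last_add {e : ℕ} (he : e < m μ) :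
    blockResidual k E μ m tr (μ + xCount m μ + e) =
      familyIdeal k (deletedStaircase E μ tr (xCount m μ + e) 1) ⊔ Ideal.span {X ^ 1} := by
  induction e with
  | zero => exact h.blockResidual_last
  | succ e ih =>
    have hμ : μ ∈ Finset.Icc 1 μ := Finset.mem_Icc.2 ⟨h.pos, le_rfl⟩
    rw [h.blockResidual_varX k hμ he, ih (by omega), blockOrder_eq_one (by omega)]
    have hst := h.deletedStaircase_isStaircase (xCount m μ + e) le_rfl
    have e1 : Submodule.colon (familyIdeal k (deletedStaircase E μ tr (xCount m μ + e) 1) ⊔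
        Ideal.span {X ^ 1}) {C (varX k)} =
        familyIdeal k (deletedStaircase E μ tr (xCount m μ + (e + 1)) 1) ⊔
          Ideal.span {X ^ 1} := by
      ext g
      rw [Submodule.mem_colon_singleton, smul_eq_mul, mul_comm, mem_map_C_sup_span_X_pow,
        mem_map_C_sup_span_X_pow]
      refine forall₂_congr fun i _ => ?_
      rw [coeff_C_mul, varX_mul_mem_monomialIdeal_iff hst, horizTranslate_deletedStaircase,
        show 1 + (xCount m μ + e) = xCount m μ + (e + 1) by ring]
    rw [e1, sup_assoc, sup_idem]

/-- Slice p - 1 of τ(E, n_(j+1)) is slice ℓ_E(tr_(j+1) - 1) - 1 of E. Its height is tr_(j+1) because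
the stair length drops strictly there. -/
theorem rank_trace_sub {j : ℕ} (hj : j < μ) :
    Module.rank k (FamilyPoly k ⧸ Submodule.colon
      (blockResidual k E μ m tr (j + xCount m (j + 1)) ⊔ Ideal.span {C (diffFX k) - X})
      {(X : FamilyPoly k) ^ (blockOrder E μ m tr (j + 1) - 1)} ⊔ Ideal.span {X}) =
        (tr (j + 1) : Cardinal) := by
  have htr := h.one_le_tr (j + 1) (Finset.mem_Icc.2 ⟨by omega, hj⟩)
  have h1 := h.xCount_lt (by omega : 1 ≤ j + 1) (by omega : j + 1 ≤ μ)
  have h2 := xCount_mono m (show j + 1 ≤ μ + 1 by omega)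
  have h3 := h.stairLength_tr_lt (by omega : 1 ≤ j + 1) (by omega : j + 1 ≤ μ)
  refine (h.isControlled_pre hj).rank_trace_sub (h.stair.horizTranslate _)
    (h.diag.horizTranslate _) (h.one_le_blockOrder (by omega)) (fun i hi => ?_) ?_ fun b hb => ?_
  · have hj1 : 1 ≤ j := by rw [Finset.mem_Icc] at hi; omega
    exact (h.step_conditions (e := m j - 1) hi hj).2 _ (xCount_succ hj1) 0
  · rw [mem_horizTranslate, ← stairLength_le_iff h.stair h.fin, blockOrder_eq (by omega : j + 1 ≤ μ)]
    omega
  · rw [mem_horizTranslate, blockOrder_eq (by omega : j + 1 ≤ μ)] at hb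
    by_contra hlt
    have h4 := h.stair.mem_of_le hb le_rfl (show b ≤ tr (j + 1) - 1 by omega)
    rw [← stairLength_le_iff h.stair h.fin] at h4
    omega

/-- In the last block the monomial part is a deleted staircase, but the slices met there are among
the first n_(μ+1), which agree with those of E. -/
theorem rank_trace_varX {j : ℕ} (hj : j ∈ Finset.Icc 1 μ) {e : ℕ} (he : e + 1 < m j) :
    Module.rank k (FamilyPoly k ⧸ Submodule.colon
      (blockResidual k E μ m tr (j + xCount m j + e) ⊔ Ideal.span {C (varX k)})
      {(X : FamilyPoly k) ^ (blockOrder E μ m tr (j + 1) - 1)} ⊔ Ideal.span {X}) =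
        (sliceHeight E (xCount m j + e) : Cardinal) := by
  have hj' := Finset.mem_Icc.1 hj
  rcases hj'.2.eq_or_lt with rfl | hlt
  · have hK := isControlled_base (k := k) (createdStaircase E tr)
      (deletedStaircase E j tr (xCount m j + e) 1) 1 fun _ => 0
    rw [← h.blockResidual_last_add (by omega)] at hK
    rw [blockOrder_eq_one (by omega)]
    have hx : xCount m j + e < xCount m (j + 1) := by rw [xCount_succ hj'.1]; omega
    have hiff : ∀ b, (0, b) ∈ deletedStaircase E j tr (xCount m j + e) 1 ↔
        sliceHeight E (xCount m j + e) ≤ b := by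
      intro b
      rw [sliceHeight_le_iff h.stair h.fin, ← h.mem_deletedStaircase_iff_mem hx,
        mem_deletedStaircase, mem_deletedStaircase, zero_add, add_zero]
    refine hK.rank_trace_varX le_rfl (fun i hi => by simp at hi) ((hiff _).2 le_rfl)
      fun b hb => (hiff b).1 hb
  · have hiff : ∀ b, (0, b) ∈ horizTranslate E (xCount m j + e) ↔
        sliceHeight E (xCount m j + e) ≤ b := by
      intro b
      rw [sliceHeight_le_iff h.stair h.fin, mem_horizTranslate, zero_add]
    refine (h.isControlled_block hj'.1 hlt (by omega : e < m j)).rank_trace_varX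
      (h.one_le_blockOrder (by omega)) (fun i hi => ?_) ((hiff _).2 le_rfl)
      fun b hb => (hiff b).1 hb
    exact (h.step_conditions (e := e) hi hlt).2 _ rfl _

end IsAdmissible
end BlockInduction
end StaircaseTraces

namespace StaircaseTraces

open Polynomial

/-! ### From the polynomial model back to power series. -/

section Bridge

/-- Since t^p = t · t^(p-1), a multiple of t^p is compensated by changing the colon element by a
multiple of t. -/
theorem colon_sup_span_pow {B : Type*} [CommRing B] (J Y : Ideal B) (t : B) {p : ℕ} (hp : 1 ≤ p) :
    Submodule.colon (J ⊔ Ideal.span {t ^ p} ⊔ Y) {t ^ (p - 1)} ⊔ Ideal.span {t} =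
      Submodule.colon (J ⊔ Y) {t ^ (p - 1)} ⊔ Ideal.span {t} := by
  apply le_antisymm
  · refine sup_le (fun g hg => ?_) le_sup_right
    rw [Submodule.mem_colon_singleton, smul_eq_mul, sup_right_comm] at hg
    obtain ⟨j, hj, w, hw, h⟩ := Submodule.mem_sup.1 hg
    obtain ⟨a, rfl⟩ := Ideal.mem_span_singleton'.1 hw
    refine Submodule.mem_sup.2 ⟨g - a * t, ?_, a * t,
      Ideal.mul_mem_left _ _ (Ideal.mem_span_singleton_self _), by ring⟩
    have ht : t ^ p = t * t ^ (p - 1) := by rw [← pow_succ', Nat.sub_add_cancel hp]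
    rw [Submodule.mem_colon_singleton, smul_eq_mul]
    rw [ht] at h
    have e : (g - a * t) * t ^ (p - 1) = j := by linear_combination -h
    rwa [e]
  · refine sup_le_sup_right (fun g hg => ?_) _
    rw [Submodule.mem_colon_singleton] at hg ⊢
    exact (sup_le_sup_right le_sup_left Y : J ⊔ Y ≤ J ⊔ Ideal.span {t ^ p} ⊔ Y) hg

universe u
variable (k : Type u) [Field k]

theorem familyHom_diffFX_sub : familyHom k (C (diffFX k) - X) = PowerSeries.C (coordY k) := by
  rw [map_sub, diffFX, C_sub, map_sub, familyHom_X, familyHom_varX, familyHom_varF, movingLine]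
  ring

theorem familyHom_stepElement (μ : ℕ) (m : ℕ → ℕ) (i : ℕ) :
    familyHom k (stepElement k μ m i) = PowerSeries.C (blockSeq k μ m i) := by
  unfold stepElement blockSeq
  split_ifs
  · exact familyHom_diffFX_sub k
  · exact familyHom_varX k

theorem map_familyIdeal (E : Set (ℕ × ℕ)) :
    (familyIdeal k E).map (familyHom k) = staircaseIdeal k E := by
  rw [familyIdeal, monomialIdeal, staircaseIdeal, Ideal.map_span, Ideal.map_span,
    Set.image_image, Set.image_image]
  congr 1
  refine Set.image_congr' fun e => ?_
  rw [C_mul, C_pow, C_pow, map_mul, map_pow, map_pow, familyHom_varX, familyHom_varF]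

variable {k} {E : Set (ℕ × ℕ)}

theorem exists_powerIdeal_le (hE : IsStaircase E) (hfin : Eᶜ.Finite) (p : ℕ) :
    ∃ N, powerIdeal k N ≤ familyIdeal k E ⊔ Ideal.span {X ^ p} := by
  have ha : (stairLength E 0, 0) ∈ E := (stairLength_le_iff hE hfin).1 le_rfl
  have hb : (0, sliceHeight E 0) ∈ E := (sliceHeight_le_iff hE hfin).1 le_rfl
  refine ⟨stairLength E 0 + sliceHeight E 0 + p, ?_⟩
  rw [powerIdeal, Ideal.span_le]
  have key : ∀ e ∈ E, (C (varX k ^ e.1 * varF k ^ e.2) : FamilyPoly k) ∈ familyIdeal k E :=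
    fun e he => Ideal.mem_map_of_mem _ (Ideal.subset_span ⟨e, he, rfl⟩)
  rintro g (rfl | rfl | rfl)
  · have := key _ (hE.mem_of_le ha (Nat.le_add_right _ (sliceHeight E 0 + p)) le_rfl)
    rw [pow_zero, mul_one, C_pow, ← add_assoc] at this
    exact Ideal.mem_sup_left this
  · have := key _ (hE.mem_of_le hb le_rfl
      (show sliceHeight E 0 ≤ stairLength E 0 + sliceHeight E 0 + p by omega))
    rw [pow_zero, one_mul, C_pow] at this
    exact Ideal.mem_sup_left this
  · exact Ideal.mem_sup_right (Ideal.mem_span_singleton.2 (pow_dvd_pow _ (Nat.le_add_left _ _)))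

theorem isCofinite_staircaseIdeal_sup (hE : IsStaircase E) (hfin : Eᶜ.Finite) (p : ℕ) :
    IsCofinite k (staircaseIdeal k E ⊔ Ideal.span {PowerSeries.X ^ p}) := by
  obtain ⟨N, hN⟩ := exists_powerIdeal_le (k := k) hE hfin p
  have := Ideal.map_mono (f := familyHom k) hN
  rw [Ideal.map_sup, map_familyIdeal, Ideal.map_span, Set.image_singleton, map_pow,
    familyHom_X] at this
  exact ⟨N, this⟩

theorem comap_staircaseIdeal_sup (hE : IsStaircase E) (hfin : Eᶜ.Finite) (p : ℕ) :
    (staircaseIdeal k E ⊔ Ideal.span {PowerSeries.X ^ p}).comap (familyHom k) =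
      familyIdeal k E ⊔ Ideal.span {X ^ p} := by
  obtain ⟨N, hN⟩ := exists_powerIdeal_le (k := k) hE hfin p
  have := comap_map_familyHom k hN
  rwa [Ideal.map_sup, map_familyIdeal, Ideal.map_span, Set.image_singleton, map_pow,
    familyHom_X] at this

theorem map_familyIdeal_sup (k : Type u) [Field k] (E : Set (ℕ × ℕ)) (p : ℕ) :
    (familyIdeal k E ⊔ Ideal.span {X ^ p}).map (familyHom k) =
      staircaseIdeal k E ⊔ Ideal.span {PowerSeries.X ^ p} := by
  rw [Ideal.map_sup, map_familyIdeal, Ideal.map_span, Set.image_singleton, map_pow, familyHom_X]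

theorem rank_quotient_specialFibre_staircaseIdeal (hE : IsStaircase E) (hfin : Eᶜ.Finite) :
    Module.rank k (PlaneRing k ⧸ specialFibre (staircaseIdeal k E)) = (Eᶜ.ncard : Cardinal) := by
  have h1 := (isCofinite_staircaseIdeal_sup (k := k) hE hfin 1).rank_quotient
  rw [comap_staircaseIdeal_sup hE hfin, pow_one, pow_one] at h1
  rw [rank_quotient_specialFibre, h1, ← rank_quotient_monomialIdeal (k := k) hE hfin]
  let ψ : FamilyPoly k →ₐ[k] PlanePoly k :=
    (Polynomial.aeval (0 : PlanePoly k)).restrictScalars k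
  have hψC : ∀ a : PlanePoly k, ψ (C a) = a := fun a => Polynomial.aeval_C _ _
  have hψ : Function.Surjective ψ := fun a => ⟨C a, hψC a⟩
  rw [← rank_quotient_comap_of_surjective ψ hψ]
  suffices familyIdeal k E ⊔ Ideal.span {(X : FamilyPoly k)} = (monomialIdeal k E).comap ψ by rw [this]
  ext g
  have h2 : ψ g = g.coeff 0 := (Polynomial.coeff_zero_eq_aeval_zero g).symm
  rw [Ideal.mem_comap, h2, ← pow_one (X : FamilyPoly k), mem_map_C_sup_span_X_pow]
  exact ⟨fun h => h 0 one_pos, fun h i hi => by rwa [Nat.lt_one_iff.1 hi]⟩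

theorem specialFibre_sup_X {R : Type*} [CommRing R] (J : Ideal (PowerSeries R)) :
    specialFibre (J ⊔ Ideal.span {PowerSeries.X}) = specialFibre J := by
  rw [specialFibre, Ideal.map_sup, Ideal.map_span, Set.image_singleton,
    PowerSeries.constantCoeff_X, Ideal.span_singleton_zero, sup_bot_eq, specialFibre]

end Bridge

/-! ### Iterated residuals and traces in the polynomial model. -/

section Transfer

universe u
variable {k : Type u} [Field k] {E : Set (ℕ × ℕ)} {μ : ℕ} {m : ℕ → ℕ} {p : ℕ → ℕ}

/-- Adjoining in advance the power of t needed at the next step makes the initial family cofinite.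
Residuals only enlarge it, so sums and colons can be contracted at every step. -/
theorem isCofinite_and_comap_iterResidualFamily (hE : IsStaircase E) (hfin : Eᶜ.Finite) (i : ℕ) :
    IsCofinite k (iterResidualFamily (staircaseIdeal k E) (blockSeq k μ m) p i ⊔
      Ideal.span {PowerSeries.X ^ p (i + 1)}) ∧
    (iterResidualFamily (staircaseIdeal k E) (blockSeq k μ m) p i ⊔
      Ideal.span {PowerSeries.X ^ p (i + 1)}).comap (familyHom k) =
        residualSeq E (stepElement k μ m) p i := by
  induction i with
  | zero => exact ⟨isCofinite_staircaseIdeal_sup hE hfin _, comap_staircaseIdeal_sup hE hfin _⟩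
  | succ i ih =>
    obtain ⟨ih1, ih2⟩ := ih
    have hc : IsCofinite k (iterResidualFamily (staircaseIdeal k E) (blockSeq k μ m) p (i + 1)) :=
      ih1.mono (le_colon_singleton _ _)
    refine ⟨hc.mono le_sup_left, ?_⟩
    have hX : (PowerSeries.X : PowerSeries (PlaneRing k)) ^ p (i + 1 + 1) =
        familyHom k (X ^ p (i + 2)) := by rw [map_pow, familyHom_X]
    rw [hX, hc.comap_sup_span, residualSeq, ← ih2, iterResidualFamily, residualFamily,
      ← familyHom_stepElement, comap_colon_singleton]

theorem traceDim_eq_rank (hE : IsStaircase E) (hfin : Eᶜ.Finite) (i : ℕ) (hp : 1 ≤ p (i + 1)) :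
    traceDim k (staircaseIdeal k E) (blockSeq k μ m) p (i + 1) =
      Module.rank k (FamilyPoly k ⧸ Submodule.colon
        (residualSeq E (stepElement k μ m) p i ⊔ Ideal.span {stepElement k μ m (i + 1)})
        {(X : FamilyPoly k) ^ (p (i + 1) - 1)} ⊔ Ideal.span {X}) := by
  obtain ⟨h1, h2⟩ := isCofinite_and_comap_iterResidualFamily (k := k) (μ := μ) (m := m) (p := p)
    hE hfin i
  rw [traceDim, iterTrace, rank_quotient_traceIdeal, Nat.add_sub_cancel,
    ← colon_sup_span_pow _ _ _ hp, ← h2, ← h1.comap_sup_span, ← comap_colon_singleton]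
  have h3 := h1.mono (le_sup_left (b := Ideal.span {familyHom k (stepElement k μ m (i + 1))}))
  have h4 := h3.mono (le_colon_singleton _ (familyHom k (X ^ (p (i + 1) - 1))))
  rw [← h4.comap_sup_span, ← (h4.mono le_sup_left).rank_quotient, familyHom_stepElement, map_pow,
    familyHom_X]

end Transfer

end StaircaseTraces

namespace StaircaseTraces

open Polynomial

/-! ### Trace dimensions, final residual and conservation of conditions. -/

namespace IsAdmissible

universe u
variable {k : Type u} [Field k] {E : Set (ℕ × ℕ)} {μ : ℕ} {m tr : ℕ → ℕ}
  (h : IsAdmissible E μ m tr)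
include h

theorem sum_eq_add_xCount : ∑ l ∈ Finset.Icc 1 μ, m l = μ + xCount m (μ + 1) := by
  have := h.one_add_sum_eq (show 1 ≤ μ + 1 by omega) le_rfl
  have e : Finset.Ico 1 (μ + 1) = Finset.Icc 1 μ := by
    ext i
    simp only [Finset.mem_Ico, Finset.mem_Icc]
    omega
  rw [e] at this
  omega

theorem stepOrder_first {j : ℕ} (hj : j < μ) :
    stepOrder E μ m tr (j + xCount m (j + 1) + 1) = blockOrder E μ m tr (j + 1) := by
  rcases j.eq_zero_or_pos with rfl | hj0
  · have h0 : xCount m (0 + 1) = 0 := by simp [xCount]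
    rw [h0]
    exact stepOrder_one
  · have hj' : j ∈ Finset.Icc 1 μ := Finset.mem_Icc.2 ⟨hj0, hj.le⟩
    rw [← h.stepOrder_eq hj' (h.one_le_m j hj') le_rfl, ← h.position_succ hj']
    congr 1
    ring

theorem traceDim_sub {j : ℕ} (hj : j < μ) :
    traceDim k (staircaseIdeal k E) (blockSeq k μ m) (stepOrder E μ m tr)
      (j + xCount m (j + 1) + 1) = (tr (j + 1) : Cardinal) := by
  have h1 := h.stepElement_sub k (Finset.mem_Icc.2 ⟨(by omega : 1 ≤ j + 1), hj⟩)
  rw [add_right_comm] at h1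
  rw [traceDim_eq_rank h.stair h.fin _ (h.one_le_stepOrder _), h.stepOrder_first hj, h1]
  exact h.rank_trace_sub hj

theorem traceDim_varX {j : ℕ} (hj : j ∈ Finset.Icc 1 μ) {e : ℕ} (he : e + 1 < m j) :
    traceDim k (staircaseIdeal k E) (blockSeq k μ m) (stepOrder E μ m tr)
      (j + xCount m j + e + 1) = (sliceHeight E (xCount m j + e) : Cardinal) := by
  rw [traceDim_eq_rank h.stair h.fin _ (h.one_le_stepOrder _), add_assoc _ e 1,
    h.stepElement_varX k hj (by omega) he, h.stepOrder_eq hj (by omega) he.le]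
  exact h.rank_trace_varX hj he

variable (k) in
theorem iterResidual_last :
    iterResidual (staircaseIdeal k E) (blockSeq k μ m) (stepOrder E μ m tr)
        (μ + xCount m (μ + 1)) =
      specialFibre (staircaseIdeal k
        (horizTranslate (deletedStaircase E μ tr 0 1) (xCount m (μ + 1)))) := by
  have hμ : μ ∈ Finset.Icc 1 μ := Finset.mem_Icc.2 ⟨h.pos, le_rfl⟩
  have hm := h.one_le_m μ hμ
  have hx := xCount_succ (m := m) h.pos
  have hM : μ + xCount m μ + (m μ - 1) = μ + xCount m (μ + 1) := by omega
  obtain ⟨h1, h2⟩ := isCofinite_and_comap_iterResidualFamily (k := k) (μ := μ) (m := m)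
    (p := stepOrder E μ m tr) h.stair h.fin (μ + xCount m (μ + 1))
  have h3 := h.blockResidual_last_add (k := k) (show m μ - 1 < m μ by omega)
  rw [hM, ← hx, blockResidual] at h3
  have h4 := h1.map_comap
  have h5 := h.stepOrder_eq hμ hm le_rfl
  rw [show μ + xCount m μ + m μ = μ + xCount m (μ + 1) + 1 by omega,
    blockOrder_eq_one (by omega)] at h5
  rw [h2, h5, h3, map_familyIdeal_sup, pow_one] at h4
  rw [iterResidual, ← specialFibre_sup_X, ← h4, specialFibre_sup_X,
    horizTranslate_deletedStaircase, add_zero]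

theorem sum_blocks {A : Type*} [AddCommMonoid A] (f g t : ℕ → A)
    (hf : ∀ j < μ, f (j + xCount m (j + 1)) = t j)
    (hg : ∀ j ∈ Finset.Icc 1 μ, ∀ e, e + 1 < m j → f (j + xCount m j + e) = g (xCount m j + e))
    {j : ℕ} (hj : j ≤ μ) :
    ∑ i ∈ Finset.range (j + xCount m (j + 1)), f i =
      ∑ a ∈ Finset.range (xCount m (j + 1)), g a + ∑ i ∈ Finset.range j, t i := by
  induction j with
  | zero => simp [xCount]
  | succ j ih =>
    have hj' : j + 1 ∈ Finset.Icc 1 μ := Finset.mem_Icc.2 ⟨by omega, hj⟩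
    have key : ∀ e < m (j + 1), ∑ i ∈ Finset.range (j + 1 + xCount m (j + 1) + e), f i =
        ∑ a ∈ Finset.range (xCount m (j + 1) + e), g a + ∑ i ∈ Finset.range (j + 1), t i := by
      intro e
      induction e with
      | zero =>
        intro _
        rw [add_zero, add_zero, add_right_comm, Finset.sum_range_succ, ih (by omega),
          hf j (by omega), add_assoc, ← Finset.sum_range_succ]
      | succ e ihe =>
        intro he
        rw [← add_assoc, Finset.sum_range_succ, ihe (by omega), hg _ hj' e he, ← add_assoc,
          Finset.sum_range_succ _ (xCount m (j + 1) + e), add_right_comm]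
    have h1 := key (m (j + 1) - 1) (by have := h.one_le_m _ hj'; omega)
    rwa [add_assoc, ← xCount_succ (by omega)] at h1

variable (k) in
theorem sum_traceDim :
    ∑ i ∈ Finset.Icc 1 (μ + xCount m (μ + 1)),
      traceDim k (staircaseIdeal k E) (blockSeq k μ m) (stepOrder E μ m tr) i =
    ((∑ a ∈ Finset.range (xCount m (μ + 1)), sliceHeight E a + ∑ i ∈ Finset.Icc 1 μ, tr i : ℕ) :
      Cardinal) := by
  have h1 := h.sum_blocks
    (fun i => traceDim k (staircaseIdeal k E) (blockSeq k μ m) (stepOrder E μ m tr) (i + 1))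
    (fun a => (sliceHeight E a : Cardinal)) (fun i => (tr (i + 1) : Cardinal))
    (fun j hj => h.traceDim_sub hj) (fun j hj e he => h.traceDim_varX hj he) le_rfl
  rw [← Finset.Ico_add_one_right_eq_Icc, ← Finset.Ico_add_one_right_eq_Icc,
    Finset.sum_Ico_eq_sum_range, Finset.sum_Ico_eq_sum_range]
  simp only [Nat.add_sub_cancel, add_comm 1]
  rw [h1]
  push_cast
  rfl

theorem traceDim_add_residualDim :
    residualDim k (staircaseIdeal k E) (blockSeq k μ m) (stepOrder E μ m tr)
        (μ + xCount m (μ + 1)) +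
      ∑ i ∈ Finset.Icc 1 (μ + xCount m (μ + 1)),
        traceDim k (staircaseIdeal k E) (blockSeq k μ m) (stepOrder E μ m tr) i =
    residualDim k (staircaseIdeal k E) (blockSeq k μ m) (stepOrder E μ m tr) 0 := by
  have hF := h.deletedStaircase_isStaircase 0 le_rfl
  have hF' := h.finite_compl_deletedStaircase 0 1
  have h0 : residualDim k (staircaseIdeal k E) (blockSeq k μ m) (stepOrder E μ m tr) 0 =
      (Eᶜ.ncard : Cardinal) := rank_quotient_specialFibre_staircaseIdeal h.stair h.fin
  rw [h0, h.sum_traceDim k, residualDim, h.iterResidual_last k,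
    rank_quotient_specialFibre_staircaseIdeal (hF.horizTranslate _)
      (finite_compl_horizTranslate hF hF' _), ← Nat.cast_add,
    h.ncard_compl_horizTranslate_deletedStaircase]

end IsAdmissible

end StaircaseTraces

theorem mainTheorem8 {k : Type*} [Field k] (E : Set (ℕ × ℕ))
    (hE : IsStaircase E) (hfin : Eᶜ.Finite) (hgentle : IsGentle E)
    (μ : ℕ) (hμ : 1 ≤ μ) (m tr : ℕ → ℕ)
    (hm : ∀ i ∈ Finset.Icc 1 μ, 1 ≤ m i)
    (htr : ∀ i ∈ Finset.Icc 1 μ, 1 ≤ tr i)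
    (htr_lt : ∀ i j, 1 ≤ i → i < j → j ≤ μ → tr i < tr j)
    (h1 : ∀ i, 1 ≤ i → i < μ → stairDiff E (tr i - 1) ≥ (tr i : ℤ) + 1)
    (h2 : ∀ i, 1 ≤ i → i < μ →
      (stairLength E (tr i - 1) : ℤ) - (stairLength E (tr (i + 1) - 1) : ℤ) ≥
        (sliceHeight E (xCount m i) : ℤ))
    (h3 : stairLength E (tr μ - 1) > xCount m (μ + 1))
    (h4 : stairLength E (tr μ) > xCount m μ → stairDiff E (tr μ - 1) ≥ (tr μ : ℤ) + 1) :
    -- the staircase obtained by deleting slices of heights `tr_1, …, tr_μ` exists and is unique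
    (∃! F : Set (ℕ × ℕ), IsSliceDeletion E μ tr F) ∧
    ∃ p : ℕ → ℕ,
      -- `p_1 ≥ p_2 ≥ ⋯ ≥ p_M ≥ 1`, where `M = m_1 + ⋯ + m_μ`
      (∀ i ∈ Finset.Icc 1 (∑ l ∈ Finset.Icc 1 μ, m l), 1 ≤ p i) ∧
      (∀ i j, 1 ≤ i → i ≤ j → j ≤ ∑ l ∈ Finset.Icc 1 μ, m l → p j ≤ p i) ∧
      -- traces at the `y`-steps
      (∀ j ∈ Finset.Icc 1 μ,
        traceDim k (staircaseIdeal k E) (blockSeq k μ m) p (j + xCount m j) =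
          (tr j : Cardinal)) ∧
      -- traces at the `x`-steps
      (∀ j ∈ Finset.Icc 1 μ, ∀ i, j + xCount m j < i → i ≤ j + xCount m (j + 1) →
        traceDim k (staircaseIdeal k E) (blockSeq k μ m) p i =
          (sliceHeight E (i - j - 1) : Cardinal)) ∧
      -- the final residual
      (∀ F : Set (ℕ × ℕ), IsSliceDeletion E μ tr F →
        iterResidual (staircaseIdeal k E) (blockSeq k μ m) p (∑ l ∈ Finset.Icc 1 μ, m l) =
          specialFibre (staircaseIdeal k
            (horizTranslate F ((∑ l ∈ Finset.Icc 1 μ, m l) - μ)))) ∧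
      -- the number of conditions is preserved
      residualDim k (staircaseIdeal k E) (blockSeq k μ m) p (∑ l ∈ Finset.Icc 1 μ, m l) +
          ∑ i ∈ Finset.Icc 1 (∑ l ∈ Finset.Icc 1 μ, m l),
            traceDim k (staircaseIdeal k E) (blockSeq k μ m) p i =
        residualDim k (staircaseIdeal k E) (blockSeq k μ m) p 0 := by
  have h : IsAdmissible E μ m tr := by
    have hsub : ∀ i ∈ Finset.Icc 1 μ, tr i - 1 + 1 = tr i := fun i hi =>
      Nat.sub_add_cancel (htr i hi)
    refine ⟨hE, hfin, hgentle.isDiagonal hE hfin, hμ, hm, htr, htr_lt, fun i hi hiμ => ?_,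
      fun i hi hiμ => ?_, h3, fun hlt => ?_⟩
    · have h5 := h1 i hi hiμ
      have hi' : i ∈ Finset.Icc 1 μ := Finset.mem_Icc.2 ⟨hi, hiμ.le⟩
      have h6 := htr i hi'
      rw [stairDiff, hsub i hi'] at h5
      omega
    · have := h2 i hi hiμ
      omega
    · have h5 := h4 hlt
      have hi' : μ ∈ Finset.Icc 1 μ := Finset.mem_Icc.2 ⟨hμ, le_rfl⟩
      have h6 := htr μ hi'
      rw [stairDiff, hsub μ hi'] at h5
      omega
  refine ⟨⟨deletedStaircase E μ tr 0 1, h.isSliceDeletion_deletedStaircase,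
    fun F hF => h.eq_deletedStaircase hF⟩, stepOrder E μ m tr, fun i _ => h.one_le_stepOrder i,
    fun i j _ hij _ => h.stepOrder_antitone hij, fun j hj => ?_, fun j hj i hi hi' => ?_,
    fun F hF => ?_, ?_⟩
  · rw [Finset.mem_Icc] at hj
    obtain ⟨l, rfl⟩ : ∃ l, j = l + 1 := ⟨j - 1, by omega⟩
    rw [add_right_comm]
    exact h.traceDim_sub (by omega)
  · obtain ⟨e, rfl⟩ : ∃ e, i = j + xCount m j + e + 1 := ⟨i - (j + xCount m j) - 1, by omega⟩
    have hx := xCount_succ (m := m) (Finset.mem_Icc.1 hj).1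
    rw [h.traceDim_varX hj (by omega)]
    congr 2
    omega
  · rw [h.eq_deletedStaircase hF, h.sum_eq_add_xCount, Nat.add_sub_cancel_left]
    exact h.iterResidual_last k
  · rw [h.sum_eq_add_xCount]
    exact h.traceDim_add_residualDim
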